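/- **Setting.** Let $\mathfrak m\subset\mathbb C[[x,y_1,y_2]]$ be the maximal ideal, $\omega=\frac{dy_1\wedge dy_2}{x}$, and let $\langle dx\rangle$ be the ideal generated by $dx$ in the algebra of formal differential forms. A formal vector field $Y$ on $(\mathbb C^3,0)$ vanishing at the origin is *transversally Hamiltonian* if $\mathcal L_Y(dx)\in\langle dx\rangle$ and $x\mathcal L_Y(\omega)\in\langle dx\rangle$. A formal diffeomorphism $\Phi$ fixing the origin is *transversally symplectic* if $\Phi^*(x)=x$ and $x\Phi^*(\omega)\in x\omega+\langle dx\rangle$. A *transversally Hamiltonian doubly-resonant saddle-node* is a transversally Hamiltonian $Y$ that is conjugate, by a transversally symplectic diffeomorphism, to a field of the form $$x^2\partial_x+(-\mu y_1+F_1)\partial_{y_1}+(\mu y_2+F_2)\partial_{y_2},\qquad \mu\in\mathbb C^*,\ F_1,F_2\in\mathfrak m^2 .$$ Let $Y$ be such a field, let $\lambda\in\mathbb C^*$, and let $H(\mathbf y)=\lambda y_1y_2+o(\|\mathbf y\|^2)$ be analytic at the origin of $\mathbb C^2$. Assume that the restriction of $Y$ to $\{x=0\}$ is (the Taylor expansion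 of) the Hamiltonian vector field $$Y_0=J\nabla H=-\frac{\partial H}{\partial y_2}\partial_{y_1}+\frac{\partial H}{\partial y_1}\partial_{y_2}.$$ *Normal form.* Let $$X=x^2\partial_x+\bigl(-(\lambda+c(v))+a_1x\bigr)y_1\partial_{y_1}+\bigl(\lambda+c(v)+a_2x\bigr)y_2\partial_{y_2},\qquad v=y_1y_2,$$ with $a_1,a_2\in\mathbb C$, $a_1+a_2=1$ and $c\in v\,\mathbb C[[v]]$, denote a transversally Hamiltonian normal form of $Y$, i.e. $\Phi_*(Y)=X$ for some transversally symplectic $\Phi$. *Period map.* Let $r_1,r_2>0$ be sufficiently small, let $a\ne0$ be sufficiently small (depending on $r_1,r_2$), and put $L_a=\{H=a\}\cap\{|y_1|<r_1,|y_2|<r_2\}$. Let $\gamma_a$ be a $C^1$ loop in $L_a$ whose class generates $H_1(L_a,\mathbb Z)$, oriented so that it is homologous in $L_a$ to a loop along which $y_1$ runs once counterclockwise around a circle $|y_1|=s$ while $|y_2|<s$. Let $\tau$ be a time form of $Y_0$ along $\gamma_a$, that is, a $1$-form with $\tau(Y_0)=1$ at the points of $\gamma_a$ (for instance $-dy_1/\frac{\partial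 H}{\partial y_2}$ where $\frac{\partial H}{\partial y_2}\neq0$). Define $$T_H(a)=\frac1{2i\pi}\oint_{\gamma_a}\tau .$$ **Proposition.** 1. The invariant $c$ is the germ of an analytic function at $0$, i.e. the power series $c$ converges near $0$. 2. The level curve $L_a$ is connected, its group $H_1(L_a,\mathbb Z)$ is generated by the class of such a $C^1$ loop $\gamma_a$, every loop generating $H_1(L_a,\mathbb Z)$ is oriented in this way up to reversal, and $T_H(a)$ is well defined: it depends neither on $\gamma_a$, nor on $\tau$, nor on the small polydisc. The period map $T_H$ extends to an analytic function of $a$ near $0\in\mathbb C$, with $T_H(0)=-\frac1\lambda$. 3. Let $S_H$ be the primitive of $T_H$ near $0$ with $S_H(0)=0$. Then $-S_H$ is invertible for composition near $0$, with an analytic inverse $h$, $h(0)=0$, and near $0$ $$\frac{dh}{dv}(v)=\lambda+c(v).$$ -/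

import Mathlib

open Filter Topology Set

noncomputable section

/-- Formal power series in the three variables `x, y₁, y₂` (indexed by `0, 1, 2`). -/
abbrev Series3 := MvPowerSeries (Fin 3) ℂ

/-- The maximal ideal of formal power series with zero constant term. -/
def maxIdeal3 : Ideal Series3 := RingHom.ker (MvPowerSeries.constantCoeff (σ := Fin 3) (R := ℂ))

/-- A formal vector field `V 0 ∂/∂x + V 1 ∂/∂y₁ + V 2 ∂/∂y₂`, given by its components. -/
abbrev FormalField := Fin 3 → Series3

/-- A triple of formal power series, seen as a formal map. -/
abbrev FormalMap := Fin 3 → Series3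

/-- The vector field vanishes at the origin. -/
def FormalField.Singular (V : FormalField) : Prop := ∀ i, V i ∈ maxIdeal3

/-- Lie derivative of a function. -/
def FormalField.lie (V : FormalField) (f : Series3) : Series3 :=
  ∑ i, V i * MvPowerSeries.pderiv ℂ i f

/-- Formal `1`-forms `∑ α j dx_j`. -/
abbrev OneForm3 := Fin 3 → Series3

/-- Formal `2`-forms, given by their values `θ i j = θ(∂_i, ∂_j)` on the coordinate fields;
all the forms considered below are skew-symmetric. -/
abbrev TwoForm3 := Matrix (Fin 3) (Fin 3) Series3

/-- The coordinate form `dx_j`. -/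
def dCoord (j : Fin 3) : OneForm3 := Pi.single j 1

/-- Wedge product of two `1`-forms. -/
def wedge (α β : OneForm3) : TwoForm3 := Matrix.of fun i j => α i * β j - α j * β i

/-- Lie derivative of a `1`-form. -/
def FormalField.lieOne (V : FormalField) (α : OneForm3) : OneForm3 :=
  fun j => V.lie (α j) + ∑ k, α k * MvPowerSeries.pderiv ℂ j (V k)

/-- Lie derivative of a `2`-form. -/
def FormalField.lieTwo (V : FormalField) (θ : TwoForm3) : TwoForm3 :=
  Matrix.of fun i j => V.lie (θ i j) +
    ∑ k, (θ k j * MvPowerSeries.pderiv ℂ i (V k) + θ i k * MvPowerSeries.pderiv ℂ j (V k))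

/-- Pull-back of a `2`-form by a formal map. -/
def FormalMap.pullTwo (Φ : FormalMap) (θ : TwoForm3) : TwoForm3 :=
  Matrix.of fun i j => ∑ k, ∑ l, MvPowerSeries.subst Φ (θ k l) *
    MvPowerSeries.pderiv ℂ i (Φ k) * MvPowerSeries.pderiv ℂ j (Φ l)

/-- The `1`-form belongs to the ideal `⟨dx⟩`. -/
def OneInIdealDx (α : OneForm3) : Prop := ∃ f : Series3, α = f • dCoord 0

/-- The `2`-form belongs to the ideal `⟨dx⟩`, i.e. it is `dx ∧ η` for some `η`. -/
def TwoInIdealDx (θ : TwoForm3) : Prop := ∃ η : OneForm3, θ = wedge (dCoord 0) η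

/-- The transverse area form `dy₁ ∧ dy₂`; the rational form is `ω = (dy₁ ∧ dy₂) / x`. -/
def areaForm : TwoForm3 := wedge (dCoord 1) (dCoord 2)

/-- Transversally Hamiltonian singular vector fields: `L_V(dx) ∈ ⟨dx⟩` and `x L_V(ω) ∈ ⟨dx⟩`.
When `L_V(x) = x g`, one has `x L_V(θ / x) = L_V(θ) - g θ`. -/
def FormalField.TransvHamiltonian (V : FormalField) : Prop :=
  V.Singular ∧ OneInIdealDx (V.lieOne (dCoord 0)) ∧
    ∃ g : Series3, V.lie (MvPowerSeries.X 0) = MvPowerSeries.X 0 * g ∧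
      TwoInIdealDx (V.lieTwo areaForm - g • areaForm)

/-- Formal diffeomorphisms fixing the origin. -/
def FormalMap.IsDiffeo (Φ : FormalMap) : Prop :=
  (∀ i, Φ i ∈ maxIdeal3) ∧
    (Matrix.of fun i j : Fin 3 =>
      MvPowerSeries.constantCoeff (MvPowerSeries.pderiv ℂ j (Φ i))).det ≠ 0

/-- Transversally symplectic formal diffeomorphisms: `Φ^*(x) = x` and
`x Φ^*(ω) ∈ x ω + ⟨dx⟩`. -/
def FormalMap.TransvSymplectic (Φ : FormalMap) : Prop :=
  Φ.IsDiffeo ∧ Φ 0 = MvPowerSeries.X 0 ∧ TwoInIdealDx (Φ.pullTwo areaForm - areaForm)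

/-- `Φ_*(V) = W`, in the form `DΦ · V = W ∘ Φ`. -/
def IsPushforward (Φ : FormalMap) (V W : FormalField) : Prop :=
  ∀ i, V.lie (Φ i) = MvPowerSeries.subst Φ (W i)

/-- Transversally Hamiltonian doubly-resonant saddle-nodes. -/
def FormalField.IsHamSaddleNode (V : FormalField) : Prop :=
  V.TransvHamiltonian ∧
    ∃ (Φ : FormalMap) (μ : ℂ) (F₁ F₂ : Series3), Φ.TransvSymplectic ∧ μ ≠ 0 ∧
      F₁ ∈ maxIdeal3 ^ 2 ∧ F₂ ∈ maxIdeal3 ^ 2 ∧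
      IsPushforward Φ V
        ![MvPowerSeries.X 0 ^ 2,
          -(MvPowerSeries.C μ * MvPowerSeries.X 1) + F₁,
          MvPowerSeries.C μ * MvPowerSeries.X 2 + F₂]

/-- The vector field `x² ∂/∂x + (-(l + c(v)) + a₁ x) y₁ ∂/∂y₁ + (l + c(v) + a₂ x) y₂ ∂/∂y₂`,
with `v = y₁ y₂`. -/
def normalField (l a₁ a₂ : ℂ) (c : PowerSeries ℂ) : FormalField :=
  let cv : Series3 := PowerSeries.subst (MvPowerSeries.X 1 * MvPowerSeries.X 2 : Series3) c
  ![MvPowerSeries.X 0 ^ 2,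
    (-(MvPowerSeries.C l + cv) + MvPowerSeries.C a₁ * MvPowerSeries.X 0) * MvPowerSeries.X 1,
    (MvPowerSeries.C l + cv + MvPowerSeries.C a₂ * MvPowerSeries.X 0) * MvPowerSeries.X 2]

/-- `normalField l a₁ a₂ c` is a transversally Hamiltonian normal form of `V`. -/
def IsHamNormalForm (V : FormalField) (l a₁ a₂ : ℂ) (c : PowerSeries ℂ) : Prop :=
  a₁ + a₂ = 1 ∧ PowerSeries.constantCoeff c = 0 ∧
    ∃ Φ : FormalMap, Φ.TransvSymplectic ∧ IsPushforward Φ V (normalField l a₁ a₂ c)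

/-- Restriction of a formal power series to `{x = 0}`. -/
def restrictX0 (f : Series3) : MvPowerSeries (Fin 2) ℂ :=
  fun k => MvPowerSeries.coeff (Finsupp.cons 0 k) f

/-- The formal power series `f` converges near the origin and its sum is `F`. -/
def HasGerm (f : MvPowerSeries (Fin 2) ℂ) (F : ℂ × ℂ → ℂ) : Prop :=
  ∀ᶠ y in 𝓝 (0 : ℂ × ℂ),
    HasSum (fun k : Fin 2 →₀ ℕ => MvPowerSeries.coeff k f * (y.1 ^ k 0 * y.2 ^ k 1)) (F y)

/-- The Hamiltonian vector field `J∇H = -∂H/∂y₂ ∂/∂y₁ + ∂H/∂y₁ ∂/∂y₂`. -/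
def hamField (H : ℂ × ℂ → ℂ) (y : ℂ × ℂ) : ℂ × ℂ :=
  (-(fderiv ℂ H y (0, 1)), fderiv ℂ H y (1, 0))

/-- The restriction of `V` to `{x = 0}` is tangent to it and is the analytic field `J∇H`. -/
def RestrictsToHam (V : FormalField) (H : ℂ × ℂ → ℂ) : Prop :=
  restrictX0 (V 0) = 0 ∧ HasGerm (restrictX0 (V 1)) (fun y => (hamField H y).1) ∧
    HasGerm (restrictX0 (V 2)) (fun y => (hamField H y).2)

/-- The open polydisc of radii `r₁, r₂` centred at the origin. -/
def polydisc (r₁ r₂ : ℝ) : Set (ℂ × ℂ) := {y | ‖y.1‖ < r₁ ∧ ‖y.2‖ < r₂}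

/-- The leaf `{H = a}` in a polydisc. -/
def levelCurve (H : ℂ × ℂ → ℂ) (r₁ r₂ : ℝ) (a : ℂ) : Set (ℂ × ℂ) :=
  {y | y ∈ polydisc r₁ r₂ ∧ H y = a}

/-- The class of a loop in `H₁(L, ℤ) = π₁(L)^{ab}`, for `L` path connected. -/
def loopClass {L : Set (ℂ × ℂ)} {p : L} (γ : Path p p) :
    Abelianization (FundamentalGroup L p) :=
  Abelianization.of (FundamentalGroup.fromPath (Path.Homotopic.Quotient.mk γ))

/-- The class of the loop generates `H₁(L, ℤ)`. -/
def GeneratesH1 {L : Set (ℂ × ℂ)} {p : L} (γ : Path p p) : Prop :=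
  ∀ g : Abelianization (FundamentalGroup L p), g ∈ Subgroup.zpowers (loopClass γ)

/-- Two loops, possibly with different base points, are homologous in `L`. -/
def HomologousLoops {L : Set (ℂ × ℂ)} {p q : L} (γ : Path p p) (γ' : Path q q) : Prop :=
  ∃ σ : Path p q, loopClass γ = loopClass ((σ.trans γ').trans σ.symm)

/-- The orientation convention for loops in a level curve: `γ` is homologous to a loop along which
`|y₂| < |y₁|` and `y₁` runs once counterclockwise around a circle centred at `0`. -/
def PositivelyOriented {L : Set (ℂ × ℂ)} {p : L} (γ : Path p p) : Prop :=
  ∃ (q : L) (γ' : Path q q) (s : ℝ), 0 < s ∧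
    (∀ t : unitInterval, (γ' t).1.1 = s * Complex.exp (2 * Real.pi * Complex.I * (t : ℝ)) ∧
      ‖(γ' t).1.2‖ < s) ∧
    HomologousLoops γ γ'

/-- The loop is continuously differentiable, as a map into `ℂ²`. -/
def IsC1Loop {L : Set (ℂ × ℂ)} {p : L} (γ : Path p p) : Prop :=
  ContDiffOn ℝ 1 (fun t : ℝ => (γ.extend t : ℂ × ℂ)) (Icc 0 1)

/-- `τ` is a time form of the vector field `Z` along `γ`: `τ(Z) = 1`. -/
def IsTimeForm {L : Set (ℂ × ℂ)} {p : L} (γ : Path p p) (Z : ℂ × ℂ → ℂ × ℂ)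
    (τ : ℂ × ℂ → (ℂ × ℂ) →L[ℂ] ℂ) : Prop :=
  ∀ t : unitInterval, τ (γ t) (Z (γ t)) = 1

/-- `(1 / 2iπ) ∮_γ τ`. -/
def loopPeriod {L : Set (ℂ × ℂ)} {p : L} (γ : Path p p)
    (τ : ℂ × ℂ → (ℂ × ℂ) →L[ℂ] ℂ) : ℂ :=
  (2 * Real.pi * Complex.I)⁻¹ * curveIntegral τ (γ.map continuous_subtype_val)

/-- `T` is the period map of `H` near the origin: in every small polydisc and for every small
`a ≠ 0`, the level curve `L_a` is connected, its first homology group has a generator, which is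
positively oriented up to reversal, and `T a = (1 / 2iπ) ∮_{γ_a} τ` for every positively oriented
generator `γ_a` and every time form `τ` of `J∇H`. -/
def IsPeriodMap (H : ℂ × ℂ → ℂ) (T : ℂ → ℂ) : Prop :=
  ∃ ρ : ℝ, 0 < ρ ∧ ∀ r₁ r₂ : ℝ, 0 < r₁ → r₁ < ρ → 0 < r₂ → r₂ < ρ →
    AnalyticOnNhd ℂ H (polydisc r₁ r₂) ∧
    ∃ r : ℝ, 0 < r ∧ ∀ a : ℂ, a ≠ 0 → ‖a‖ < r →
      IsPathConnected (levelCurve H r₁ r₂ a) ∧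
      (∃ (p : levelCurve H r₁ r₂ a) (γ : Path p p),
        IsC1Loop γ ∧ GeneratesH1 γ ∧ PositivelyOriented γ) ∧
      ∀ (p : levelCurve H r₁ r₂ a) (γ : Path p p), GeneratesH1 γ →
        (PositivelyOriented γ ∨ PositivelyOriented γ.symm) ∧
        (IsC1Loop γ → PositivelyOriented γ →
          ∀ τ : ℂ × ℂ → (ℂ × ℂ) →L[ℂ] ℂ, IsTimeForm γ (hamField H) τ →
            loopPeriod γ τ = T a)

/-- The formal power series `c` converges near the origin, with sum `C`. -/
def IsSumNearZero (c : PowerSeries ℂ) (C : ℂ → ℂ) : Prop :=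
  HasFPowerSeriesAt C (FormalMultilinearSeries.ofScalars ℂ (fun n => PowerSeries.coeff n c)) 0

end

/-! Restricted to `x = 0`, a transversally symplectic conjugacy to the normal form becomes a formal
map `(f, g)` of Jacobian `1` carrying `J∇H` to the Hamiltonian field of `q(y₁ y₂)`, where `q' = l +
c` and `q(0) = 0`. Comparing differentials gives `H = q(f g)`. Let `G` be the inverse of an analytic
Morse chart `U`, so that `H ∘ G = u₁ u₂`, let `j` be the Jacobian determinant of `G`, and let `δ(a)
= ∑ jₙₙ aⁿ` be its convergent diagonal series. Both the normal form and the period map are read off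
`δ`.

Formal side. With `p` the compositional inverse of `q`, the series `F = f ∘ G` and `g ∘ G` have
product `p(u₁ u₂)` and Jacobian `j`. Differentiating the product gives `j F = p'(u₁ u₂) D F`, where
`D = u₁ ∂₁ - u₂ ∂₂`. This forces `F = u₁ w` with `w` a unit, and the logarithmic derivative `D w /
w` has no resonant term; hence the resonant part of `j` is `p'(u₁ u₂)`
(`coeff_derivative_of_mul_eq_subst`). So `p' = δ` converges, and with it `q` and `c`.

Analytic side. On the level curve write `u = (exp ζ, a exp (-ζ))`. The map `DG` sends `D` to `-j
J∇H`, so a time form pulls back to `-j dζ`. Around a loop only the monomials `u₁ⁿ u₂ⁿ` contribute,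
whence `T = -δ` (`loopPeriod_eq`), `-S` is the sum of `p`, and its inverse `h` is the sum of `q`.

Topology. The logarithms `ζ` of points of the level curve form a set that retracts horizontally onto
a vertical line, because the moduli of the components of `G` cross the radii of the polydisc only
once along the hyperbolic flow. The set is contractible, so the first homology is `ℤ`, measured by
the increment of `log U₁`.

The relation `HasJets`, a series being the asymptotic expansion of a function, carries identities
between the formal and the analytic sides. -/

noncomputable section

/-! ### Orders of formal power series and the chain rule. -/

namespace MvPowerSeries

theorem le_order_sub_truncTotal {σ : Type*} [Finite σ] (f : MvPowerSeries σ ℂ) (N : ℕ) :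
    (N : ℕ∞) ≤ (f - (truncTotal N f : MvPolynomial σ ℂ)).order := by
  refine nat_le_order fun d hd => ?_
  rw [map_sub, MvPolynomial.coeff_coe, coeff_truncTotal _ hd, sub_self]

theorem eq_of_forall_le_order_sub {σ : Type*} {f g : MvPowerSeries σ ℂ}
    (h : ∀ N : ℕ, (N : ℕ∞) ≤ (f - g).order) : f = g := by
  ext d
  have h1 := coeff_of_lt_order (f := f - g) (d := d)
    (lt_of_lt_of_le (by exact_mod_cast Nat.lt_succ_self d.degree) (h (d.degree + 1)))
  rwa [map_sub, sub_eq_zero] at h1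

theorem le_order_add' {σ : Type*} {f g : MvPowerSeries σ ℂ} {N : ℕ∞} (hf : N ≤ f.order) (hg : N ≤ g.order) :
    N ≤ (f + g).order :=
  (le_min hf hg).trans min_order_le_add

theorem le_order_sub' {σ : Type*} {f g : MvPowerSeries σ ℂ} {N : ℕ∞} (hf : N ≤ f.order) (hg : N ≤ g.order) :
    N ≤ (f - g).order := by
  rw [sub_eq_add_neg]
  exact le_order_add' hf (by rwa [order_neg])

theorem le_order_mul_left {σ : Type*} {f g : MvPowerSeries σ ℂ} {N : ℕ∞} (hf : N ≤ f.order) :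
    N ≤ (f * g).order :=
  (hf.trans le_self_add).trans le_order_mul

theorem le_order_mul_right {σ : Type*} {f g : MvPowerSeries σ ℂ} {N : ℕ∞} (hg : N ≤ g.order) :
    N ≤ (f * g).order :=
  (hg.trans le_add_self).trans le_order_mul

theorem le_order_pderiv {σ : Type*} {f : MvPowerSeries σ ℂ} {N : ℕ} (i : σ)
    (hf : ((N + 1 : ℕ) : ℕ∞) ≤ f.order) : (N : ℕ∞) ≤ (pderiv ℂ i f).order := by
  refine nat_le_order fun d hd => ?_
  rw [coeff_pderiv, coeff_of_lt_order, zero_mul]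
  refine lt_of_lt_of_le ?_ hf
  rw [map_add, Finsupp.degree_single]
  exact_mod_cast Nat.succ_lt_succ hd

theorem le_order_subst_of_constantCoeff_zero {σ τ : Type*} [Finite σ]
    {a : σ → MvPowerSeries τ ℂ}
    (ha : ∀ i, constantCoeff (a i) = 0) {f : MvPowerSeries σ ℂ} {N : ℕ∞} (hf : N ≤ f.order) :
    N ≤ (subst a f).order := by
  refine le_trans ?_ (le_order_subst (hasSubst_of_constantCoeff_zero ha) f)
  have h1 : (1 : ℕ∞) ≤ ⨅ i, (a i).order :=
    le_iInf fun i => one_le_order_iff_constCoeff_eq_zero.mpr (ha i)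
  calc N ≤ f.order := hf
    _ = 1 * f.order := (one_mul _).symm
    _ ≤ _ := mul_le_mul_left h1 _

theorem pderiv_aeval {σ τ : Type*} [Fintype σ] (a : σ → MvPowerSeries τ ℂ) (p : MvPolynomial σ ℂ) (j : τ) :
    pderiv ℂ j (MvPolynomial.aeval a p) =
      ∑ i, MvPolynomial.aeval a (MvPolynomial.pderiv i p) * pderiv ℂ j (a i) := by
  classical
  induction p using MvPolynomial.induction_on with
  | C c => simp [algebraMap_apply]
  | add p q hp hq => simp [hp, hq, add_mul, Finset.sum_add_distrib]
  | mul_X p k hp =>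
    simp only [map_mul, MvPolynomial.aeval_X, Derivation.leibniz, smul_eq_mul, hp, map_add,
      MvPolynomial.pderiv_X, add_mul, Finset.sum_add_distrib, Finset.mul_sum]
    congr 1
    · rw [Finset.sum_eq_single k]
      · simp
      · intro b _ hb
        simp [Pi.single_eq_of_ne (Ne.symm hb)]
      · simp
    · exact Finset.sum_congr rfl fun i _ => by ring

/-- The chain rule for substitution in formal power series. -/
theorem pderiv_subst {σ τ : Type*} [Fintype σ] {a : σ → MvPowerSeries τ ℂ}
    (ha : ∀ i, constantCoeff (a i) = 0) (f : MvPowerSeries σ ℂ) (j : τ) :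
    pderiv ℂ j (subst a f) = ∑ i, subst a (pderiv ℂ i f) * pderiv ℂ j (a i) := by
  have hs := hasSubst_of_constantCoeff_zero ha
  refine eq_of_forall_le_order_sub fun N => ?_
  -- The polynomial part satisfies the formula by `pderiv_aeval`. The remainder has order at least
  -- `N + 1`, and differentiation loses one order.
  set p := truncTotal (N + 1) f
  set r := f - (p : MvPowerSeries σ ℂ) with hr
  have hro : ((N + 1 : ℕ) : ℕ∞) ≤ r.order := le_order_sub_truncTotal f (N + 1)
  have hf : f = p + r := by rw [hr]; ring
  have h1 : pderiv ℂ j (subst a f) - ∑ i, subst a (pderiv ℂ i f) * pderiv ℂ j (a i) =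
      pderiv ℂ j (subst a r) - ∑ i, subst a (pderiv ℂ i r) * pderiv ℂ j (a i) := by
    rw [hf]
    simp only [subst_add hs, map_add, add_mul, Finset.sum_add_distrib, pderiv_coe, subst_coe,
      pderiv_aeval]
    ring
  rw [h1]
  refine le_order_sub' (le_order_pderiv _ (le_order_subst_of_constantCoeff_zero ha hro)) ?_
  refine Finset.sum_induction _ (fun x : MvPowerSeries τ ℂ => (N : ℕ∞) ≤ x.order) (fun _ _ => le_order_add')
    (by simp) fun i _ => le_order_mul_left
      (le_order_subst_of_constantCoeff_zero ha (le_order_pderiv _ hro))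

theorem pderiv_powerSeries_subst {τ : Type*} {a : MvPowerSeries τ ℂ} (ha : constantCoeff a = 0)
    (f : PowerSeries ℂ) (j : τ) :
    pderiv ℂ j (PowerSeries.subst a f) =
      PowerSeries.subst a (PowerSeries.derivative ℂ f) * pderiv ℂ j a := by
  have h := pderiv_subst (σ := Unit) (a := fun _ => a) (fun _ => ha) f j
  rw [Finset.univ_unique, Finset.sum_singleton] at h
  have h2 : pderiv ℂ (default : Unit) f = PowerSeries.derivative ℂ f := by
    ext n
    rw [PowerSeries.coeff_derivative, PowerSeries.coeff, coeff_pderiv, PowerSeries.coeff]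
    congr 2
    · rw [← Finsupp.single_add]
    · simp
  rwa [h2] at h

end MvPowerSeries
end

/-! ### Asymptotic expansions by formal power series. -/

noncomputable section

open Asymptotics

/-- Once the lower coefficients vanish, `P = X ^ m * Q`; dividing by `t ^ m` off the origin forces
`Q(0) = 0`. -/
theorem Polynomial.coeff_eq_zero_of_isLittleO {P : Polynomial ℂ} {n : ℕ}
    (h : (fun t : ℂ => P.eval t) =o[𝓝 0] fun t : ℂ => t ^ n) {m : ℕ} (hm : m ≤ n) :
    P.coeff m = 0 := by
  induction m using Nat.strong_induction_on with
  | _ m ih =>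
    obtain ⟨Q, hQ⟩ := Polynomial.X_pow_dvd_iff.mpr fun d hd => ih d hd (hd.le.trans hm)
    have h1 : P.coeff m = Q.eval 0 := by
      rw [hQ, ← Polynomial.coeff_zero_eq_eval_zero]
      simpa using Polynomial.coeff_X_pow_mul Q m 0
    have h2 : (fun t : ℂ => t ^ m * Q.eval t) =o[𝓝 0] fun t : ℂ => t ^ m * 1 := by
      refine IsLittleO.trans_isBigO (f := _) (g := fun t : ℂ => t ^ n) ?_ ?_
      · simpa [hQ] using h
      · refine IsBigO.of_bound 1 ?_
        filter_upwards [Metric.ball_mem_nhds (0 : ℂ) one_pos] with t ht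
        rw [one_mul, mul_one, norm_pow, norm_pow]
        exact pow_le_pow_of_le_one (norm_nonneg _) (mem_ball_zero_iff.mp ht).le hm
    have h3 : Tendsto (fun t : ℂ => Q.eval t) (𝓝[≠] 0) (𝓝 0) := by
      rw [← isLittleO_one_iff ℂ]
      refine IsLittleO.of_bound fun c hc => ?_
      have h4 := (h2.mono (nhdsWithin_le_nhds (s := {0}ᶜ))).bound hc
      filter_upwards [h4, self_mem_nhdsWithin] with t ht ht0
      have h5 : 0 < ‖t ^ m‖ := norm_pos_iff.mpr (pow_ne_zero _ ht0)
      rw [norm_mul, norm_mul] at ht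
      exact le_of_mul_le_mul_left (by linarith) h5
    rw [h1]
    exact tendsto_nhds_unique
      ((Polynomial.continuous Q).continuousAt.tendsto.mono_left nhdsWithin_le_nhds) h3

/-- Reduces several variables to one: along a ray through `y`, homogeneous components become
coefficients. -/
theorem MvPolynomial.coeff_aeval_ray {σ : Type*} (q : MvPolynomial σ ℂ) (y : σ → ℂ) (m : ℕ) :
    (MvPolynomial.aeval (fun i => Polynomial.C (y i) * Polynomial.X) q : Polynomial ℂ).coeff m =
      MvPolynomial.eval y (MvPolynomial.homogeneousComponent m q) := by
  classical
  induction q using MvPolynomial.induction_on' with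
  | monomial d c =>
    rw [MvPolynomial.aeval_monomial]
    simp only [mul_pow, Finsupp.prod_mul, ← Polynomial.C_pow]
    have h1 : (d.prod fun i k => Polynomial.C (y i ^ k)) = Polynomial.C (d.prod fun i k => y i ^ k) := by
      simp [Finsupp.prod, map_prod]
    have h2 : (d.prod fun _ k => (Polynomial.X : Polynomial ℂ) ^ k) = Polynomial.X ^ d.degree := by
      simp [Finsupp.prod, Finset.prod_pow_eq_pow_sum, Finsupp.degree_apply]
    rw [h1, h2]
    have h3 : MvPolynomial.homogeneousComponent m (MvPolynomial.monomial d c) =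
        if d.degree = m then MvPolynomial.monomial d c else 0 := by
      ext e
      rw [MvPolynomial.coeff_homogeneousComponent]
      by_cases he : d = e
      · subst he; split_ifs <;> simp
      · rw [MvPolynomial.coeff_monomial, if_neg he, ite_self]
        split_ifs
        · rw [MvPolynomial.coeff_monomial, if_neg he]
        · rfl
    rw [h3, Polynomial.algebraMap_eq, ← mul_assoc, ← map_mul, Polynomial.coeff_C_mul_X_pow]
    by_cases hm : m = d.degree
    · rw [if_pos hm, if_pos hm.symm, MvPolynomial.eval_monomial]
    · rw [if_neg hm, if_neg (Ne.symm hm), map_zero]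
  | add p q hp hq => simp [hp, hq]

theorem MvPolynomial.coeff_eq_zero_of_isLittleO {σ : Type*} [Fintype σ] {q : MvPolynomial σ ℂ}
    {n : ℕ} (h : (fun y : σ → ℂ => MvPolynomial.eval y q) =o[𝓝 0] fun y => ‖y‖ ^ n)
    {d : σ →₀ ℕ} (hd : d.degree ≤ n) : q.coeff d = 0 := by
  have h0 : MvPolynomial.homogeneousComponent d.degree q = 0 := by
    refine MvPolynomial.funext fun y => ?_
    rw [map_zero, ← MvPolynomial.coeff_aeval_ray]
    refine Polynomial.coeff_eq_zero_of_isLittleO (n := n) ?_ hd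
    have h1 : Tendsto (fun t : ℂ => t • y) (𝓝 0) (𝓝 0) := by
      have : Continuous fun t : ℂ => t • y := by fun_prop
      simpa using this.tendsto 0
    have h2 := h.comp_tendsto h1
    have h3 : (fun t : ℂ => Polynomial.eval t (MvPolynomial.aeval
        (fun i => Polynomial.C (y i) * Polynomial.X) q)) =
        (fun y : σ → ℂ => MvPolynomial.eval y q) ∘ fun t : ℂ => t • y := by
      funext t
      rw [Function.comp_apply, MvPolynomial.aeval_def, ← Polynomial.coe_evalRingHom,
        MvPolynomial.hom_eval₂, MvPolynomial.eval, MvPolynomial.coe_eval₂Hom]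
      congr 1
      · ext1 c; simp
      · funext i
        rw [Pi.smul_apply, smul_eq_mul, Polynomial.coe_evalRingHom, Polynomial.eval_mul,
          Polynomial.eval_C, Polynomial.eval_X, mul_comm]
    rw [h3]
    refine h2.trans_isBigO ?_
    refine IsBigO.of_bound (‖y‖ ^ n) (Eventually.of_forall fun t => ?_)
    simp [norm_smul, mul_pow, mul_comm]
  have h1 := congrArg (MvPolynomial.coeff d) h0
  rwa [MvPolynomial.coeff_homogeneousComponent, if_pos rfl, MvPolynomial.coeff_zero] at h1

/-- The formal power series `f` is the asymptotic expansion of `F` at the origin. -/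
def HasJets {σ : Type*} [Fintype σ] (f : MvPowerSeries σ ℂ) (F : (σ → ℂ) → ℂ) : Prop :=
  ∀ N : ℕ, ∃ p : MvPolynomial σ ℂ, (N : ℕ∞) ≤ (f - (p : MvPowerSeries σ ℂ)).order ∧
    (fun y => F y - MvPolynomial.eval y p) =O[𝓝 0] fun y => ‖y‖ ^ N

namespace HasJets

variable {σ τ : Type*} [Fintype σ] [Fintype τ]

theorem of_polynomial (p : MvPolynomial σ ℂ) :
    HasJets (p : MvPowerSeries σ ℂ) fun y => MvPolynomial.eval y p := fun N =>
  ⟨p, by simp, by simpa using isBigO_zero _ _⟩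

theorem congr {f : MvPowerSeries σ ℂ} {F G : (σ → ℂ) → ℂ} (h : HasJets f F)
    (hFG : F =ᶠ[𝓝 0] G) : HasJets f G := fun N => by
  obtain ⟨p, hp, hF⟩ := h N
  refine ⟨p, hp, hF.congr' ?_ EventuallyEq.rfl⟩
  filter_upwards [hFG] with y hy
  rw [hy]

theorem add {f g : MvPowerSeries σ ℂ} {F G : (σ → ℂ) → ℂ} (hf : HasJets f F) (hg : HasJets g G) :
    HasJets (f + g) fun y => F y + G y := fun N => by
  obtain ⟨p, hp, hF⟩ := hf N
  obtain ⟨q, hq, hG⟩ := hg N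
  refine ⟨p + q, ?_, (hF.add hG).congr_left fun y => by simp; ring⟩
  have : f + g - ((p + q : MvPolynomial σ ℂ) : MvPowerSeries σ ℂ) = (f - p) + (g - q) := by
    push_cast; ring
  rw [this]
  exact MvPowerSeries.le_order_add' hp hq

theorem isBigO_one_eval {σ : Type*} (p : MvPolynomial σ ℂ) :
    (fun y : σ → ℂ => MvPolynomial.eval y p) =O[𝓝 0] fun _ => (1 : ℝ) :=
  ((MvPolynomial.continuous_eval p).tendsto 0).isBigO_one ℝ

theorem isBigO_one {f : MvPowerSeries σ ℂ} {F : (σ → ℂ) → ℂ} (hf : HasJets f F) :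
    F =O[𝓝 0] fun _ => (1 : ℝ) := by
  obtain ⟨p, -, hF⟩ := hf 0
  simpa using (hF.congr_right (g₂ := fun _ => (1 : ℝ)) fun y => by simp).add (isBigO_one_eval p)

theorem mul {f g : MvPowerSeries σ ℂ} {F G : (σ → ℂ) → ℂ} (hf : HasJets f F) (hg : HasJets g G) :
    HasJets (f * g) fun y => F y * G y := fun N => by
  obtain ⟨p, hp, hF⟩ := hf N
  obtain ⟨q, hq, hG⟩ := hg N
  refine ⟨p * q, ?_, ?_⟩
  · have : f * g - ((p * q : MvPolynomial σ ℂ) : MvPowerSeries σ ℂ) =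
        f * (g - q) + (f - p) * q := by push_cast; ring
    rw [this]
    exact MvPowerSeries.le_order_add' (MvPowerSeries.le_order_mul_right hq)
      (MvPowerSeries.le_order_mul_left hp)
  · have h1 := hf.isBigO_one.mul hG
    have h2 := hF.mul (isBigO_one_eval q)
    refine ((h1.congr_right fun y => one_mul _).add (h2.congr_right fun y => mul_one _)).congr_left
      fun y => ?_
    simp; ring

theorem const (c : ℂ) : HasJets (MvPowerSeries.C c : MvPowerSeries σ ℂ) fun _ => c := by
  simpa using of_polynomial (σ := σ) (MvPolynomial.C c)

theorem coord (i : σ) : HasJets (MvPowerSeries.X i : MvPowerSeries σ ℂ) fun y => y i := by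
  simpa using of_polynomial (σ := σ) (MvPolynomial.X i)

theorem neg {f : MvPowerSeries σ ℂ} {F : (σ → ℂ) → ℂ} (hf : HasJets f F) :
    HasJets (-f) fun y => -F y := by
  simpa using (const (-1)).mul hf

theorem sub {f g : MvPowerSeries σ ℂ} {F G : (σ → ℂ) → ℂ} (hf : HasJets f F) (hg : HasJets g G) :
    HasJets (f - g) fun y => F y - G y := by
  simpa [sub_eq_add_neg] using hf.add hg.neg

/-- Two approximating polynomials of `F` differ by `O(‖y‖ ^ (N + 1))`, hence by no monomial of
degree at most `N`. Formal identities are obtained from analytic ones in this way. -/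
theorem unique {f g : MvPowerSeries σ ℂ} {F : (σ → ℂ) → ℂ} (hf : HasJets f F)
    (hg : HasJets g F) : f = g := by
  refine MvPowerSeries.eq_of_forall_le_order_sub fun N => ?_
  obtain ⟨p, hp, hF⟩ := hf (N + 1)
  obtain ⟨q, hq, hG⟩ := hg (N + 1)
  have hN : (N : ℕ∞) ≤ ((N + 1 : ℕ) : ℕ∞) := by exact_mod_cast N.le_succ
  have h1 : (fun y : σ → ℂ => MvPolynomial.eval y (p - q)) =o[𝓝 0] fun y => ‖y‖ ^ N := by
    refine ((hG.sub hF).congr_left (f₂ := fun y : σ → ℂ => MvPolynomial.eval y (p - q))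
      fun y => by simp).trans_isLittleO ?_
    exact (isLittleO_pow_pow (𝕜 := ℝ) N.lt_succ_self).comp_tendsto
      (tendsto_norm_zero (E := σ → ℂ))
  have h2 : (N : ℕ∞) ≤ ((p - q : MvPolynomial σ ℂ) : MvPowerSeries σ ℂ).order :=
    MvPowerSeries.nat_le_order fun d hd => by
      rw [MvPolynomial.coeff_coe]
      exact MvPolynomial.coeff_eq_zero_of_isLittleO h1 hd.le
  have h3 : f - g = (f - p) + ((p - q : MvPolynomial σ ℂ) : MvPowerSeries σ ℂ) - (g - q) := by
    have : ((p - q : MvPolynomial σ ℂ) : MvPowerSeries σ ℂ) = p - q := by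
      rw [sub_eq_add_neg, MvPolynomial.coe_add]
      have h4 : ((-q : MvPolynomial σ ℂ) : MvPowerSeries σ ℂ) = -q := by
        ext; simp
      rw [h4, sub_eq_add_neg]
    rw [this]; ring
  rw [h3]
  exact MvPowerSeries.le_order_sub' (MvPowerSeries.le_order_add' (hN.trans hp) h2) (hN.trans hq)

theorem isBigO_norm {f : MvPowerSeries σ ℂ} {F : (σ → ℂ) → ℂ} (hf : HasJets f F) {n : ℕ}
    (h0 : (n : ℕ∞) ≤ f.order) : F =O[𝓝 0] fun y => ‖y‖ ^ n := by
  classical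
  obtain ⟨p, hp, hF⟩ := hf n
  have h1 : (n : ℕ∞) ≤ (p : MvPowerSeries σ ℂ).order := by
    have := MvPowerSeries.le_order_sub' h0 hp
    rwa [sub_sub_cancel] at this
  have h2 : (fun y : σ → ℂ => MvPolynomial.eval y p) =O[𝓝 0] fun y => ‖y‖ ^ n := by
    simp only [MvPolynomial.eval_eq']
    refine IsBigO.fun_sum fun d hd => ?_
    have hdn : n ≤ d.degree := by
      by_contra hlt
      have := MvPowerSeries.coeff_of_lt_order (f := (p : MvPowerSeries σ ℂ)) (d := d)
        (lt_of_lt_of_le (by exact_mod_cast not_le.mp hlt) h1)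
      rw [MvPolynomial.coeff_coe] at this
      exact (MvPolynomial.mem_support_iff.mp hd) this
    refine IsBigO.of_bound ‖MvPolynomial.coeff d p‖ ?_
    filter_upwards [Metric.ball_mem_nhds (0 : σ → ℂ) one_pos] with y hy
    rw [norm_mul, norm_prod, norm_pow, norm_norm]
    refine mul_le_mul_of_nonneg_left ?_ (norm_nonneg _)
    calc ∏ i, ‖y i ^ d i‖ ≤ ∏ i, ‖y‖ ^ d i := by
          refine Finset.prod_le_prod (fun i _ => norm_nonneg _) fun i _ => ?_
          rw [norm_pow]
          exact pow_le_pow_left₀ (norm_nonneg _) (norm_le_pi_norm y i) _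
      _ = ‖y‖ ^ d.degree := by
          rw [Finset.prod_pow_eq_pow_sum, Finsupp.degree_eq_sum]
      _ ≤ ‖y‖ ^ n := pow_le_pow_of_le_one (norm_nonneg _) (mem_ball_zero_iff.mp hy).le hdn
  simpa using hF.add h2

/-- The vanishing constant terms give `A = O(‖y‖)`, so an error of order `N` in `F` remains of order
`N` after composition. The polynomial part is covered by sums and products. -/
theorem comp {f : MvPowerSeries σ ℂ} {F : (σ → ℂ) → ℂ} (hf : HasJets f F)
    {a : σ → MvPowerSeries τ ℂ} {A : (τ → ℂ) → σ → ℂ}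
    (ha : ∀ i, HasJets (a i) fun y => A y i)
    (ha0 : ∀ i, MvPowerSeries.constantCoeff (a i) = 0) :
    HasJets (MvPowerSeries.subst a f) fun y => F (A y) := fun N => by
  have hs := MvPowerSeries.hasSubst_of_constantCoeff_zero ha0
  obtain ⟨p, hp, hF⟩ := hf N
  have hA : A =O[𝓝 0] fun y => ‖y‖ := by
    rw [isBigO_pi]
    intro i
    simpa using (ha i).isBigO_norm (n := 1)
      (by simpa using MvPowerSeries.one_le_order_iff_constCoeff_eq_zero.mpr (ha0 i))
  have hA0 : Tendsto A (𝓝 0) (𝓝 0) :=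
    hA.trans_tendsto (tendsto_norm_zero (E := τ → ℂ))
  have hpoly : ∀ p : MvPolynomial σ ℂ,
      HasJets (MvPolynomial.aeval a p) fun y => MvPolynomial.eval (A y) p := by
    intro p
    induction p using MvPolynomial.induction_on with
    | C c => simpa [MvPowerSeries.algebraMap_apply] using const c
    | add p q hp hq => simpa using hp.add hq
    | mul_X p i hp => simpa using hp.mul (ha i)
  obtain ⟨q, hq, hG⟩ := hpoly p N
  refine ⟨q, ?_, ?_⟩
  · have h1 : MvPowerSeries.subst a f - (q : MvPowerSeries τ ℂ) =
        MvPowerSeries.subst a (f - (p : MvPowerSeries σ ℂ)) + (MvPolynomial.aeval a p - (q : MvPowerSeries τ ℂ)) := by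
      rw [MvPowerSeries.subst_sub hs, MvPowerSeries.subst_coe]; ring
    rw [h1]
    exact MvPowerSeries.le_order_add' (MvPowerSeries.le_order_subst_of_constantCoeff_zero ha0 hp) hq
  · have h2 := (hF.comp_tendsto hA0).trans (hA.norm_left.pow N)
    refine (h2.add hG).congr_left fun y => ?_
    simp

/-- An asymptotic expansion cannot be differentiated in general. For an analytic function, Cauchy's
estimate on a disc of radius `‖y‖` in the direction `i` bounds the derivative of the remainder. -/
theorem pderiv {f : MvPowerSeries σ ℂ} {F : (σ → ℂ) → ℂ} (hf : HasJets f F)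
    (hF : AnalyticAt ℂ F 0) [DecidableEq σ] (i : σ) :
    HasJets (MvPowerSeries.pderiv ℂ i f) fun y => fderiv ℂ F y (Pi.single i 1) := fun N => by
  -- Cauchy's estimate loses one order. The second extra order makes the remainder `o(‖y‖)` even for
  -- `N = 0`, so that its derivative at the origin vanishes.
  obtain ⟨p, hp, hFp⟩ := hf (N + 2)
  refine ⟨MvPolynomial.pderiv i p, ?_, ?_⟩
  · rw [← MvPowerSeries.pderiv_coe, ← map_sub]
    exact MvPowerSeries.le_order_pderiv i (le_trans (by exact_mod_cast Nat.le_succ _) hp)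
  have hpa : ∀ (p : MvPolynomial σ ℂ) (y : σ → ℂ),
      DifferentiableAt ℂ (fun y : σ → ℂ => MvPolynomial.eval y p) y := by
    intro p y
    simp only [MvPolynomial.eval_eq']
    fun_prop
  have hpd : ∀ (p : MvPolynomial σ ℂ) (y : σ → ℂ),
      fderiv ℂ (fun y : σ → ℂ => MvPolynomial.eval y p) y (Pi.single i 1) =
      MvPolynomial.eval y (MvPolynomial.pderiv i p) := by
    intro p y
    induction p using MvPolynomial.induction_on with
    | C c => simp
    | add p q hp hq =>
      simp only [map_add]
      rw [fderiv_fun_add (hpa p y) (hpa q y), ← hp, ← hq]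
      rfl
    | mul_X p k hp =>
      have hk : fderiv ℂ (fun y : σ → ℂ => y k) y (Pi.single i 1) =
          Pi.single (M := fun _ => ℂ) i 1 k := by
        rw [(hasFDerivAt_apply k y).fderiv]; rfl
      simp only [map_mul, MvPolynomial.eval_X]
      rw [fderiv_fun_mul (hpa p y) (by fun_prop), add_apply,
        smul_apply, smul_apply, hp, hk,
        Derivation.leibniz, MvPolynomial.pderiv_X]
      rcases eq_or_ne i k with rfl | h
      · simp
      · simp [Pi.single_eq_of_ne h.symm]
  set R : (σ → ℂ) → ℂ := fun y => F y - MvPolynomial.eval y p with hR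
  obtain ⟨C, hC⟩ := hFp.bound
  have hdiff : ∀ᶠ y in 𝓝 (0 : σ → ℂ), DifferentiableAt ℂ F y :=
    hF.eventually_analyticAt.mono fun y hy => hy.differentiableAt
  obtain ⟨ε, hε, hball⟩ := Metric.eventually_nhds_iff_ball.mp (hdiff.and hC)
  have hRd : ∀ y ∈ Metric.ball (0 : σ → ℂ) ε, DifferentiableAt ℂ R y := fun y hy =>
    (hball y hy).1.sub (hpa p y)
  refine IsBigO.of_bound (C * 2 ^ (N + 2)) ?_
  filter_upwards [Metric.ball_mem_nhds (0 : σ → ℂ) (half_pos hε),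
    Metric.ball_mem_nhds (0 : σ → ℂ) one_pos] with y hy hy1
  rw [mem_ball_zero_iff] at hy hy1
  have hyε : y ∈ Metric.ball (0 : σ → ℂ) ε := mem_ball_zero_iff.mpr (by linarith)
  have h1 : fderiv ℂ F y (Pi.single i 1) - MvPolynomial.eval y (MvPolynomial.pderiv i p) =
      fderiv ℂ R y (Pi.single i 1) := by
    rw [hR, fderiv_fun_sub (hball y hyε).1 (hpa p y), ← hpd]; rfl
  rw [h1]
  rcases eq_or_ne y 0 with rfl | hy0
  · have h2 : HasFDerivAt R (0 : (σ → ℂ) →L[ℂ] ℂ) 0 :=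
      IsBigO.hasFDerivAt (n := N + 2) (by simpa using hFp) (by omega)
    rw [h2.fderiv]
    simp only [zero_apply, norm_zero]
    have hC0 := (hball 0 hyε).2
    -- At `y = 0` the bound says nothing about the sign of `C`, which is therefore tested at a
    -- nonzero point.
    have : 0 ≤ C := by
      by_contra hneg
      obtain ⟨t, ht0, htε⟩ := exists_between hε
      have h3 := (hball (Pi.single i (t : ℂ)) (by
        rw [mem_ball_zero_iff, Pi.norm_single]; simpa [abs_of_pos ht0] using htε)).2
      have h4 : 0 < ‖‖(Pi.single i (t : ℂ) : σ → ℂ)‖ ^ (N + 2)‖ := by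
        rw [Pi.norm_single]; simp; positivity
      nlinarith [norm_nonneg (F (Pi.single i (t : ℂ)) - MvPolynomial.eval (Pi.single i (t : ℂ)) p)]
    positivity
  · have hyp : 0 < ‖y‖ := norm_pos_iff.mpr hy0
    have hsingle : ‖(Pi.single i (1 : ℂ) : σ → ℂ)‖ = 1 := by rw [Pi.norm_single]; simp
    have hnorm : ∀ t : ℂ, ‖t‖ ≤ ‖y‖ → ‖y + t • (Pi.single i (1 : ℂ) : σ → ℂ)‖ ≤ 2 * ‖y‖ := by
      intro t ht
      refine (norm_add_le _ _).trans ?_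
      rw [norm_smul, hsingle]; linarith
    have hline : ∀ t : ℂ, ‖t‖ ≤ ‖y‖ → HasDerivAt
        (fun t : ℂ => R (y + t • (Pi.single i (1 : ℂ) : σ → ℂ)))
        (fderiv ℂ R (y + t • (Pi.single i (1 : ℂ) : σ → ℂ)) (Pi.single i 1)) t := by
      intro t ht
      have hd := (hRd (y + t • Pi.single i (1 : ℂ)) (mem_ball_zero_iff.mpr (by
        linarith [hnorm t ht]))).hasFDerivAt
      have hl : HasDerivAt (fun t : ℂ => y + t • (Pi.single i (1 : ℂ) : σ → ℂ))
          (Pi.single i (1 : ℂ)) t := by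
        simpa only [id, one_smul] using
          ((hasDerivAt_id t).smul_const (Pi.single i (1 : ℂ) : σ → ℂ)).const_add y
      exact hd.comp_hasDerivAt t hl
    have h2 := Complex.norm_deriv_le_of_forall_mem_sphere_norm_le
      (f := fun t : ℂ => R (y + t • (Pi.single i (1 : ℂ) : σ → ℂ))) (c := 0) hyp
      (C := C * (2 * ‖y‖) ^ (N + 2)) ?_ ?_
    · rw [(hline 0 (by simp)).deriv] at h2
      simp only [zero_smul, add_zero] at h2
      refine h2.trans ?_
      rw [norm_pow, norm_norm, div_le_iff₀ hyp]
      have h3 : 0 ≤ C * ‖y‖ ^ (N + 2) := by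
        have := (norm_nonneg _).trans (hball y hyε).2
        rwa [norm_pow, norm_norm] at this
      have hC0 : 0 ≤ C := nonneg_of_mul_nonneg_left h3 (by positivity)
      rw [mul_pow, ← mul_assoc]
      have : ‖y‖ ^ (N + 2) ≤ ‖y‖ ^ (N + 1) :=
        pow_le_pow_of_le_one hyp.le hy1.le (Nat.le_succ _)
      calc C * 2 ^ (N + 2) * ‖y‖ ^ (N + 2) ≤ C * 2 ^ (N + 2) * ‖y‖ ^ (N + 1) := by gcongr
        _ = C * 2 ^ (N + 2) * ‖y‖ ^ N * ‖y‖ := by ring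
    · refine DifferentiableOn.diffContOnCl ?_
      intro t ht
      rw [closure_ball _ hyp.ne', mem_closedBall_zero_iff] at ht
      exact (hline t ht).differentiableAt.differentiableWithinAt
    · intro t ht
      rw [mem_sphere_zero_iff_norm] at ht
      have hb := (hball (y + t • Pi.single i (1 : ℂ)) (mem_ball_zero_iff.mpr (by
        linarith [hnorm t ht.le]))).2
      have hC0 : 0 ≤ C := by
        have := (norm_nonneg _).trans (hball y hyε).2
        rw [norm_pow, norm_norm] at this
        exact nonneg_of_mul_nonneg_left this (by positivity)
      refine hb.trans ?_
      rw [norm_pow, norm_norm]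
      exact mul_le_mul_of_nonneg_left (pow_le_pow_left₀ (norm_nonneg _) (hnorm t ht.le) _) hC0

end HasJets
end

/-! ### Convergent power series in two variables. -/

noncomputable section

open Asymptotics

/-- Pairs of natural numbers as exponents in two variables. -/
def pairExponent : ℕ × ℕ ≃ (Fin 2 →₀ ℕ) where
  toFun p := Finsupp.single 0 p.1 + Finsupp.single 1 p.2
  invFun k := (k 0, k 1)
  left_inv p := by simp
  right_inv k := by ext i; fin_cases i <;> simp

@[simp] theorem pairExponent_zero (p : ℕ × ℕ) : pairExponent p 0 = p.1 := by
  simp [pairExponent]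

@[simp] theorem pairExponent_one (p : ℕ × ℕ) : pairExponent p 1 = p.2 := by
  simp [pairExponent]

theorem summable_geometric_pair {q : ℝ} (h0 : 0 ≤ q) (h1 : q < 1) :
    Summable fun k : Fin 2 →₀ ℕ => q ^ (k 0 + k 1) := by
  rw [← pairExponent.summable_iff]
  have := (summable_geometric_of_lt_one h0 h1).mul_of_nonneg (summable_geometric_of_lt_one h0 h1)
    (fun n => pow_nonneg h0 n) (fun n => pow_nonneg h0 n)
  refine this.congr fun p => ?_
  simp [pow_add]

theorem hasSum_antidiagonal_pair {g : (Fin 2 →₀ ℕ) → ℂ} (hg : Summable g) :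
    HasSum (fun n => ∑ p ∈ Finset.HasAntidiagonal.antidiagonal n, g (pairExponent p)) (∑' k, g k) := by
  have h1 : HasSum (g ∘ pairExponent) (∑' k, g k) := pairExponent.hasSum_iff.mpr hg.hasSum
  rw [← Finset.HasAntidiagonal.sigmaAntidiagonalEquivProd.hasSum_iff] at h1
  refine h1.sigma fun n => ?_
  have h2 := hasSum_fintype (fun c : Finset.HasAntidiagonal.antidiagonal n => g (pairExponent c.1))
  rw [Finset.sum_coe_sort (Finset.HasAntidiagonal.antidiagonal n) (fun p => g (pairExponent p))] at h2
  exact h2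

/-- The coefficients grow at most geometrically. -/
def GeomBounded (f : MvPowerSeries (Fin 2) ℂ) : Prop :=
  ∃ ε : ℝ, 0 < ε ∧ ∃ C : ℝ, ∀ k : Fin 2 →₀ ℕ, ‖MvPowerSeries.coeff k f‖ * ε ^ (k 0 + k 1) ≤ C

theorem norm_term_le {f : MvPowerSeries (Fin 2) ℂ} {ε C : ℝ} (hε : 0 < ε)
    (hC : ∀ k : Fin 2 →₀ ℕ, ‖MvPowerSeries.coeff k f‖ * ε ^ (k 0 + k 1) ≤ C) {y : ℂ × ℂ} {s : ℝ}
    (hy : ‖y‖ ≤ s) (k : Fin 2 →₀ ℕ) :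
    ‖MvPowerSeries.coeff k f * (y.1 ^ k 0 * y.2 ^ k 1)‖ ≤ C * (s / ε) ^ (k 0 + k 1) := by
  have hs : 0 ≤ s := (norm_nonneg _).trans hy
  have h1 : ‖y.1‖ ^ k 0 * ‖y.2‖ ^ k 1 ≤ s ^ (k 0 + k 1) := by
    rw [pow_add]
    have := (norm_fst_le y).trans hy
    have := (norm_snd_le y).trans hy
    gcongr
  rw [norm_mul, norm_mul, norm_pow, norm_pow, div_pow]
  calc ‖MvPowerSeries.coeff k f‖ * (‖y.1‖ ^ k 0 * ‖y.2‖ ^ k 1)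
      ≤ ‖MvPowerSeries.coeff k f‖ * s ^ (k 0 + k 1) := by gcongr
    _ = (‖MvPowerSeries.coeff k f‖ * ε ^ (k 0 + k 1)) * (s ^ (k 0 + k 1) / ε ^ (k 0 + k 1)) := by
        field_simp
    _ ≤ C * (s ^ (k 0 + k 1) / ε ^ (k 0 + k 1)) :=
        mul_le_mul_of_nonneg_right (hC k) (by positivity)

/-- Summability at the single point `(ε / 2, ε / 2)` bounds all the terms there. -/
theorem HasGerm.geomBounded {f : MvPowerSeries (Fin 2) ℂ} {F : ℂ × ℂ → ℂ} (h : HasGerm f F) :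
    GeomBounded f := by
  obtain ⟨ε, hε, hb⟩ := Metric.eventually_nhds_iff_ball.mp h
  have hmem : (((ε / 2 : ℝ) : ℂ), ((ε / 2 : ℝ) : ℂ)) ∈ Metric.ball (0 : ℂ × ℂ) ε := by
    rw [mem_ball_zero_iff, Prod.norm_mk, Complex.norm_real, max_self, Real.norm_eq_abs,
      abs_of_pos (by positivity)]
    linarith
  have hs := (hb _ hmem).summable.norm
  refine ⟨ε / 2, by positivity, _, fun k => le_trans (le_of_eq ?_)
    (hs.le_tsum k fun _ _ => norm_nonneg _)⟩
  rw [norm_mul, norm_mul, norm_pow, norm_pow, Complex.norm_real, Real.norm_eq_abs,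
    abs_of_pos (by positivity), pow_add]

/-- The sum of a power series in two variables. -/
def seriesSum (f : MvPowerSeries (Fin 2) ℂ) (y : ℂ × ℂ) : ℂ :=
  ∑' k : Fin 2 →₀ ℕ, MvPowerSeries.coeff k f * (y.1 ^ k 0 * y.2 ^ k 1)

theorem summable_term {f : MvPowerSeries (Fin 2) ℂ} {ε C : ℝ} (hε : 0 < ε)
    (hC : ∀ k : Fin 2 →₀ ℕ, ‖MvPowerSeries.coeff k f‖ * ε ^ (k 0 + k 1) ≤ C) {y : ℂ × ℂ}
    (hy : ‖y‖ < ε) :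
    Summable fun k : Fin 2 →₀ ℕ => MvPowerSeries.coeff k f * (y.1 ^ k 0 * y.2 ^ k 1) :=
  Summable.of_norm_bounded ((summable_geometric_pair (by positivity)
    ((div_lt_one hε).mpr hy)).mul_left C) (norm_term_le hε hC le_rfl)

theorem GeomBounded.hasGerm {f : MvPowerSeries (Fin 2) ℂ} (h : GeomBounded f) :
    HasGerm f (seriesSum f) := by
  obtain ⟨ε, hε, C, hC⟩ := h
  filter_upwards [Metric.ball_mem_nhds (0 : ℂ × ℂ) hε] with y hy
  exact (summable_term hε hC (mem_ball_zero_iff.mp hy)).hasSum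

/-- The monomial `y₁ ^ i * y₂ ^ (n - i)` as a multilinear map. -/
def monomialMultilinear (n i : ℕ) : ContinuousMultilinearMap ℂ (fun _ : Fin n => ℂ × ℂ) ℂ :=
  (ContinuousMultilinearMap.mkPiAlgebraFin ℂ n ℂ).compContinuousLinearMap fun j =>
    if (j : ℕ) < i then ContinuousLinearMap.fst ℂ ℂ ℂ else ContinuousLinearMap.snd ℂ ℂ ℂ

theorem monomialMultilinear_apply {n i j : ℕ} (h : i + j = n) (y : ℂ × ℂ) :
    monomialMultilinear n i (fun _ => y) = y.1 ^ i * y.2 ^ j := by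
  subst h
  simp only [monomialMultilinear, ContinuousMultilinearMap.compContinuousLinearMap_apply,
    ContinuousMultilinearMap.mkPiAlgebraFin_apply]
  rw [List.prod_ofFn, Fin.prod_univ_add]
  congr 1
  · simp
  · simp

theorem norm_monomialMultilinear_le (n i : ℕ) : ‖monomialMultilinear n i‖ ≤ 1 := by
  refine ContinuousMultilinearMap.opNorm_le_bound zero_le_one fun m => ?_
  simp only [monomialMultilinear, ContinuousMultilinearMap.compContinuousLinearMap_apply,
    ContinuousMultilinearMap.mkPiAlgebraFin_apply]
  rw [List.prod_ofFn, norm_prod, one_mul]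
  refine Finset.prod_le_prod (fun _ _ => norm_nonneg _) fun j _ => ?_
  split_ifs
  · exact norm_fst_le _
  · exact norm_snd_le _

/-- The terms are grouped by total degree into a formal multilinear series. Degree `n` contains `n +
1` monomials, a factor absorbed by halving the radius. -/
theorem GeomBounded.analyticAt {f : MvPowerSeries (Fin 2) ℂ} (h : GeomBounded f) :
    AnalyticAt ℂ (seriesSum f) 0 := by
  obtain ⟨ε, hε, C, hC⟩ := h
  have hC0 : 0 ≤ C := le_trans (by positivity) (hC 0)
  let q : FormalMultilinearSeries ℂ (ℂ × ℂ) ℂ := fun n =>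
    ∑ p ∈ Finset.HasAntidiagonal.antidiagonal n, MvPowerSeries.coeff (pairExponent p) f • monomialMultilinear n p.1
  have hq : ∀ n, ‖q n‖ ≤ (n + 1) * (C / ε ^ n) := by
    intro n
    calc ‖q n‖ ≤ ∑ p ∈ Finset.HasAntidiagonal.antidiagonal n, C / ε ^ n := by
          refine norm_sum_le_of_le _ fun p hp => ?_
          rw [norm_smul]
          have h1 := hC (pairExponent p)
          rw [pairExponent_zero, pairExponent_one, Finset.HasAntidiagonal.mem_antidiagonal.mp hp] at h1
          calc _ ≤ ‖MvPowerSeries.coeff (pairExponent p) f‖ * 1 := by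
                gcongr; exact norm_monomialMultilinear_le _ _
            _ ≤ C / ε ^ n := by rw [mul_one, le_div_iff₀ (by positivity)]; exact h1
      _ = (n + 1) * (C / ε ^ n) := by simp
  have hε2 : (0 : ℝ) ≤ ε / 2 := by positivity
  refine ⟨q, ENNReal.ofReal (ε / 2), ?_⟩
  refine ⟨?_, by simpa using hε, fun {y} hy => ?_⟩
  · refine q.le_radius_of_bound C fun n => ?_
    rw [Real.coe_toNNReal _ hε2]
    calc ‖q n‖ * (ε / 2) ^ n ≤ (n + 1) * (C / ε ^ n) * (ε / 2) ^ n := by gcongr; exact hq n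
      _ = C * ((n + 1) / 2 ^ n) := by rw [div_pow]; field_simp
      _ ≤ C * 1 := by
          gcongr
          rw [div_le_one (by positivity)]
          exact_mod_cast Nat.lt_two_pow_self (n := n)
      _ = C := mul_one C
  · rw [zero_add]
    have hy' : ‖y‖ < ε := by
      have h1 : edist y 0 < ENNReal.ofReal (ε / 2) := hy
      rw [edist_dist, ENNReal.ofReal_lt_ofReal_iff (by positivity), dist_zero_right] at h1
      linarith
    refine (hasSum_antidiagonal_pair (summable_term hε hC hy')).congr_fun fun n => ?_
    simp only [q, sum_apply, smul_apply]
    refine Finset.sum_congr rfl fun p hp => ?_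
    rw [monomialMultilinear_apply (Finset.HasAntidiagonal.mem_antidiagonal.mp hp), pairExponent_zero,
      pairExponent_one, smul_eq_mul]

theorem HasGerm.eventuallyEq {f : MvPowerSeries (Fin 2) ℂ} {F : ℂ × ℂ → ℂ} (h : HasGerm f F) :
    F =ᶠ[𝓝 0] seriesSum f :=
  Eventually.mono h fun _ hy => hy.tsum_eq.symm

theorem HasGerm.analyticAt {f : MvPowerSeries (Fin 2) ℂ} {F : ℂ × ℂ → ℂ} (h : HasGerm f F) :
    AnalyticAt ℂ F 0 :=
  h.geomBounded.analyticAt.congr h.eventuallyEq.symm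

/-- Expanding the `n`-linear term at `y₁ e₁ + y₂ e₂`, the coefficient of `y₁ ^ i y₂ ^ (n - i)` is a
sum over the `i`-element sets of slots. There are at most `2 ^ n` of them, which costs a factor `2`
in the radius. -/
theorem exists_hasGerm {F : ℂ × ℂ → ℂ} (hF : AnalyticAt ℂ F 0) : ∃ f, HasGerm f F := by
  obtain ⟨p, r, hp⟩ := hF
  obtain ⟨s, hs0, hsr⟩ := ENNReal.lt_iff_exists_nnreal_btwn.mp hp.r_pos
  obtain ⟨C, hC0, hC⟩ := p.norm_mul_pow_le_of_lt_radius (hsr.trans_le hp.r_le)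
  have hs : (0 : ℝ) < s := by exact_mod_cast hs0
  let E : (n : ℕ) → Finset (Fin n) → ℂ := fun n S =>
    p n (S.piecewise (fun _ => ((1 : ℂ), (0 : ℂ))) fun _ => ((0 : ℂ), (1 : ℂ)))
  let c : ℕ → ℕ → ℂ := fun n i => ∑ S ∈ Finset.univ.filter (fun S : Finset (Fin n) => S.card = i), E n S
  have hE : ∀ n S, ‖E n S‖ ≤ C / s ^ n := by
    intro n S
    rw [le_div_iff₀ (by positivity)]
    refine le_trans ?_ (hC n)
    gcongr
    refine ((p n).le_opNorm _).trans ?_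
    rw [mul_comm]
    refine mul_le_of_le_one_left (norm_nonneg _) (Finset.prod_le_one (fun _ _ => norm_nonneg _) ?_)
    intro j _
    by_cases hj : j ∈ S <;> simp [Finset.piecewise, hj]
  have hc : ∀ n i, ‖c n i‖ ≤ 2 ^ n * (C / s ^ n) := by
    intro n i
    refine (norm_sum_le_of_le _ fun S _ => hE n S).trans ?_
    rw [Finset.sum_const, nsmul_eq_mul]
    gcongr
    have := Finset.card_filter_le (Finset.univ) (fun S : Finset (Fin n) => S.card = i)
    rw [Finset.card_univ, Fintype.card_finset, Fintype.card_fin] at this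
    exact_mod_cast this
  let f : MvPowerSeries (Fin 2) ℂ := fun k => c (k 0 + k 1) (k 0)
  have hcoeff : ∀ k : Fin 2 →₀ ℕ, MvPowerSeries.coeff k f = c (k 0 + k 1) (k 0) := fun k => rfl
  have hb : ∀ k : Fin 2 →₀ ℕ, ‖MvPowerSeries.coeff k f‖ * (s / 2 : ℝ) ^ (k 0 + k 1) ≤ C := by
    intro k
    rw [hcoeff]
    calc _ ≤ 2 ^ (k 0 + k 1) * (C / s ^ (k 0 + k 1)) * (s / 2 : ℝ) ^ (k 0 + k 1) := by
          gcongr; exact hc _ _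
      _ = C := by rw [div_pow]; field_simp
  have hhom : ∀ (n : ℕ) (y : ℂ × ℂ), p n (fun _ => y) =
      ∑ q ∈ Finset.HasAntidiagonal.antidiagonal n, c n q.1 * (y.1 ^ q.1 * y.2 ^ q.2) := by
    intro n y
    have h1 : (fun _ : Fin n => y) =
        (fun _ => y.1 • ((1 : ℂ), (0 : ℂ))) + fun _ => y.2 • ((0 : ℂ), (1 : ℂ)) := by
      funext j; ext <;> simp
    have h2 : ∀ S : Finset (Fin n), p n (S.piecewise (fun _ => y.1 • ((1 : ℂ), (0 : ℂ)))
        fun _ => y.2 • ((0 : ℂ), (1 : ℂ))) = E n S * (y.1 ^ S.card * y.2 ^ (n - S.card)) := by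
      intro S
      have h3 : S.piecewise (fun _ => y.1 • ((1 : ℂ), (0 : ℂ))) (fun _ => y.2 • ((0 : ℂ), (1 : ℂ)))
          = fun j => (S.piecewise (fun _ => y.1) (fun _ => y.2) j : ℂ) •
            (S.piecewise (fun _ => ((1 : ℂ), (0 : ℂ))) (fun _ => ((0 : ℂ), (1 : ℂ))) j : ℂ × ℂ) := by
        funext j
        by_cases hj : j ∈ S <;> simp [Finset.piecewise, hj]
      rw [h3, ContinuousMultilinearMap.map_smul_univ, smul_eq_mul, mul_comm]
      congr 1
      rw [Finset.prod_piecewise]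
      simp [Finset.card_sdiff]
    rw [h1, ContinuousMultilinearMap.map_add_univ, Finset.Nat.sum_antidiagonal_eq_sum_range_succ_mk]
    simp only [h2, c, Finset.sum_mul]
    rw [← Finset.sum_fiberwise_of_maps_to (s := Finset.univ) (t := Finset.range n.succ)
      (g := fun S : Finset (Fin n) => S.card)]
    · refine Finset.sum_congr rfl fun i _ => Finset.sum_congr rfl fun S hS => ?_
      rw [(Finset.mem_filter.mp hS).2]
    · intro S _
      rw [Finset.mem_range, Nat.lt_succ_iff]
      simpa using Finset.card_le_univ S
  refine ⟨f, ?_⟩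
  have hs2 : (0 : ℝ) < s / 2 := by positivity
  filter_upwards [Metric.ball_mem_nhds (0 : ℂ × ℂ) hs2] with y hy
  rw [mem_ball_zero_iff] at hy
  have hsum := summable_term hs2 hb hy
  have h1 := hasSum_antidiagonal_pair hsum
  have h2 := hp.hasSum (y := y) (by
    rw [Metric.mem_eball, edist_zero_right]
    refine lt_trans ?_ hsr
    rw [← ofReal_norm, ← ENNReal.ofReal_coe_nnreal]
    exact (ENNReal.ofReal_lt_ofReal_iff hs).mpr (by linarith))
  rw [zero_add] at h2
  have h3 : (fun n => ∑ p ∈ Finset.HasAntidiagonal.antidiagonal n, MvPowerSeries.coeff (pairExponent p) f *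
      (y.1 ^ pairExponent p 0 * y.2 ^ pairExponent p 1)) = fun n => p n fun _ => y := by
    funext n
    rw [hhom]
    refine Finset.sum_congr rfl fun q hq => ?_
    rw [hcoeff, pairExponent_zero, pairExponent_one, Finset.HasAntidiagonal.mem_antidiagonal.mp hq]
  rw [h3] at h1
  rw [h2.unique h1]
  exact hsum.hasSum

/-- For `‖z‖ < δ / 2` the terms of degree at least `N` are bounded by `(2 ‖z‖ / δ) ^ N` times a
convergent geometric series. -/
theorem HasGerm.hasJets {f : MvPowerSeries (Fin 2) ℂ} {F : ℂ × ℂ → ℂ} (h : HasGerm f F) :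
    HasJets f fun z => F (z 0, z 1) := fun N => by
  obtain ⟨ε, hε, hb⟩ := Metric.eventually_nhds_iff_ball.mp h
  obtain ⟨δ, hδ, C, hC⟩ := h.geomBounded
  refine ⟨MvPowerSeries.truncTotal N f, MvPowerSeries.le_order_sub_truncTotal f N, ?_⟩
  have hC0 : 0 ≤ C := le_trans (by positivity) (hC 0)
  set K := ∑' k : Fin 2 →₀ ℕ, C * ((1 : ℝ) / 2) ^ (k 0 + k 1) with hK
  have hKs : Summable fun k : Fin 2 →₀ ℕ => C * ((1 : ℝ) / 2) ^ (k 0 + k 1) :=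
    (summable_geometric_pair (by norm_num) (by norm_num)).mul_left C
  refine IsBigO.of_bound ((2 / δ) ^ N * K) ?_
  filter_upwards [Metric.ball_mem_nhds (0 : Fin 2 → ℂ) hε,
    Metric.ball_mem_nhds (0 : Fin 2 → ℂ) (half_pos hδ)] with z hz hz'
  rw [mem_ball_zero_iff] at hz hz'
  have hzn : ‖(z 0, z 1)‖ ≤ ‖z‖ := max_le (norm_le_pi_norm z 0) (norm_le_pi_norm z 1)
  have h1 := hb (z 0, z 1) (mem_ball_zero_iff.mpr (hzn.trans_lt hz))
  set p := MvPowerSeries.truncTotal N f with hp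
  have hpc : ∀ k : Fin 2 →₀ ℕ, MvPolynomial.coeff k p =
      if k 0 + k 1 < N then MvPowerSeries.coeff k f else 0 := by
    intro k
    rw [hp, MvPowerSeries.coeff_truncTotal_eq_ite, Finsupp.degree_eq_sum, Fin.sum_univ_two]
  have h2 : HasSum (fun k : Fin 2 →₀ ℕ => MvPolynomial.coeff k p * (z 0 ^ k 0 * z 1 ^ k 1))
      (MvPolynomial.eval z p) := by
    rw [MvPolynomial.eval_eq']
    simp only [Fin.prod_univ_two]
    refine hasSum_sum_of_ne_finset_zero fun k hk => ?_
    rw [MvPolynomial.notMem_support_iff.mp hk, zero_mul]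
  have h3 := h1.sub h2
  rw [← h3.tsum_eq, norm_pow, norm_norm]
  have h4 : ∀ k : Fin 2 →₀ ℕ, ‖MvPowerSeries.coeff k f * (z 0 ^ k 0 * z 1 ^ k 1) -
      MvPolynomial.coeff k p * (z 0 ^ k 0 * z 1 ^ k 1)‖ ≤
      (2 / δ) ^ N * ‖z‖ ^ N * (C * ((1 : ℝ) / 2) ^ (k 0 + k 1)) := by
    intro k
    rw [hpc]
    split_ifs with hk
    · rw [sub_self, norm_zero]; positivity
    · rw [zero_mul, sub_zero]
      refine (norm_term_le hδ hC hzn k).trans ?_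
      obtain ⟨m, hm⟩ := Nat.exists_eq_add_of_le (not_lt.mp hk)
      rw [hm, pow_add, pow_add]
      have h5 : (‖z‖ / δ) ^ m ≤ (1 / 2) ^ m := by
        refine pow_le_pow_left₀ (by positivity) ?_ m
        rw [div_le_iff₀ hδ]; linarith
      have h6 : (‖z‖ / δ) ^ N = (2 / δ) ^ N * ‖z‖ ^ N * (1 / 2) ^ N := by
        rw [← mul_pow, ← mul_pow]; congr 1; field_simp
      calc C * ((‖z‖ / δ) ^ N * (‖z‖ / δ) ^ m) ≤ C * ((‖z‖ / δ) ^ N * (1 / 2) ^ m) := by gcongr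
        _ = _ := by rw [h6]; ring
  refine (tsum_of_norm_bounded (hKs.hasSum.mul_left _) h4).trans (le_of_eq ?_)
  rw [hK]; ring

/-- The transfer in the other direction: an analytic germ is determined by its expansion, so a
formal identity yields an identity of germs. -/
theorem eventuallyEq_of_hasJets {f : MvPowerSeries (Fin 2) ℂ} {F G : ℂ × ℂ → ℂ}
    (hF : AnalyticAt ℂ F 0) (hG : AnalyticAt ℂ G 0) (hf : HasJets f fun z => F (z 0, z 1))
    (hg : HasJets f fun z => G (z 0, z 1)) : F =ᶠ[𝓝 0] G := by
  obtain ⟨a, ha⟩ := exists_hasGerm hF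
  obtain ⟨b, hb⟩ := exists_hasGerm hG
  have h1 : a = f := ha.hasJets.unique hf
  have h2 : b = f := hb.hasJets.unique hg
  subst h1
  subst h2
  exact ha.eventuallyEq.trans hb.eventuallyEq.symm

end

/-! ### Quadratic expansion at the saddle point and Morse chart. -/

noncomputable section

open Asymptotics

theorem seriesSum_zero (f : MvPowerSeries (Fin 2) ℂ) :
    seriesSum f 0 = MvPowerSeries.constantCoeff f := by
  rw [seriesSum, tsum_eq_single 0]
  · simp
  · intro k hk
    have h1 : k 0 ≠ 0 ∨ k 1 ≠ 0 := by
      by_contra h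
      push Not at h
      exact hk (by ext i; fin_cases i <;> simp [h.1, h.2])
    rcases h1 with h | h <;> simp [h]

theorem GeomBounded.of_shift {f g : MvPowerSeries (Fin 2) ℂ} (hf : GeomBounded f)
    (e : Fin 2 →₀ ℕ)
    (h : ∀ k, ‖MvPowerSeries.coeff k g‖ ≤ ‖MvPowerSeries.coeff (k + e) f‖) : GeomBounded g := by
  obtain ⟨ε, hε, C, hC⟩ := hf
  refine ⟨ε, hε, C / ε ^ (e 0 + e 1), fun k => ?_⟩
  rw [le_div_iff₀ (by positivity), mul_assoc, ← pow_add]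
  refine le_trans ?_ (hC (k + e))
  rw [Finsupp.add_apply, Finsupp.add_apply, show k 0 + e 0 + (k 1 + e 1) = k 0 + k 1 + (e 0 + e 1) by ring]
  exact mul_le_mul_of_nonneg_right (h k) (by positivity)

theorem hasJets_pairExponent (p : ℕ × ℕ) :
    HasJets (MvPowerSeries.monomial (pairExponent p) (1 : ℂ)) fun z => z 0 ^ p.1 * z 1 ^ p.2 := by
  have := HasJets.of_polynomial (MvPolynomial.monomial (pairExponent p) (1 : ℂ))
  rw [MvPolynomial.coe_monomial] at this
  refine this.congr (Eventually.of_forall fun z => ?_)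
  simp only [MvPolynomial.eval_monomial, one_mul]
  rw [Finsupp.prod_fintype _ _ (fun i => pow_zero _), Fin.prod_univ_two, pairExponent_zero,
    pairExponent_one]

theorem pairExponent_le_iff (p : ℕ × ℕ) (k : Fin 2 →₀ ℕ) :
    pairExponent p ≤ k ↔ p.1 ≤ k 0 ∧ p.2 ≤ k 1 := by
  rw [Finsupp.le_def, Fin.forall_fin_two, pairExponent_zero, pairExponent_one]

theorem coeff_of_saddle {f : MvPowerSeries (Fin 2) ℂ} {H : ℂ × ℂ → ℂ} {l : ℂ} (hf : HasGerm f H)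
    (hHl : (fun y : ℂ × ℂ => H y - l * (y.1 * y.2)) =o[𝓝 0] fun y : ℂ × ℂ => ‖y‖ ^ 2)
    {k : Fin 2 →₀ ℕ} (hk : k 0 + k 1 ≤ 2) :
    MvPowerSeries.coeff k f = if k = pairExponent (1, 1) then l else 0 := by
  obtain ⟨p, hp, hF⟩ := hf.hasJets 3
  have hkd : k.degree ≤ 2 := by rwa [Finsupp.degree_eq_sum, Fin.sum_univ_two]
  set q := p - MvPolynomial.monomial (pairExponent (1, 1)) l with hq
  have hev : ∀ z : Fin 2 → ℂ, MvPolynomial.eval z q = MvPolynomial.eval z p - l * (z 0 * z 1) := by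
    intro z
    rw [hq, map_sub, MvPolynomial.eval_monomial, Finsupp.prod_fintype _ _ (fun i => pow_zero _),
      Fin.prod_univ_two, pairExponent_zero, pairExponent_one, pow_one, pow_one]
  have hpr : Tendsto (fun z : Fin 2 → ℂ => (z 0, z 1)) (𝓝 0) (𝓝 (0 : ℂ × ℂ)) := by
    have : Continuous fun z : Fin 2 → ℂ => (z 0, z 1) := by fun_prop
    exact this.tendsto' 0 0 rfl
  have h1 : (fun z : Fin 2 → ℂ => H (z 0, z 1) - l * (z 0 * z 1)) =o[𝓝 0] fun z => ‖z‖ ^ 2 := by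
    refine (hHl.comp_tendsto hpr).trans_isBigO (IsBigO.of_bound 1 (Eventually.of_forall fun z => ?_))
    rw [one_mul, Function.comp_apply, norm_pow, norm_norm, norm_pow, norm_norm]
    exact pow_le_pow_left₀ (norm_nonneg _)
      (max_le (norm_le_pi_norm z 0) (norm_le_pi_norm z 1)) 2
  have h2 : (fun z : Fin 2 → ℂ => H (z 0, z 1) - MvPolynomial.eval z p) =o[𝓝 0]
      fun z => ‖z‖ ^ 2 :=
    hF.trans_isLittleO ((isLittleO_pow_pow (𝕜 := ℝ) (by norm_num : 2 < 3)).comp_tendsto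
      (tendsto_norm_zero (E := Fin 2 → ℂ)))
  have h3 : (fun z : Fin 2 → ℂ => MvPolynomial.eval z q) =o[𝓝 0] fun z => ‖z‖ ^ 2 :=
    (h1.sub h2).congr_left fun z => by rw [hev]; ring
  have h4 := MvPolynomial.coeff_eq_zero_of_isLittleO h3 hkd
  have h5 := MvPowerSeries.coeff_of_lt_order (f := f - (p : MvPowerSeries (Fin 2) ℂ)) (d := k)
    (lt_of_lt_of_le (by exact_mod_cast Nat.lt_succ_of_le hkd) hp)
  rw [map_sub, MvPolynomial.coeff_coe, sub_eq_zero] at h5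
  rw [hq, MvPolynomial.coeff_sub, sub_eq_zero] at h4
  rw [h5, h4, MvPolynomial.coeff_monomial]
  simp only [eq_comm]

/-- Second order Hadamard expansion of a function with a saddle point at the origin. -/
theorem exists_quadratic_expansion {H : ℂ × ℂ → ℂ} {l : ℂ} (hH : AnalyticAt ℂ H 0)
    (hHl : (fun y : ℂ × ℂ => H y - l * (y.1 * y.2)) =o[𝓝 0] fun y : ℂ × ℂ => ‖y‖ ^ 2) :
    ∃ A B C : ℂ × ℂ → ℂ, AnalyticAt ℂ A 0 ∧ AnalyticAt ℂ B 0 ∧ AnalyticAt ℂ C 0 ∧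
      A 0 = 0 ∧ B 0 = l ∧ C 0 = 0 ∧
      ∀ᶠ y in 𝓝 (0 : ℂ × ℂ), H y = y.1 ^ 2 * A y + y.1 * y.2 * B y + y.2 ^ 2 * C y := by
  obtain ⟨f, hf⟩ := exists_hasGerm hH
  have hco := fun {k} hk => coeff_of_saddle hf hHl (k := k) hk
  -- Each monomial of `f` is assigned to one quotient: `a` receives the multiples of `y₁²`, `b` the
  -- multiples of `y₁ y₂` of degree one in `y₁`, and `c` the powers of `y₂` from `y₂²` on. The
  -- remaining monomials `1, y₁, y₂` have zero coefficient.
  let a : MvPowerSeries (Fin 2) ℂ := fun k => MvPowerSeries.coeff (k + pairExponent (2, 0)) f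
  let b : MvPowerSeries (Fin 2) ℂ := fun k =>
    if k 0 = 0 then MvPowerSeries.coeff (k + pairExponent (1, 1)) f else 0
  let c : MvPowerSeries (Fin 2) ℂ := fun k =>
    if k 0 = 0 then MvPowerSeries.coeff (k + pairExponent (0, 2)) f else 0
  have ha : ∀ k, MvPowerSeries.coeff k a = MvPowerSeries.coeff (k + pairExponent (2, 0)) f :=
    fun k => rfl
  have hb : ∀ k, MvPowerSeries.coeff k b =
    if k 0 = 0 then MvPowerSeries.coeff (k + pairExponent (1, 1)) f else 0 := fun k => rfl
  have hc : ∀ k, MvPowerSeries.coeff k c =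
    if k 0 = 0 then MvPowerSeries.coeff (k + pairExponent (0, 2)) f else 0 := fun k => rfl
  have hab : GeomBounded a := hf.geomBounded.of_shift _ fun k => (congrArg norm (ha k)).le
  have hbb : GeomBounded b := hf.geomBounded.of_shift (pairExponent (1, 1)) fun k => by
    rw [hb]; split_ifs <;> simp
  have hcb : GeomBounded c := hf.geomBounded.of_shift (pairExponent (0, 2)) fun k => by
    rw [hc]; split_ifs <;> simp
  have hid : f = MvPowerSeries.monomial (pairExponent (2, 0)) (1 : ℂ) * a +
      MvPowerSeries.monomial (pairExponent (1, 1)) (1 : ℂ) * b +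
      MvPowerSeries.monomial (pairExponent (0, 2)) (1 : ℂ) * c := by
    ext k
    simp only [map_add, MvPowerSeries.coeff_monomial_mul, one_mul, pairExponent_le_iff, ha, hb, hc,
      Finsupp.tsub_apply, pairExponent_zero]
    by_cases h2 : 2 ≤ k 0
    · have e1 : ¬ (k 0 - 1 = 0) := by omega
      have e2 : ¬ (k 0 - 0 = 0) := by omega
      rw [if_pos ⟨h2, Nat.zero_le _⟩, if_neg e1, if_neg e2, ite_self, ite_self, add_zero, add_zero,
        tsub_add_cancel_of_le ((pairExponent_le_iff _ _).mpr ⟨h2, Nat.zero_le _⟩)]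
    · rw [if_neg (fun h => h2 h.1), zero_add]
      by_cases h1 : 1 ≤ k 0
      · have e1 : k 0 - 1 = 0 := by omega
        have e2 : ¬ (k 0 - 0 = 0) := by omega
        rw [if_pos e1, if_neg e2, ite_self, add_zero]
        split_ifs with h
        · rw [tsub_add_cancel_of_le ((pairExponent_le_iff _ _).mpr h)]
        · have hk1 : k 1 = 0 := by
            by_contra hne
            exact h ⟨h1, Nat.one_le_iff_ne_zero.mpr hne⟩
          rw [hco (by omega), if_neg]
          intro he
          have := DFunLike.congr_fun he 1
          rw [pairExponent_one] at this
          omega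
      · rw [if_neg (fun h => h1 h.1), zero_add, if_pos (by omega : k 0 - 0 = 0)]
        split_ifs with h
        · rw [tsub_add_cancel_of_le ((pairExponent_le_iff _ _).mpr h)]
        · have hk1 : ¬ 2 ≤ k 1 := fun hle => h ⟨Nat.zero_le _, hle⟩
          rw [hco (by omega), if_neg]
          intro he
          have := DFunLike.congr_fun he 0
          rw [pairExponent_zero] at this
          omega
  refine ⟨seriesSum a, seriesSum b, seriesSum c, hab.analyticAt, hbb.analyticAt, hcb.analyticAt,
    ?_, ?_, ?_, ?_⟩
  · rw [seriesSum_zero, ← MvPowerSeries.coeff_zero_eq_constantCoeff_apply, ha, zero_add,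
      hco (by simp), if_neg]
    simp [pairExponent.injective.eq_iff]
  · rw [seriesSum_zero, ← MvPowerSeries.coeff_zero_eq_constantCoeff_apply, hb, if_pos Finsupp.zero_apply, zero_add,
      hco (by simp), if_pos rfl]
  · rw [seriesSum_zero, ← MvPowerSeries.coeff_zero_eq_constantCoeff_apply, hc, if_pos Finsupp.zero_apply, zero_add,
      hco (by simp), if_neg]
    simp [pairExponent.injective.eq_iff]
  · have hR : AnalyticAt ℂ (fun y : ℂ × ℂ => y.1 ^ 2 * seriesSum a y + y.1 * y.2 * seriesSum b y +
        y.2 ^ 2 * seriesSum c y) 0 := by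
      have := hab.analyticAt
      have := hbb.analyticAt
      have := hcb.analyticAt
      have := analyticAt_fst (𝕜 := ℂ) (p := (0 : ℂ × ℂ))
      have := analyticAt_snd (𝕜 := ℂ) (p := (0 : ℂ × ℂ))
      fun_prop
    refine eventuallyEq_of_hasJets (f := f) hH hR hf.hasJets ?_
    have h1 := (((hasJets_pairExponent (2, 0)).mul hab.hasGerm.hasJets).add
      ((hasJets_pairExponent (1, 1)).mul hbb.hasGerm.hasJets)).add
      ((hasJets_pairExponent (0, 2)).mul hcb.hasGerm.hasJets)
    rw [← hid] at h1
    refine h1.congr (Eventually.of_forall fun z => ?_)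
    simp

/-- Local analytic coordinates `U` with inverse `G` in which `H` is the product `u₁ u₂`. -/
structure IsMorseChart (H : ℂ × ℂ → ℂ) (l : ℂ) (U G : ℂ × ℂ → ℂ × ℂ) : Prop where
  analyticAt_chart : AnalyticAt ℂ U 0
  analyticAt_inverse : AnalyticAt ℂ G 0
  chart_zero : U 0 = 0
  inverse_zero : G 0 = 0
  left_inverse : ∀ᶠ y in 𝓝 (0 : ℂ × ℂ), G (U y) = y
  right_inverse : ∀ᶠ u in 𝓝 (0 : ℂ × ℂ), U (G u) = u
  chart_mul : ∀ᶠ y in 𝓝 (0 : ℂ × ℂ), (U y).1 * (U y).2 = H y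
  fderiv_chart : ∀ v, fderiv ℂ U 0 v = (v.1, l * v.2)
  fderiv_inverse : ∀ v, fderiv ℂ G 0 v = (v.1, l⁻¹ * v.2)

/-- The form `A y₁² + B y₁ y₂ + C y₂²` splits over the ring of germs: `d` is the root near `B` of
`d² - B d + A C = 0`, given by an analytic square root of `1 - 4 A C / B²`, and `φ = C / d`. -/
theorem exists_factorization {H : ℂ × ℂ → ℂ} {l : ℂ} (hl : l ≠ 0) (hH : AnalyticAt ℂ H 0)
    (hHl : (fun y : ℂ × ℂ => H y - l * (y.1 * y.2)) =o[𝓝 0] fun y : ℂ × ℂ => ‖y‖ ^ 2) :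
    ∃ φ A d : ℂ × ℂ → ℂ, AnalyticAt ℂ φ 0 ∧ AnalyticAt ℂ A 0 ∧ AnalyticAt ℂ d 0 ∧
      φ 0 = 0 ∧ A 0 = 0 ∧ d 0 = l ∧ ∀ᶠ y in 𝓝 (0 : ℂ × ℂ),
        (y.1 + φ y * y.2) * (A y * y.1 + d y * y.2) = H y := by
  obtain ⟨A, B, C, hA, hB, hC, hA0, hB0, hC0, hHy⟩ := exists_quadratic_expansion hH hHl
  have hB0' : B 0 ≠ 0 := by rwa [hB0]
  let s : ℂ × ℂ → ℂ := fun y => 1 - 4 * A y * C y / B y ^ 2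
  have hs : AnalyticAt ℂ s 0 := by
    have : B 0 ^ 2 ≠ 0 := pow_ne_zero 2 hB0'
    fun_prop (disch := assumption)
  have hs0 : s 0 = 1 := by simp [s, hA0]
  let q : ℂ × ℂ → ℂ := fun y => Complex.exp (Complex.log (s y) / 2)
  have hq : AnalyticAt ℂ q 0 := by
    have h1 := hs.clog (by rw [hs0]; exact Complex.one_mem_slitPlane)
    have h2 : AnalyticAt ℂ (fun y => Complex.log (s y) / 2) 0 := h1.div_const
    exact h2.cexp
  have hq0 : q 0 = 1 := by simp [q, hs0]
  let d : ℂ × ℂ → ℂ := fun y => B y * (1 + q y) / 2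
  have hd : AnalyticAt ℂ d 0 := (hB.mul (analyticAt_const.add hq)).div_const
  have hd0 : d 0 = l := by simp only [d, hq0, hB0]; ring
  have hd0' : d 0 ≠ 0 := by rwa [hd0]
  refine ⟨fun y => C y / d y, A, d, hC.div hd hd0', hA, hd, by simp [hC0], hA0, hd0, ?_⟩
  filter_upwards [hHy, hs.continuousAt.eventually_ne (by rw [hs0]; exact one_ne_zero),
    hB.continuousAt.eventually_ne hB0', hd.continuousAt.eventually_ne hd0'] with y h1 h2 h3 h4
  have hq2 : q y ^ 2 = s y := by
    simp only [q]
    rw [← Complex.exp_nat_mul]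
    rw [show ((2 : ℕ) : ℂ) * (Complex.log (s y) / 2) = Complex.log (s y) by push_cast; ring,
      Complex.exp_log h2]
  have hq3 : q y ^ 2 * B y ^ 2 = B y ^ 2 - 4 * A y * C y := by
    rw [hq2]; simp only [s]; field_simp
  have hdd : d y ^ 2 + A y * C y = B y * d y := by
    simp only [d]; linear_combination hq3 / 4
  rw [h1]
  field_simp
  linear_combination y.1 * y.2 * hdd

/-- The two factors of `H` have differentials `y₁` and `l y₂` at the origin, so they are local
coordinates by the inverse function theorem. -/
theorem exists_isMorseChart {H : ℂ × ℂ → ℂ} {l : ℂ} (hl : l ≠ 0) (hH : AnalyticAt ℂ H 0)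
    (hHl : (fun y : ℂ × ℂ => H y - l * (y.1 * y.2)) =o[𝓝 0] fun y : ℂ × ℂ => ‖y‖ ^ 2) :
    ∃ U G, IsMorseChart H l U G := by
  obtain ⟨φ, A, d, hφ, hA, hd, hφ0, hA0, hd0, hmul⟩ := exists_factorization hl hH hHl
  let U : ℂ × ℂ → ℂ × ℂ := fun y => (y.1 + φ y * y.2, A y * y.1 + d y * y.2)
  have hU : AnalyticAt ℂ U 0 := by
    have h1 := analyticAt_fst (𝕜 := ℂ) (p := (0 : ℂ × ℂ))
    have h2 := analyticAt_snd (𝕜 := ℂ) (p := (0 : ℂ × ℂ))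
    exact (h1.add (hφ.mul h2)).prod ((hA.mul h1).add (hd.mul h2))
  have hU0 : U 0 = 0 := by simp [U]
  let i : (ℂ × ℂ) ≃L[ℂ] (ℂ × ℂ) := (ContinuousLinearEquiv.refl ℂ ℂ).prodCongr
    (ContinuousLinearEquiv.unitsEquivAut ℂ (Units.mk0 l hl))
  have hUd : HasFDerivAt U (i : (ℂ × ℂ) →L[ℂ] (ℂ × ℂ)) 0 := by
    have hp1 := hφ.differentiableAt.hasFDerivAt
    have hp2 := hA.differentiableAt.hasFDerivAt
    have hp3 := hd.differentiableAt.hasFDerivAt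
    have h1 := (hasFDerivAt_fst (𝕜 := ℂ) (p := (0 : ℂ × ℂ))).add
      (hp1.mul (hasFDerivAt_snd (𝕜 := ℂ) (p := (0 : ℂ × ℂ))))
    have h2 := (hp2.mul (hasFDerivAt_fst (𝕜 := ℂ) (p := (0 : ℂ × ℂ)))).add
      (hp3.mul (hasFDerivAt_snd (𝕜 := ℂ) (p := (0 : ℂ × ℂ))))
    refine (h1.prodMk h2).congr_fderiv ?_
    ext <;> simp [i, hφ0, hA0, hd0]
  have hUs : HasStrictFDerivAt U (i : (ℂ × ℂ) →L[ℂ] (ℂ × ℂ)) 0 := by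
    have := hU.hasStrictFDerivAt
    rwa [hUd.fderiv] at this
  have hGa : AnalyticAt ℂ (hUs.localInverse U i 0) 0 := by
    have := (hUs.toOpenPartialHomeomorph U).analyticAt_symm'
      hUs.mem_toOpenPartialHomeomorph_source hU hUd.fderiv
    rw [hUs.toOpenPartialHomeomorph_coe, hU0] at this
    exact this
  have hGd : HasFDerivAt (hUs.localInverse U i 0) (i.symm : (ℂ × ℂ) →L[ℂ] (ℂ × ℂ)) 0 := by
    have := hUs.to_localInverse.hasFDerivAt
    rwa [hU0] at this
  refine ⟨U, hUs.localInverse U i 0, hU, hGa, hU0, ?_, hUs.eventually_left_inverse, ?_, hmul, ?_, ?_⟩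
  · have := hUs.localInverse_apply_image
    rwa [hU0] at this
  · have := hUs.eventually_right_inverse
    rwa [hU0] at this
  · intro v
    rw [hUd.fderiv]
    simp only [i, ContinuousLinearEquiv.coe_coe, ContinuousLinearEquiv.prodCongr_apply]
    rw [ContinuousLinearEquiv.unitsEquivAut_apply, Units.val_mk0, mul_comm]
    rfl
  · intro v
    rw [hGd.fderiv]
    simp only [i, ContinuousLinearEquiv.coe_coe, ContinuousLinearEquiv.prodCongr_symm,
      ContinuousLinearEquiv.prodCongr_apply]
    rw [ContinuousLinearEquiv.unitsEquivAut_apply_symm, Units.val_inv_eq_inv_val, Units.val_mk0,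
      mul_comm]
    rfl

end

/-! ### The saddle derivation and resonant monomials. -/

noncomputable section

theorem MvPowerSeries.coeff_X_mul_pderiv {σ : Type*} (f : MvPowerSeries σ ℂ) (i : σ) (k : σ →₀ ℕ) :
    MvPowerSeries.coeff k (MvPowerSeries.X i * MvPowerSeries.pderiv ℂ i f) =
      k i * MvPowerSeries.coeff k f := by
  classical
  rw [MvPowerSeries.X, MvPowerSeries.coeff_monomial_mul, one_mul, MvPowerSeries.coeff_pderiv]
  by_cases h : 1 ≤ k i
  · have h1 : Finsupp.single i 1 ≤ k := by simpa using h
    rw [if_pos h1, tsub_add_cancel_of_le h1, mul_comm]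
    congr 1
    rw [Finsupp.tsub_apply, Finsupp.single_eq_same, Nat.cast_sub h]
    push_cast; ring
  · rw [if_neg (by simpa using h)]
    have : k i = 0 := by omega
    simp [this]

/-- The derivation `X₀ ∂₀ - X₁ ∂₁`. -/
def saddleDeriv : Derivation ℂ (MvPowerSeries (Fin 2) ℂ) (MvPowerSeries (Fin 2) ℂ) :=
  (MvPowerSeries.X 0 : MvPowerSeries (Fin 2) ℂ) • MvPowerSeries.pderiv ℂ 0 -
    (MvPowerSeries.X 1 : MvPowerSeries (Fin 2) ℂ) • MvPowerSeries.pderiv ℂ 1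

theorem saddleDeriv_apply (f : MvPowerSeries (Fin 2) ℂ) :
    saddleDeriv f = MvPowerSeries.X 0 * MvPowerSeries.pderiv ℂ 0 f -
      MvPowerSeries.X 1 * MvPowerSeries.pderiv ℂ 1 f := rfl

theorem coeff_saddleDeriv (f : MvPowerSeries (Fin 2) ℂ) (k : Fin 2 →₀ ℕ) :
    MvPowerSeries.coeff k (saddleDeriv f) = ((k 0 : ℂ) - k 1) * MvPowerSeries.coeff k f := by
  rw [saddleDeriv_apply, map_sub, MvPowerSeries.coeff_X_mul_pderiv,
    MvPowerSeries.coeff_X_mul_pderiv, sub_mul]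

theorem constantCoeff_X_mul_X :
    MvPowerSeries.constantCoeff (MvPowerSeries.X 0 * MvPowerSeries.X 1 : MvPowerSeries (Fin 2) ℂ)
      = 0 := by simp

theorem saddleDeriv_subst {a : MvPowerSeries (Fin 2) ℂ} (ha : MvPowerSeries.constantCoeff a = 0)
    (f : PowerSeries ℂ) : saddleDeriv (PowerSeries.subst a f) =
      PowerSeries.subst a (PowerSeries.derivative ℂ f) * saddleDeriv a := by
  simp only [saddleDeriv_apply, MvPowerSeries.pderiv_powerSeries_subst ha]
  ring

theorem pderiv_zero_X_mul_X : MvPowerSeries.pderiv ℂ 0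
    (MvPowerSeries.X 0 * MvPowerSeries.X 1 : MvPowerSeries (Fin 2) ℂ) = MvPowerSeries.X 1 := by
  rw [Derivation.leibniz, MvPowerSeries.pderiv_X_self,
    MvPowerSeries.pderiv_X_of_ne (by decide : (1 : Fin 2) ≠ 0)]
  simp

theorem pderiv_one_X_mul_X : MvPowerSeries.pderiv ℂ 1
    (MvPowerSeries.X 0 * MvPowerSeries.X 1 : MvPowerSeries (Fin 2) ℂ) = MvPowerSeries.X 0 := by
  rw [Derivation.leibniz, MvPowerSeries.pderiv_X_self,
    MvPowerSeries.pderiv_X_of_ne (by decide : (0 : Fin 2) ≠ 1)]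
  simp

theorem saddleDeriv_subst_X_mul_X (f : PowerSeries ℂ) : saddleDeriv
    (PowerSeries.subst (MvPowerSeries.X 0 * MvPowerSeries.X 1 : MvPowerSeries (Fin 2) ℂ) f) = 0 := by
  rw [saddleDeriv_subst constantCoeff_X_mul_X, saddleDeriv_apply, pderiv_zero_X_mul_X,
    pderiv_one_X_mul_X]
  ring

theorem coeff_subst_X_mul_X (f : PowerSeries ℂ) (n : ℕ) :
    MvPowerSeries.coeff (pairExponent (n, n)) (PowerSeries.subst
      (MvPowerSeries.X 0 * MvPowerSeries.X 1 : MvPowerSeries (Fin 2) ℂ) f) =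
      PowerSeries.coeff n f := by
  classical
  have h1 : ∀ d : ℕ, (MvPowerSeries.X 0 * MvPowerSeries.X 1 : MvPowerSeries (Fin 2) ℂ) ^ d =
      MvPowerSeries.monomial (pairExponent (d, d)) 1 := by
    intro d
    rw [mul_pow, MvPowerSeries.X_pow_eq, MvPowerSeries.X_pow_eq,
      MvPowerSeries.monomial_mul_monomial, one_mul]
    rfl
  rw [PowerSeries.coeff_subst (PowerSeries.HasSubst.of_constantCoeff_zero constantCoeff_X_mul_X),
    finsum_eq_single _ n]
  · rw [h1, MvPowerSeries.coeff_monomial_same, smul_eq_mul, mul_one]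
  · intro d hd
    rw [h1, MvPowerSeries.coeff_monomial_ne, smul_zero]
    intro he
    have := DFunLike.congr_fun he 0
    simp only [pairExponent_zero] at this
    exact hd this.symm

theorem coeff_eq_zero_of_saddleDeriv_eq_zero {f : MvPowerSeries (Fin 2) ℂ}
    (hf : saddleDeriv f = 0) {k : Fin 2 →₀ ℕ} (hk : k 0 ≠ k 1) : MvPowerSeries.coeff k f = 0 := by
  have := coeff_saddleDeriv f k
  rw [hf, map_zero, zero_eq_mul] at this
  exact this.resolve_left (sub_ne_zero.mpr (by exact_mod_cast hk))

/-- The part of a power series consisting of the monomials `X₀ⁿ X₁ⁿ`. -/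
def resonantPart (f : MvPowerSeries (Fin 2) ℂ) : MvPowerSeries (Fin 2) ℂ := fun k =>
  if k 0 = k 1 then MvPowerSeries.coeff k f else 0

theorem coeff_resonantPart (f : MvPowerSeries (Fin 2) ℂ) (k : Fin 2 →₀ ℕ) :
    MvPowerSeries.coeff k (resonantPart f) =
      if k 0 = k 1 then MvPowerSeries.coeff k f else 0 := rfl

theorem saddleDeriv_resonantPart (f : MvPowerSeries (Fin 2) ℂ) :
    saddleDeriv (resonantPart f) = 0 := by
  ext k
  rw [coeff_saddleDeriv, coeff_resonantPart]
  split_ifs with h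
  · simp [h]
  · simp

theorem resonantPart_saddleDeriv (f : MvPowerSeries (Fin 2) ℂ) :
    resonantPart (saddleDeriv f) = 0 := by
  ext k
  rw [coeff_resonantPart, coeff_saddleDeriv]
  split_ifs with h
  · simp [h]
  · simp

/-- A series killed by `saddleDeriv` contains only diagonal monomials, so multiplication by it
preserves the difference of the two exponents. -/
theorem resonantPart_mul {κ : MvPowerSeries (Fin 2) ℂ} (hκ : saddleDeriv κ = 0)
    (f : MvPowerSeries (Fin 2) ℂ) : resonantPart (κ * f) = κ * resonantPart f := by
  ext k
  rw [coeff_resonantPart, MvPowerSeries.coeff_mul, MvPowerSeries.coeff_mul]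
  split_ifs with h
  · refine Finset.sum_congr rfl fun p hp => ?_
    rw [Finset.HasAntidiagonal.mem_antidiagonal] at hp
    rw [coeff_resonantPart]
    split_ifs with h2
    · rfl
    · rw [coeff_eq_zero_of_saddleDeriv_eq_zero hκ, zero_mul, zero_mul]
      have e0 := DFunLike.congr_fun hp 0
      have e1 := DFunLike.congr_fun hp 1
      rw [Finsupp.add_apply] at e0 e1
      omega
  · refine (Finset.sum_eq_zero fun p hp => ?_).symm
    rw [Finset.HasAntidiagonal.mem_antidiagonal] at hp
    rw [coeff_resonantPart]
    split_ifs with h2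
    · rw [coeff_eq_zero_of_saddleDeriv_eq_zero hκ, zero_mul]
      have e0 := DFunLike.congr_fun hp 0
      have e1 := DFunLike.congr_fun hp 1
      rw [Finsupp.add_apply] at e0 e1
      omega
    · rw [mul_zero]

/-- A primitive for `saddleDeriv` of the non-resonant part of a power series. -/
def saddlePrimitive (f : MvPowerSeries (Fin 2) ℂ) : MvPowerSeries (Fin 2) ℂ := fun k =>
  MvPowerSeries.coeff k f / ((k 0 : ℂ) - k 1)

theorem coeff_saddlePrimitive (f : MvPowerSeries (Fin 2) ℂ) (k : Fin 2 →₀ ℕ) :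
    MvPowerSeries.coeff k (saddlePrimitive f) = MvPowerSeries.coeff k f / ((k 0 : ℂ) - k 1) := rfl

theorem resonantPart_add_saddleDeriv (f : MvPowerSeries (Fin 2) ℂ) :
    resonantPart f + saddleDeriv (saddlePrimitive f) = f := by
  ext k
  rw [map_add, coeff_resonantPart, coeff_saddleDeriv, coeff_saddlePrimitive]
  split_ifs with h
  · simp [h]
  · rw [zero_add, mul_div_cancel₀]
    exact sub_ne_zero.mpr (by exact_mod_cast h)

/-- If `w` is invertible and `X₀ ∂₀ w - X₁ ∂₁ w = (κ + (X₀ ∂₀ - X₁ ∂₁) m) w` with `κ` resonant,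
then `κ = 0`: the logarithmic derivative of `w` has no resonant part. -/
theorem resonant_eq_zero_of_saddleDeriv_eq {w κ m : MvPowerSeries (Fin 2) ℂ}
    (hw : MvPowerSeries.constantCoeff w ≠ 0) (hκ : saddleDeriv κ = 0)
    (hm : MvPowerSeries.constantCoeff m = 0)
    (h : saddleDeriv w = (κ + saddleDeriv m) * w) : κ = 0 := by
  have hm' : MvPowerSeries.constantCoeff (-m) = 0 := by rw [map_neg, hm, neg_zero]
  -- The integrating factor `E = exp(-m)` turns the equation into `D (w E) = κ w E`. The left side
  -- has no resonant part, while `w E` has a nonzero constant term, which is resonant.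
  set E := PowerSeries.subst (-m) (PowerSeries.exp ℂ) with hE
  have hE1 : saddleDeriv E = - (E * saddleDeriv m) := by
    rw [hE, saddleDeriv_subst hm', PowerSeries.derivative_exp, map_neg, mul_neg]
  have hE0 : MvPowerSeries.constantCoeff E = 1 := by
    have h0 : PowerSeries.constantCoeff (PowerSeries.exp ℂ - 1) = 0 := by simp
    have hs := PowerSeries.HasSubst.of_constantCoeff_zero (S := ℂ) hm'
    have h1 := PowerSeries.constantCoeff_subst_eq_zero hm' (PowerSeries.exp ℂ - 1) h0
    rw [PowerSeries.subst_sub hs, map_sub, ← hE, sub_eq_zero] at h1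
    rw [h1, ← map_one (PowerSeries.C (R := ℂ)), PowerSeries.subst_C]
    simp
  have h1 : saddleDeriv (w * E) = κ * (w * E) := by
    rw [Derivation.leibniz, smul_eq_mul, smul_eq_mul, hE1, h]; ring
  have h2 : κ * resonantPart (w * E) = 0 := by
    rw [← resonantPart_mul hκ, ← h1, resonantPart_saddleDeriv]
  refine (mul_eq_zero.mp h2).resolve_right fun h3 => ?_
  have h4 := congrArg (MvPowerSeries.coeff 0) h3
  rw [coeff_resonantPart, if_pos (by simp), MvPowerSeries.coeff_zero_eq_constantCoeff_apply,
    map_mul, hE0, mul_one, map_zero] at h4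
  exact hw h4

/-- The Jacobian determinant of a pair of power series in two variables. -/
def formalJacobian (f g : MvPowerSeries (Fin 2) ℂ) : MvPowerSeries (Fin 2) ℂ :=
  MvPowerSeries.pderiv ℂ 0 f * MvPowerSeries.pderiv ℂ 1 g -
    MvPowerSeries.pderiv ℂ 1 f * MvPowerSeries.pderiv ℂ 0 g

theorem formalJacobian_subst {G : Fin 2 → MvPowerSeries (Fin 2) ℂ}
    (hG : ∀ i, MvPowerSeries.constantCoeff (G i) = 0) (f g : MvPowerSeries (Fin 2) ℂ) :
    formalJacobian (MvPowerSeries.subst G f) (MvPowerSeries.subst G g) =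
      MvPowerSeries.subst G (formalJacobian f g) * formalJacobian (G 0) (G 1) := by
  have hs := MvPowerSeries.hasSubst_of_constantCoeff_zero hG
  simp only [formalJacobian, MvPowerSeries.pderiv_subst hG, Fin.sum_univ_two,
    MvPowerSeries.subst_sub hs, MvPowerSeries.subst_mul hs]
  ring

/-- The two partial derivatives of `f g = p(X₀ X₁)` are combined so that the undifferentiated factor
`g` drops out. -/
theorem saddle_identity {f g : MvPowerSeries (Fin 2) ℂ} {p : PowerSeries ℂ}
    (h : f * g = PowerSeries.subst (MvPowerSeries.X 0 * MvPowerSeries.X 1) p) :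
    formalJacobian f g * f = PowerSeries.subst
      (MvPowerSeries.X 0 * MvPowerSeries.X 1) (PowerSeries.derivative ℂ p) * saddleDeriv f := by
  have h0 := congrArg (MvPowerSeries.pderiv ℂ 0) h
  have h1 := congrArg (MvPowerSeries.pderiv ℂ 1) h
  rw [MvPowerSeries.pderiv_powerSeries_subst constantCoeff_X_mul_X, pderiv_zero_X_mul_X,
    Derivation.leibniz, smul_eq_mul, smul_eq_mul] at h0
  rw [MvPowerSeries.pderiv_powerSeries_subst constantCoeff_X_mul_X, pderiv_one_X_mul_X,
    Derivation.leibniz, smul_eq_mul, smul_eq_mul] at h1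
  rw [formalJacobian, saddleDeriv_apply]
  linear_combination MvPowerSeries.pderiv ℂ 0 f * h1 - MvPowerSeries.pderiv ℂ 1 f * h0

/-- By induction on `n`: once the lower pure powers of `X₁` are absent from `f`, comparing
coefficients of `X₁ ^ n` gives `f_n = -n f_n` after division by the common constant term, hence `(n
+ 1) f_n = 0`. -/
theorem X_dvd_of_saddle {f j Γ : MvPowerSeries (Fin 2) ℂ}
    (hj : MvPowerSeries.constantCoeff j = MvPowerSeries.constantCoeff Γ)
    (hΓ : MvPowerSeries.constantCoeff Γ ≠ 0) (h : j * f = Γ * saddleDeriv f) :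
    MvPowerSeries.X 0 ∣ f := by
  rw [MvPowerSeries.X_dvd_iff]
  have key : ∀ (n : ℕ) (m : Fin 2 →₀ ℕ), m 0 = 0 → m 1 = n → MvPowerSeries.coeff m f = 0 := by
    intro n
    induction n using Nat.strong_induction_on with
    | _ n ih =>
      intro m hm0 hm1
      have hlow : ∀ p ∈ Finset.HasAntidiagonal.antidiagonal m, p ≠ (0, m) →
          MvPowerSeries.coeff p.2 f = 0 := by
        intro p hp hne
        rw [Finset.HasAntidiagonal.mem_antidiagonal] at hp
        have e0 := DFunLike.congr_fun hp 0
        have e1 := DFunLike.congr_fun hp 1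
        rw [Finsupp.add_apply] at e0 e1
        refine ih (p.2 1) ?_ p.2 (by omega) rfl
        by_contra hge
        apply hne
        have hp1 : p.1 = 0 := by
          ext i
          fin_cases i
          · change p.1 0 = 0; omega
          · change p.1 1 = 0; omega
        rw [hp1, zero_add] at hp
        exact Prod.ext hp1 hp
      have hmem : (0, m) ∈ Finset.HasAntidiagonal.antidiagonal m := by simp
      have h1 := congrArg (MvPowerSeries.coeff m) h
      rw [MvPowerSeries.coeff_mul, MvPowerSeries.coeff_mul,
        Finset.sum_eq_single_of_mem _ hmem (fun p hp hne => by rw [hlow p hp hne, mul_zero]),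
        Finset.sum_eq_single_of_mem _ hmem (fun p hp hne => by
          rw [coeff_saddleDeriv, hlow p hp hne, mul_zero, mul_zero]),
        coeff_saddleDeriv, MvPowerSeries.coeff_zero_eq_constantCoeff_apply,
        MvPowerSeries.coeff_zero_eq_constantCoeff_apply, hj, hm0, hm1] at h1
      have h2 := mul_left_cancel₀ hΓ h1
      have h3 : ((n : ℂ) + 1) * MvPowerSeries.coeff m f = 0 := by
        push_cast at h2
        linear_combination h2
      exact (mul_eq_zero.mp h3).resolve_left (by exact_mod_cast Nat.succ_ne_zero n)
  exact fun m hm => key _ m hm rfl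

/-- If `f g = p(X₀ X₁)` then the resonant part of the Jacobian of `(f, g)` is `p'(X₀ X₁)`. -/
theorem coeff_derivative_of_mul_eq_subst {f g : MvPowerSeries (Fin 2) ℂ} {p : PowerSeries ℂ}
    (h : f * g = PowerSeries.subst (MvPowerSeries.X 0 * MvPowerSeries.X 1) p)
    (hj : MvPowerSeries.constantCoeff (formalJacobian f g) =
      PowerSeries.constantCoeff (PowerSeries.derivative ℂ p))
    (h0 : MvPowerSeries.constantCoeff (formalJacobian f g) ≠ 0) (n : ℕ) :
    PowerSeries.coeff n (PowerSeries.derivative ℂ p) =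
      MvPowerSeries.coeff (pairExponent (n, n)) (formalJacobian f g) := by
  set j := formalJacobian f g with hjdef
  set Γ := PowerSeries.subst (MvPowerSeries.X 0 * MvPowerSeries.X 1 : MvPowerSeries (Fin 2) ℂ)
    (PowerSeries.derivative ℂ p) with hΓ
  have hid : j * f = Γ * saddleDeriv f := saddle_identity h
  have hΓc : MvPowerSeries.constantCoeff Γ =
      PowerSeries.constantCoeff (PowerSeries.derivative ℂ p) := by
    have := coeff_subst_X_mul_X (PowerSeries.derivative ℂ p) 0
    rwa [show pairExponent (0, 0) = 0 by ext i; fin_cases i <;> simp,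
      MvPowerSeries.coeff_zero_eq_constantCoeff_apply,
      PowerSeries.coeff_zero_eq_constantCoeff_apply] at this
  have hΓ0 : MvPowerSeries.constantCoeff Γ ≠ 0 := by rw [hΓc, ← hj]; exact h0
  have hΓD : saddleDeriv Γ = 0 := saddleDeriv_subst_X_mul_X _
  -- Thus `f = X₀ w`, and `w` is a unit because the Jacobian has a nonzero constant term.
  obtain ⟨w, hw⟩ := X_dvd_of_saddle (hj.trans hΓc.symm) hΓ0 hid
  have hw0 : MvPowerSeries.constantCoeff w ≠ 0 := by
    intro hw0
    apply h0
    rw [hjdef, formalJacobian, hw]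
    simp [MvPowerSeries.pderiv_X_of_ne (by decide : (0 : Fin 2) ≠ 1), hw0]
  have hDX : saddleDeriv (MvPowerSeries.X 0) = MvPowerSeries.X 0 := by
    rw [saddleDeriv_apply, MvPowerSeries.pderiv_X_self,
      MvPowerSeries.pderiv_X_of_ne (by decide : (0 : Fin 2) ≠ 1)]
    ring
  have hX0 : (MvPowerSeries.X 0 : MvPowerSeries (Fin 2) ℂ) ≠ 0 := fun h => by
    have := congrArg (MvPowerSeries.coeff (Finsupp.single (0 : Fin 2) 1)) h
    simp at this
  have h1 : j * w = Γ * (w + saddleDeriv w) := by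
    refine mul_left_cancel₀ hX0 ?_
    rw [hw, Derivation.leibniz, smul_eq_mul, smul_eq_mul, hDX] at hid
    linear_combination hid
  have hinv : Γ * Γ⁻¹ = 1 := MvPowerSeries.mul_inv_cancel Γ hΓ0
  have hΓi : saddleDeriv Γ⁻¹ = 0 := by
    have h2 := congrArg saddleDeriv hinv
    rw [Derivation.leibniz, smul_eq_mul, smul_eq_mul, hΓD, mul_zero, add_zero,
      Derivation.map_one_eq_zero] at h2
    refine (mul_eq_zero.mp h2).resolve_left fun h => hΓ0 (by rw [h, map_zero])
  -- Dividing `h1` by `Γ w`, the logarithmic derivative of `w` is `Γ⁻¹ j - 1`. Its resonant part is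
  -- `Γ⁻¹ * resonantPart j - 1`, and the rest is `saddleDeriv` of `Γ⁻¹ * saddlePrimitive j`.
  have h2 : Γ⁻¹ * resonantPart j - 1 = 0 := by
    refine resonant_eq_zero_of_saddleDeriv_eq (w := w) (m := Γ⁻¹ * saddlePrimitive j) hw0 ?_ ?_ ?_
    · rw [map_sub, Derivation.leibniz, smul_eq_mul, smul_eq_mul, hΓi, saddleDeriv_resonantPart,
        Derivation.map_one_eq_zero]
      ring
    -- The constant term of `saddlePrimitive j` is a division by zero, hence `0`.
    · rw [map_mul, ← MvPowerSeries.coeff_zero_eq_constantCoeff_apply (saddlePrimitive j),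
        coeff_saddlePrimitive]
      simp
    · rw [Derivation.leibniz, smul_eq_mul, smul_eq_mul, hΓi]
      have h3 := resonantPart_add_saddleDeriv j
      linear_combination (-Γ⁻¹ * w) * h3 - Γ⁻¹ * h1 - (w + saddleDeriv w) * hinv
  have h3 : resonantPart j = Γ := by
    linear_combination Γ * h2 - resonantPart j * hinv
  rw [← coeff_subst_X_mul_X, ← hΓ, ← h3, coeff_resonantPart, if_pos (by simp)]

end

/-! ### Restriction of the normal form to `x = 0`. -/

noncomputable section

/-- The substitution `x = 0`. -/
def substX0 : Fin 3 → MvPowerSeries (Fin 2) ℂ := ![0, MvPowerSeries.X 0, MvPowerSeries.X 1]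

theorem constantCoeff_substX0 (i : Fin 3) : MvPowerSeries.constantCoeff (substX0 i) = 0 := by
  fin_cases i <;> simp [substX0]

theorem hasSubst_substX0 : MvPowerSeries.HasSubst substX0 :=
  MvPowerSeries.hasSubst_of_constantCoeff_zero constantCoeff_substX0

theorem coeff_restrictX0 (f : Series3) (k : Fin 2 →₀ ℕ) :
    MvPowerSeries.coeff k (restrictX0 f) = MvPowerSeries.coeff (Finsupp.cons 0 k) f := rfl

/-- As a substitution, the restriction is a ring morphism and composes with other substitutions. -/
theorem restrictX0_eq_subst (f : Series3) : restrictX0 f = MvPowerSeries.subst substX0 f := by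
  classical
  ext k
  have hmon : ∀ d : Fin 3 →₀ ℕ, (d.prod fun s e => substX0 s ^ e) =
      (0 : MvPowerSeries (Fin 2) ℂ) ^ d 0 *
        MvPowerSeries.monomial (pairExponent (d 1, d 2)) (1 : ℂ) := by
    intro d
    rw [Finsupp.prod_fintype _ _ (fun i => pow_zero _), Fin.prod_univ_three, mul_assoc]
    congr 1
    simp only [substX0, Matrix.cons_val_one, Matrix.cons_val_zero, Matrix.cons_val]
    rw [MvPowerSeries.X_pow_eq, MvPowerSeries.X_pow_eq, MvPowerSeries.monomial_mul_monomial, one_mul]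
    rfl
  rw [MvPowerSeries.coeff_subst hasSubst_substX0, finsum_eq_single _ (Finsupp.cons 0 k)]
  · have hk : pairExponent ((Finsupp.cons 0 k : Fin 3 →₀ ℕ) 1, (Finsupp.cons 0 k : Fin 3 →₀ ℕ) 2)
        = k := by
      ext i
      fin_cases i
      · simpa using Finsupp.cons_succ 0 0 k
      · simpa using Finsupp.cons_succ 1 0 k
    rw [hmon, Finsupp.cons_zero, pow_zero, one_mul, hk, MvPowerSeries.coeff_monomial_same,
      smul_eq_mul, mul_one, coeff_restrictX0]
  · intro d hd
    rw [hmon]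
    rcases Nat.eq_zero_or_pos (d 0) with h0 | h0
    · rw [h0, pow_zero, one_mul, MvPowerSeries.coeff_monomial_ne, smul_zero]
      intro hk
      apply hd
      ext i
      fin_cases i
      · simpa using h0
      · have := Finsupp.cons_succ 0 0 k
        have h1 := DFunLike.congr_fun hk 0
        rw [pairExponent_zero] at h1
        exact (h1.symm.trans this.symm)
      · have := Finsupp.cons_succ 1 0 k
        have h1 := DFunLike.congr_fun hk 1
        rw [pairExponent_one] at h1
        exact (h1.symm.trans this.symm)
    · rw [zero_pow h0.ne', zero_mul, map_zero, smul_zero]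

theorem restrictX0_mul (f g : Series3) : restrictX0 (f * g) = restrictX0 f * restrictX0 g := by
  simp only [restrictX0_eq_subst, MvPowerSeries.subst_mul hasSubst_substX0]

theorem restrictX0_add (f g : Series3) : restrictX0 (f + g) = restrictX0 f + restrictX0 g := by
  simp only [restrictX0_eq_subst, MvPowerSeries.subst_add hasSubst_substX0]

theorem restrictX0_sub (f g : Series3) : restrictX0 (f - g) = restrictX0 f - restrictX0 g := by
  simp only [restrictX0_eq_subst, MvPowerSeries.subst_sub hasSubst_substX0]

theorem restrictX0_pderiv (f : Series3) (i : Fin 2) :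
    restrictX0 (MvPowerSeries.pderiv ℂ i.succ f) = MvPowerSeries.pderiv ℂ i (restrictX0 f) := by
  ext k
  rw [coeff_restrictX0, MvPowerSeries.coeff_pderiv, MvPowerSeries.coeff_pderiv, coeff_restrictX0,
    Finsupp.cons_succ]
  congr 3
  ext j
  refine Fin.cases ?_ (fun j => ?_) j
  · simp
  · simp [Finsupp.cons_succ, Finsupp.single_apply]

theorem constantCoeff_restrictX0 (f : Series3) :
    MvPowerSeries.constantCoeff (restrictX0 f) = MvPowerSeries.constantCoeff f := by
  rw [← MvPowerSeries.coeff_zero_eq_constantCoeff_apply, coeff_restrictX0, Finsupp.cons_zero_zero,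
    MvPowerSeries.coeff_zero_eq_constantCoeff_apply]

theorem constantCoeff_mul_eq_zero {σ : Type*} {f g : MvPowerSeries σ ℂ}
    (hf : MvPowerSeries.constantCoeff f = 0) : MvPowerSeries.constantCoeff (f * g) = 0 := by
  rw [map_mul, hf, zero_mul]

theorem subst_powerSeries_subst {σ τ : Type*} [Finite σ] {a : σ → MvPowerSeries τ ℂ}
    (ha : ∀ i, MvPowerSeries.constantCoeff (a i) = 0) {b : MvPowerSeries σ ℂ}
    (hb : MvPowerSeries.constantCoeff b = 0) (f : PowerSeries ℂ) :
    MvPowerSeries.subst a (PowerSeries.subst b f) =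
      PowerSeries.subst (MvPowerSeries.subst a b) f :=
  MvPowerSeries.subst_comp_subst_apply
    (MvPowerSeries.hasSubst_of_constantCoeff_zero fun _ => hb)
    (MvPowerSeries.hasSubst_of_constantCoeff_zero ha) f

theorem restrictX0_powerSeries_subst {b : Series3} (hb : MvPowerSeries.constantCoeff b = 0)
    (f : PowerSeries ℂ) :
    restrictX0 (PowerSeries.subst b f) = PowerSeries.subst (restrictX0 b) f := by
  rw [restrictX0_eq_subst, subst_powerSeries_subst constantCoeff_substX0 hb, restrictX0_eq_subst]

/-- Normal forms restricted to `x = 0`: a pair of power series of Jacobian `1` conjugating the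
restriction of the vector field to the Hamiltonian field of `∫ (l + c)`. -/
theorem IsHamNormalForm.exists_restriction {V : FormalField} {l a₁ a₂ : ℂ} {c : PowerSeries ℂ}
    (h : IsHamNormalForm V l a₁ a₂ c) (hV : restrictX0 (V 0) = 0) :
    ∃ f g : MvPowerSeries (Fin 2) ℂ, MvPowerSeries.constantCoeff f = 0 ∧
      MvPowerSeries.constantCoeff g = 0 ∧ formalJacobian f g = 1 ∧
      restrictX0 (V 1) * MvPowerSeries.pderiv ℂ 0 f +
        restrictX0 (V 2) * MvPowerSeries.pderiv ℂ 1 f =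
        -(PowerSeries.subst (f * g) (PowerSeries.C l + c)) * f ∧
      restrictX0 (V 1) * MvPowerSeries.pderiv ℂ 0 g +
        restrictX0 (V 2) * MvPowerSeries.pderiv ℂ 1 g =
        PowerSeries.subst (f * g) (PowerSeries.C l + c) * g := by
  obtain ⟨-, -, Φ, ⟨⟨hΦm, -⟩, hΦ0, ⟨η, hη⟩⟩, hpush⟩ := h
  have hΦc : ∀ i, MvPowerSeries.constantCoeff (Φ i) = 0 := fun i => hΦm i
  have hs := MvPowerSeries.hasSubst_of_constantCoeff_zero hΦc
  have hp0 : ∀ f : Series3, restrictX0 (MvPowerSeries.pderiv ℂ 1 f) =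
      MvPowerSeries.pderiv ℂ 0 (restrictX0 f) := fun f => restrictX0_pderiv f 0
  have hp1 : ∀ f : Series3, restrictX0 (MvPowerSeries.pderiv ℂ 2 f) =
      MvPowerSeries.pderiv ℂ 1 (restrictX0 f) := fun f => restrictX0_pderiv f 1
  have hX : restrictX0 (MvPowerSeries.X 0) = 0 := by
    rw [restrictX0_eq_subst, MvPowerSeries.subst_X hasSubst_substX0]; rfl
  have hcv : ∀ (e : PowerSeries ℂ), restrictX0 (MvPowerSeries.subst Φ
      (PowerSeries.subst (MvPowerSeries.X 1 * MvPowerSeries.X 2 : Series3) e)) =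
      PowerSeries.subst (restrictX0 (Φ 1) * restrictX0 (Φ 2)) e := by
    intro e
    rw [subst_powerSeries_subst hΦc (by simp), MvPowerSeries.subst_mul hs, MvPowerSeries.subst_X hs,
      MvPowerSeries.subst_X hs, restrictX0_powerSeries_subst (constantCoeff_mul_eq_zero (hΦc 1)),
      restrictX0_mul]
  have hfg : MvPowerSeries.constantCoeff (restrictX0 (Φ 1) * restrictX0 (Φ 2)) = 0 :=
    constantCoeff_mul_eq_zero (by rw [constantCoeff_restrictX0]; exact hΦc 1)
  have hlc : PowerSeries.subst (restrictX0 (Φ 1) * restrictX0 (Φ 2)) (PowerSeries.C l + c) =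
      MvPowerSeries.C l + PowerSeries.subst (restrictX0 (Φ 1) * restrictX0 (Φ 2)) c := by
    rw [PowerSeries.subst_add (PowerSeries.HasSubst.of_constantCoeff_zero hfg), PowerSeries.subst_C]
  have hC : ∀ r : ℂ, restrictX0 (MvPowerSeries.C r) = MvPowerSeries.C r := fun r => by
    rw [restrictX0_eq_subst, MvPowerSeries.subst_C]
  have hlie : ∀ i, restrictX0 (V.lie (Φ i)) =
      restrictX0 (V 1) * MvPowerSeries.pderiv ℂ 0 (restrictX0 (Φ i)) +
        restrictX0 (V 2) * MvPowerSeries.pderiv ℂ 1 (restrictX0 (Φ i)) := by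
    intro i
    rw [FormalField.lie, Fin.sum_univ_three, restrictX0_add, restrictX0_add, restrictX0_mul,
      restrictX0_mul, restrictX0_mul, hV, hp0, hp1, zero_mul, zero_add]
  refine ⟨restrictX0 (Φ 1), restrictX0 (Φ 2), ?_, ?_, ?_, ?_, ?_⟩
  · rw [constantCoeff_restrictX0]; exact hΦc 1
  · rw [constantCoeff_restrictX0]; exact hΦc 2
  -- Elements of `⟨dx⟩` have no `dy₁ ∧ dy₂` component, so the `(1, 2)` entry says that the
  -- transverse Jacobian of `Φ` is `1`.
  · have h1 := congrFun (congrFun hη 1) 2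
    have h2 : Φ.pullTwo areaForm 1 2 - areaForm 1 2 = 0 := by
      refine h1.trans ?_
      simp [wedge, dCoord]
    have h3 : areaForm 1 2 = 1 := by
      simp [areaForm, wedge, dCoord]
    have h4 : Φ.pullTwo areaForm 1 2 =
        MvPowerSeries.pderiv ℂ 1 (Φ 1) * MvPowerSeries.pderiv ℂ 2 (Φ 2) -
          MvPowerSeries.pderiv ℂ 2 (Φ 1) * MvPowerSeries.pderiv ℂ 1 (Φ 2) := by
      have e0 : MvPowerSeries.subst Φ (0 : Series3) = 0 := by
        rw [← MvPowerSeries.substAlgHom_apply hs, map_zero]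
      have e1 : MvPowerSeries.subst Φ (1 : Series3) = 1 := by
        rw [← MvPowerSeries.substAlgHom_apply hs, map_one]
      have e2 : MvPowerSeries.subst Φ (-1 : Series3) = -1 := by
        rw [← MvPowerSeries.substAlgHom_apply hs, map_neg, map_one]
      simp [FormalMap.pullTwo, areaForm, wedge, dCoord, Fin.sum_univ_three, e0, e1, e2]
      ring
    rw [h4, h3, sub_eq_zero] at h2
    have h5 := congrArg restrictX0 h2
    rw [restrictX0_sub, restrictX0_mul, restrictX0_mul, hp0, hp0, hp1, hp1,
      ← map_one MvPowerSeries.C, hC, map_one] at h5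
    exact h5
  · rw [← hlie, hpush 1]
    simp only [normalField, Matrix.cons_val_one, Matrix.cons_val_zero]
    rw [MvPowerSeries.subst_mul hs, MvPowerSeries.subst_X hs, MvPowerSeries.subst_add hs,
      MvPowerSeries.subst_mul hs, MvPowerSeries.subst_X hs, hΦ0, restrictX0_mul, restrictX0_add,
      restrictX0_mul, hX, mul_zero, add_zero, hlc, ← neg_one_mul, ← map_one (MvPowerSeries.C),
      ← map_neg, MvPowerSeries.subst_mul hs, MvPowerSeries.subst_C, MvPowerSeries.subst_add hs,
      MvPowerSeries.subst_C, restrictX0_mul, restrictX0_add, hC, hC, hcv]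
    simp
  · rw [← hlie, hpush 2]
    simp only [normalField, Matrix.cons_val]
    rw [MvPowerSeries.subst_mul hs, MvPowerSeries.subst_X hs, MvPowerSeries.subst_add hs,
      MvPowerSeries.subst_mul hs, MvPowerSeries.subst_X hs, hΦ0, restrictX0_mul, restrictX0_add,
      restrictX0_mul, hX, mul_zero, add_zero, hlc, MvPowerSeries.subst_add hs,
      MvPowerSeries.subst_C, restrictX0_add, hC, hcv]

/-- The primitive without constant term of a power series. -/
def PowerSeries.primitive (f : PowerSeries ℂ) : PowerSeries ℂ :=
  -- At `n = 0` the truncated index `n - 1` is harmless, since division by zero gives the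
  -- coefficient `0`.
  PowerSeries.mk fun n => PowerSeries.coeff (n - 1) f / n

theorem PowerSeries.derivative_primitive (f : PowerSeries ℂ) :
    PowerSeries.derivative ℂ f.primitive = f := by
  ext n
  rw [PowerSeries.coeff_derivative, PowerSeries.primitive, PowerSeries.coeff_mk,
    Nat.add_sub_cancel]
  have : (n : ℂ) + 1 ≠ 0 := by exact_mod_cast Nat.succ_ne_zero n
  push_cast
  field_simp

theorem PowerSeries.constantCoeff_primitive (f : PowerSeries ℂ) :
    PowerSeries.constantCoeff f.primitive = 0 := by
  rw [← PowerSeries.coeff_zero_eq_constantCoeff_apply, PowerSeries.primitive, PowerSeries.coeff_mk]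
  simp

/-- As the Jacobian is `1`, Cramer's rule solves the two conjugacy equations for the partial
derivatives of `H` and gives `dH = q(f g) d(f g)`. -/
theorem eq_subst_of_conjugation {H f g : MvPowerSeries (Fin 2) ℂ} {q : PowerSeries ℂ}
    (hH : MvPowerSeries.constantCoeff H = 0) (hf : MvPowerSeries.constantCoeff f = 0)
    (hj : formalJacobian f g = 1)
    (h1 : -MvPowerSeries.pderiv ℂ 1 H * MvPowerSeries.pderiv ℂ 0 f +
      MvPowerSeries.pderiv ℂ 0 H * MvPowerSeries.pderiv ℂ 1 f = -(PowerSeries.subst (f * g) q) * f)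
    (h2 : -MvPowerSeries.pderiv ℂ 1 H * MvPowerSeries.pderiv ℂ 0 g +
      MvPowerSeries.pderiv ℂ 0 H * MvPowerSeries.pderiv ℂ 1 g = PowerSeries.subst (f * g) q * g) :
    H = PowerSeries.subst (f * g) q.primitive := by
  have hfg : MvPowerSeries.constantCoeff (f * g) = 0 := constantCoeff_mul_eq_zero hf
  refine MvPowerSeries.pderiv.ext (R := ℂ) (fun i => ?_) ?_
  · rw [MvPowerSeries.pderiv_powerSeries_subst hfg, PowerSeries.derivative_primitive,
      Derivation.leibniz, smul_eq_mul, smul_eq_mul]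
    rw [formalJacobian] at hj
    fin_cases i
    · change MvPowerSeries.pderiv ℂ 0 H = _ * (_ * MvPowerSeries.pderiv ℂ 0 g +
        _ * MvPowerSeries.pderiv ℂ 0 f)
      linear_combination (-MvPowerSeries.pderiv ℂ 0 H) * hj -
        MvPowerSeries.pderiv ℂ 0 g * h1 + MvPowerSeries.pderiv ℂ 0 f * h2
    · change MvPowerSeries.pderiv ℂ 1 H = _ * (_ * MvPowerSeries.pderiv ℂ 1 g +
        _ * MvPowerSeries.pderiv ℂ 1 f)
      linear_combination (-MvPowerSeries.pderiv ℂ 1 H) * hj -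
        MvPowerSeries.pderiv ℂ 1 g * h1 + MvPowerSeries.pderiv ℂ 1 f * h2
  · rw [hH]
    exact (PowerSeries.constantCoeff_subst_eq_zero hfg _
      (PowerSeries.constantCoeff_primitive q)).symm

/-- The formal part of the statement: in coordinates `G` in which `H` is `X₀ X₁`, the resonant
coefficients of the Jacobian determine the normal form. -/
theorem exists_inverse_primitive {V : FormalField} {l a₁ a₂ : ℂ} (hl : l ≠ 0) {c : PowerSeries ℂ}
    (h : IsHamNormalForm V l a₁ a₂ c) {H : MvPowerSeries (Fin 2) ℂ}
    (hH : MvPowerSeries.constantCoeff H = 0) (hV0 : restrictX0 (V 0) = 0)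
    (hV1 : restrictX0 (V 1) = -MvPowerSeries.pderiv ℂ 1 H)
    (hV2 : restrictX0 (V 2) = MvPowerSeries.pderiv ℂ 0 H)
    {G : Fin 2 → MvPowerSeries (Fin 2) ℂ} (hG : ∀ i, MvPowerSeries.constantCoeff (G i) = 0)
    (hHG : MvPowerSeries.subst G H = MvPowerSeries.X 0 * MvPowerSeries.X 1)
    (hGj : MvPowerSeries.constantCoeff (formalJacobian (G 0) (G 1)) = l⁻¹) :
    ∃ p : PowerSeries ℂ, PowerSeries.constantCoeff p = 0 ∧
      (∀ n, PowerSeries.coeff n (PowerSeries.derivative ℂ p) =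
        MvPowerSeries.coeff (pairExponent (n, n)) (formalJacobian (G 0) (G 1))) ∧
      PowerSeries.subst p (PowerSeries.C l + c) * PowerSeries.derivative ℂ p = 1 := by
  have hc : PowerSeries.constantCoeff c = 0 := h.2.1
  obtain ⟨f, g, hf, hg, hj, h1, h2⟩ := h.exists_restriction hV0
  rw [hV1, hV2] at h1 h2
  have hHfg := eq_subst_of_conjugation hH hf hj h1 h2
  set q : PowerSeries ℂ := (PowerSeries.C l + c).primitive with hq
  have hqc : PowerSeries.constantCoeff q = 0 := PowerSeries.constantCoeff_primitive _
  have hq1 : PowerSeries.coeff 1 q = l := by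
    rw [hq, PowerSeries.primitive, PowerSeries.coeff_mk]
    simp [hc]
  have hu : IsUnit (PowerSeries.coeff 1 q) := by rw [hq1]; exact isUnit_iff_ne_zero.mpr hl
  have hs := MvPowerSeries.hasSubst_of_constantCoeff_zero hG
  have hfg : MvPowerSeries.constantCoeff (f * g) = 0 := constantCoeff_mul_eq_zero hf
  have hf' : MvPowerSeries.constantCoeff (MvPowerSeries.subst G f) = 0 :=
    MvPowerSeries.constantCoeff_subst_eq_zero hs hG hf
  -- From `H = q(f g)` and `H ∘ G = X₀ X₁`, the product of `f ∘ G` and `g ∘ G` is `p(X₀ X₁)`. Since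
  -- `(f, g)` has Jacobian `1`, their Jacobian is that of `G`.
  set p := PowerSeries.substInvOfIsUnit q hu with hp
  have hpc : PowerSeries.constantCoeff p = 0 := PowerSeries.constantCoeff_substInvOfIsUnit q hu
  have hps : PowerSeries.HasSubst p := PowerSeries.HasSubst.of_constantCoeff_zero' hpc
  have hqs : PowerSeries.HasSubst q := PowerSeries.HasSubst.of_constantCoeff_zero' hqc
  have hprod : MvPowerSeries.subst G f * MvPowerSeries.subst G g =
      PowerSeries.subst (MvPowerSeries.X 0 * MvPowerSeries.X 1) p := by
    have e1 : PowerSeries.subst (MvPowerSeries.subst G f * MvPowerSeries.subst G g) q =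
        MvPowerSeries.X 0 * MvPowerSeries.X 1 := by
      rw [← hHG, hHfg, subst_powerSeries_subst hG hfg, MvPowerSeries.subst_mul hs]
    have hfgs : PowerSeries.HasSubst (MvPowerSeries.subst G f * MvPowerSeries.subst G g) :=
      PowerSeries.HasSubst.of_constantCoeff_zero (constantCoeff_mul_eq_zero hf')
    rw [← e1, ← PowerSeries.subst_comp_subst_apply hqs hfgs,
      PowerSeries.subst_substInvOfIsUnit_left (P := q) hqc hu, PowerSeries.subst_X hfgs]
  have hjac : formalJacobian (MvPowerSeries.subst G f) (MvPowerSeries.subst G g) =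
      formalJacobian (G 0) (G 1) := by
    rw [formalJacobian_subst hG, hj, ← MvPowerSeries.substAlgHom_apply hs, map_one, one_mul]
  have hlast : PowerSeries.subst p (PowerSeries.C l + c) * PowerSeries.derivative ℂ p = 1 := by
    have e1 := congrArg (PowerSeries.derivative ℂ)
      (PowerSeries.subst_substInvOfIsUnit_right (P := q) hqc hu)
    rw [PowerSeries.derivative_subst hps, hq, PowerSeries.derivative_primitive] at e1
    rw [e1, PowerSeries.derivative_X]
  have hpd : PowerSeries.constantCoeff (PowerSeries.derivative ℂ p) = l⁻¹ := by
    rw [← PowerSeries.coeff_zero_eq_constantCoeff_apply, PowerSeries.coeff_derivative, hp,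
      PowerSeries.coeff_one_substInvOfIsUnit]
    simp [hq1]
  refine ⟨p, hpc, fun n => ?_, hlast⟩
  rw [coeff_derivative_of_mul_eq_subst hprod (by rw [hjac, hGj, hpd])
    (by rw [hjac, hGj]; exact inv_ne_zero hl), hjac]

end

/-! ### Germs in one variable: primitives and compositional inverses. -/

noncomputable section

open Asymptotics

theorem hasFPowerSeriesAt_tsum_of_bound {d : ℕ → ℂ} {r C : ℝ} (hr : 0 < r)
    (h : ∀ n, ‖d n‖ * r ^ n ≤ C) :
    HasFPowerSeriesAt (fun v : ℂ => ∑' n, d n * v ^ n) (FormalMultilinearSeries.ofScalars ℂ d) 0 := by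
  set p := FormalMultilinearSeries.ofScalars ℂ d with hp
  have hrad : (r.toNNReal : ENNReal) ≤ p.radius := by
    refine p.le_radius_of_bound C fun n => ?_
    rw [hp, FormalMultilinearSeries.ofScalars_norm, Real.coe_toNNReal _ hr.le]
    exact h n
  have hpos : 0 < p.radius := lt_of_lt_of_le (by simpa using hr) hrad
  have h1 := (p.hasFPowerSeriesOnBall hpos).hasFPowerSeriesAt
  have h2 : p.sum = fun v : ℂ => ∑' n, d n * v ^ n := by
    funext v
    have := FormalMultilinearSeries.ofScalars_sum_eq (𝕜 := ℂ) (E := ℂ) d v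
    rw [FormalMultilinearSeries.ofScalarsSum, ← hp] at this
    simpa using this
  rwa [h2] at h1

theorem HasFPowerSeriesAt.hasJets {e : PowerSeries ℂ} {F : ℂ → ℂ}
    (h : HasFPowerSeriesAt F
      (FormalMultilinearSeries.ofScalars ℂ fun n => PowerSeries.coeff n e) 0) :
    HasJets (σ := Unit) e fun z => F (z ()) := fun N => by
  refine ⟨(MvPowerSeries.truncTotal N (e : MvPowerSeries Unit ℂ)),
    MvPowerSeries.le_order_sub_truncTotal _ N, ?_⟩
  have h1 := h.isBigO_sub_partialSum_pow N
  have hpr : Tendsto (fun z : Unit → ℂ => z ()) (𝓝 0) (𝓝 0) :=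
    (continuous_apply ()).tendsto' 0 0 rfl
  have h2 := h1.comp_tendsto hpr
  have hn : ∀ z : Unit → ℂ, ‖z ()‖ = ‖z‖ := fun z => by
    rw [Pi.norm_def]; simp
  refine (h2.congr_left (f₂ := fun z : Unit → ℂ => F (z ()) - MvPolynomial.eval z
    (MvPowerSeries.truncTotal N (e : MvPowerSeries Unit ℂ))) fun z => ?_).congr_right fun z => ?_
  · rw [Function.comp_apply, zero_add]
    congr 1
    rw [FormalMultilinearSeries.partialSum, MvPolynomial.eval_eq']
    simp only [FormalMultilinearSeries.ofScalars_apply_eq, smul_eq_mul]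
    have hsub : (MvPowerSeries.truncTotal N (e : MvPowerSeries Unit ℂ)).support ⊆
        (Finset.range N).image fun n => Finsupp.single () n := by
      intro d hd
      rw [Finset.mem_image]
      refine ⟨d (), ?_, by ext; simp⟩
      rw [MvPolynomial.mem_support_iff, MvPowerSeries.coeff_truncTotal_eq_ite] at hd
      rw [Finset.mem_range]
      by_contra hge
      apply hd
      rw [if_neg]
      rw [Finsupp.degree_eq_sum]
      simpa using hge
    rw [Finset.sum_subset hsub fun d _ hd => by
      rw [MvPolynomial.notMem_support_iff.mp hd, zero_mul], Finset.sum_image]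
    · refine Finset.sum_congr rfl fun n hn => ?_
      rw [MvPowerSeries.coeff_truncTotal_eq_ite, if_pos (by simpa using hn)]
      simp [PowerSeries.coeff]
    · intro a _ b _ hab
      simpa using hab
  · simp [hn]

theorem PowerSeries.subst_injective_of_coeff_one {p e c : PowerSeries ℂ}
    (hp : PowerSeries.constantCoeff p = 0) (hp1 : PowerSeries.coeff 1 p ≠ 0)
    (h : PowerSeries.subst p e = PowerSeries.subst p c) : e = c := by
  have hu : IsUnit (PowerSeries.coeff 1 p) := isUnit_iff_ne_zero.mpr hp1
  have hps : PowerSeries.HasSubst p := PowerSeries.HasSubst.of_constantCoeff_zero' hp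
  have hq := PowerSeries.HasSubst.substInvOfIsUnit p hu
  have h1 := congrArg (PowerSeries.subst (PowerSeries.substInvOfIsUnit p hu)) h
  have h2 : PowerSeries.subst (p.substInvOfIsUnit hu) p = PowerSeries.X :=
    p.subst_substInvOfIsUnit_right hp hu
  rwa [PowerSeries.subst_comp_subst_apply hps hq, PowerSeries.subst_comp_subst_apply hps hq,
    h2, PowerSeries.X_subst, PowerSeries.X_subst] at h1

theorem exists_primitive_near_zero {δ : ℂ → ℂ} (hδ : AnalyticAt ℂ δ 0) :
    ∃ g : ℂ → ℂ, g 0 = 0 ∧ AnalyticAt ℂ g 0 ∧ ∀ᶠ a in 𝓝 (0 : ℂ), HasDerivAt g (δ a) a := by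
  obtain ⟨ε, hε, hb⟩ := Metric.eventually_nhds_iff_ball.mp hδ.eventually_analyticAt
  have h1 : DifferentiableOn ℂ δ (Metric.ball 0 ε) := fun z hz =>
    (hb z hz).differentiableAt.differentiableWithinAt
  obtain ⟨g, hg⟩ := h1.isExactOn_ball.with_val_at 0 0
  have h2 : ∀ z ∈ Metric.ball (0 : ℂ) ε, HasDerivAt g (δ z) z := hg.2
  refine ⟨g, hg.1, ?_, ?_⟩
  · refine DifferentiableOn.analyticAt (s := Metric.ball 0 ε) (fun z hz =>
      (h2 z hz).differentiableAt.differentiableWithinAt) (Metric.ball_mem_nhds _ hε)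
  · filter_upwards [Metric.ball_mem_nhds (0 : ℂ) hε] with z hz using h2 z hz

theorem HasJets.derivative_eq {e e' : PowerSeries ℂ} {F F' : ℂ → ℂ}
    (hF : HasJets (σ := Unit) e fun z => F (z ())) (hF' : HasJets (σ := Unit) e' fun z => F' (z ()))
    (ha : AnalyticAt ℂ F 0) (hd : ∀ᶠ a in 𝓝 (0 : ℂ), HasDerivAt F (F' a) a) :
    PowerSeries.derivative ℂ e = e' := by
  have hpr : Tendsto (fun z : Unit → ℂ => z ()) (𝓝 0) (𝓝 0) :=
    (continuous_apply ()).tendsto' 0 0 rfl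
  have ha' : AnalyticAt ℂ (fun z : Unit → ℂ => F (z ())) 0 :=
    AnalyticAt.fun_comp (g := F) (f := fun z : Unit → ℂ => z ()) ha
      ((ContinuousLinearMap.proj (R := ℂ) (φ := fun _ : Unit => ℂ) ()).analyticAt 0)
  have h1 := hF.pderiv ha' ()
  have h2 : HasJets (σ := Unit) (MvPowerSeries.pderiv ℂ () e) fun z => F' (z ()) := by
    refine h1.congr ?_
    filter_upwards [hpr.eventually hd] with z hz
    have h3 : HasFDerivAt (fun z : Unit → ℂ => F (z ())) _ z :=
      hz.hasFDerivAt.comp z (hasFDerivAt_apply (𝕜 := ℂ) () z)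
    rw [h3.fderiv]
    simp
  have h3 : MvPowerSeries.pderiv ℂ () e = PowerSeries.derivative ℂ e := by
    ext n
    rw [PowerSeries.coeff_derivative, PowerSeries.coeff, MvPowerSeries.coeff_pderiv,
      PowerSeries.coeff]
    congr 2
    · rw [← Finsupp.single_add]
    · simp
  rw [h3] at h2
  exact h2.unique hF'

/-- The germs attached to a convergent power series `∑ dₙ vⁿ` with `d₀ = 1 / l`: its sum `δ`, the
primitive `g` of `δ` and the inverse `h` of `g`. -/
theorem exists_inverse_of_primitive {d : ℕ → ℂ} {r C : ℝ} {l : ℂ} (hl : l ≠ 0) (hr : 0 < r)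
    (hd : ∀ n, ‖d n‖ * r ^ n ≤ C) (hd0 : d 0 = l⁻¹) :
    ∃ δ g h : ℂ → ℂ, (δ = fun v => ∑' n, d n * v ^ n) ∧ AnalyticAt ℂ δ 0 ∧ δ 0 = l⁻¹ ∧
      g 0 = 0 ∧ (∀ᶠ a in 𝓝 (0 : ℂ), HasDerivAt g (δ a) a) ∧
      AnalyticAt ℂ h 0 ∧ h 0 = 0 ∧ (∀ᶠ v in 𝓝 (0 : ℂ), g (h v) = v) ∧
      (∀ᶠ a in 𝓝 (0 : ℂ), h (g a) = a) ∧
      ∀ p c : PowerSeries ℂ, PowerSeries.constantCoeff p = 0 →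
        (∀ n, PowerSeries.coeff n (PowerSeries.derivative ℂ p) = d n) →
        PowerSeries.subst p (PowerSeries.C l + c) * PowerSeries.derivative ℂ p = 1 →
        ∃ Cf : ℂ → ℂ, IsSumNearZero c Cf ∧ ∀ᶠ v in 𝓝 (0 : ℂ), HasDerivAt h (l + Cf v) v := by
  set δ : ℂ → ℂ := fun v => ∑' n, d n * v ^ n with hδdef
  have hδps := hasFPowerSeriesAt_tsum_of_bound hr hd
  rw [← hδdef] at hδps
  have hδ : AnalyticAt ℂ δ 0 := hδps.analyticAt
  have hδ0 : δ 0 = l⁻¹ := by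
    rw [hδdef, ← hd0]
    simp only
    rw [tsum_eq_single 0 (fun n hn => by rw [zero_pow hn, mul_zero])]
    simp
  obtain ⟨g, hg0, hga, hgd⟩ := exists_primitive_near_zero hδ
  have hgd0 : deriv g 0 ≠ 0 := by
    rw [hgd.self_of_nhds.deriv, hδ0]; exact inv_ne_zero hl
  let h : ℂ → ℂ := hga.hasStrictDerivAt.localInverse _ _ _ hgd0
  have hha : AnalyticAt ℂ h 0 := by
    have := hga.analyticAt_localInverse hgd0
    rwa [hg0] at this
  have hhl : ∀ᶠ a in 𝓝 (0 : ℂ), h (g a) = a :=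
    HasStrictDerivAt.eventually_left_inverse hga.hasStrictDerivAt hgd0
  have hhr : ∀ᶠ v in 𝓝 (0 : ℂ), g (h v) = v := by
    have := HasStrictDerivAt.eventually_right_inverse hga.hasStrictDerivAt hgd0
    rwa [hg0] at this
  have hh0 : h 0 = 0 := by
    have := hhl.self_of_nhds
    rwa [hg0] at this
  refine ⟨δ, g, h, rfl, hδ, hδ0, hg0, hgd, hha, hh0, hhr, hhl, ?_⟩
  intro p c hpc hpd hsub
  -- the Taylor series of `h' - l` equals `c`
  let Cf : ℂ → ℂ := fun v => deriv h v - l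
  have hCa : AnalyticAt ℂ Cf 0 := hha.deriv.sub analyticAt_const
  obtain ⟨e, he⟩ : ∃ e : PowerSeries ℂ, IsSumNearZero e Cf := by
    refine ⟨PowerSeries.mk fun n => iteratedDeriv n Cf 0 / n.factorial, ?_⟩
    have := hCa.hasFPowerSeriesAt
    simpa [IsSumNearZero] using this
  have hhd : ∀ᶠ v in 𝓝 (0 : ℂ), HasDerivAt h (deriv h v) v :=
    hha.eventually_analyticAt.mono fun v hv => hv.differentiableAt.hasDerivAt
  have hdd : PowerSeries.derivative ℂ p = PowerSeries.mk d := by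
    ext n; rw [hpd, PowerSeries.coeff_mk]
  have hδj : HasJets (σ := Unit) (PowerSeries.mk d) fun z => δ (z ()) := by
    refine HasFPowerSeriesAt.hasJets ?_
    simpa using hδps
  have hgj : HasJets (σ := Unit) p fun z => g (z ()) := by
    have h1 : HasFPowerSeriesAt g (FormalMultilinearSeries.ofScalars ℂ fun n => PowerSeries.coeff n
        (PowerSeries.mk fun n => iteratedDeriv n g 0 / (n.factorial : ℂ))) 0 := by
      simpa using hga.hasFPowerSeriesAt
    have h2 := h1.hasJets
    have h3 := h2.derivative_eq hδj hga hgd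
    have h4 : PowerSeries.mk (fun n => iteratedDeriv n g 0 / (n.factorial : ℂ)) = p := by
      refine PowerSeries.derivative.ext (h3.trans hdd.symm) ?_
      rw [hpc, ← PowerSeries.coeff_zero_eq_constantCoeff_apply, PowerSeries.coeff_mk]
      simp [hg0]
    rwa [h4] at h2
  have hgt : Tendsto g (𝓝 0) (𝓝 0) := by
    have := hga.continuousAt.tendsto
    rwa [hg0] at this
  have hpr : Tendsto (fun z : Unit → ℂ => z ()) (𝓝 0) (𝓝 0) :=
    (continuous_apply ()).tendsto' 0 0 rfl
  have hcomp : ∀ᶠ a in 𝓝 (0 : ℂ), (l + Cf (g a)) * δ a = 1 := by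
    filter_upwards [hgt.eventually hhd, hgd, hhl.eventually_nhds] with a h1 h2 h3
    have h4 := h1.comp a h2
    have h5 : HasDerivAt (h ∘ g) 1 a := (hasDerivAt_id a).congr_of_eventuallyEq h3
    have h6 := h4.unique h5
    simp only [Cf]
    rw [← h6]; ring
  have hej : HasJets (σ := Unit) (PowerSeries.C l + e) fun z => l + Cf (z ()) :=
    (HasJets.const l).add he.hasJets
  have hps : PowerSeries.HasSubst p := PowerSeries.HasSubst.of_constantCoeff_zero' hpc
  -- Taking jets in `(l + Cf ∘ g) δ = 1` shows that `e` satisfies the formal equation imposed on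
  -- `c`. Cancelling `p'` and then the substitution of `p` yields `e = c`.
  have hsub' : PowerSeries.subst p (PowerSeries.C l + e) * PowerSeries.derivative ℂ p = 1 := by
    have h1 := hej.comp (a := fun _ : Unit => (p : MvPowerSeries Unit ℂ))
      (A := fun z _ => g (z ())) (fun _ => hgj) (fun _ => hpc)
    have h2 := h1.mul hδj
    rw [← hdd] at h2
    have h3 := (HasJets.const (σ := Unit) 1).congr (G := fun z => (l + Cf (g (z ()))) * δ (z ())) (by
      filter_upwards [hpr.eventually hcomp] with z hz using hz.symm)
    have h4 := h2.unique h3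
    rw [map_one] at h4
    exact h4
  have hunit : PowerSeries.derivative ℂ p ≠ 0 := fun h0 => by
    rw [h0, mul_zero] at hsub; exact zero_ne_one hsub
  have hec : e = c := by
    have h1 := mul_right_cancel₀ hunit (hsub'.trans hsub.symm)
    have hp1 : PowerSeries.coeff 1 p ≠ 0 := by
      have := hpd 0
      rw [PowerSeries.coeff_derivative, hd0] at this
      intro h0
      rw [h0] at this
      simp at this
      exact hl this.symm
    exact add_left_cancel (PowerSeries.subst_injective_of_coeff_one hpc hp1 h1)
  refine ⟨Cf, hec ▸ he, ?_⟩
  filter_upwards [hhd] with v hv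
  simpa [Cf] using hv

end

/-! ### Taylor series of the Morse chart and of its Jacobian. -/

noncomputable section

/-- The linear isomorphism from `Fin 2 → ℂ` to `ℂ × ℂ`. -/
def pairEquiv : (Fin 2 → ℂ) →L[ℂ] ℂ × ℂ :=
  (ContinuousLinearMap.proj 0).prod (ContinuousLinearMap.proj 1)

theorem pairEquiv_apply (z : Fin 2 → ℂ) : pairEquiv z = (z 0, z 1) := rfl

theorem tendsto_pair : Tendsto (fun z : Fin 2 → ℂ => (z 0, z 1)) (𝓝 0) (𝓝 (0 : ℂ × ℂ)) :=
  pairEquiv.continuous.tendsto' 0 0 (map_zero _)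

theorem AnalyticAt.comp_pair {F : ℂ × ℂ → ℂ} (hF : AnalyticAt ℂ F 0) :
    AnalyticAt ℂ (fun z : Fin 2 → ℂ => F (z 0, z 1)) 0 := by
  have h1 : AnalyticAt ℂ F (pairEquiv 0) := by rwa [map_zero]
  exact h1.comp (pairEquiv.analyticAt 0)

theorem HasJets.hasGerm {f : MvPowerSeries (Fin 2) ℂ} {F : ℂ × ℂ → ℂ}
    (hf : HasJets f fun z => F (z 0, z 1)) (hF : AnalyticAt ℂ F 0) : HasGerm f F := by
  obtain ⟨g, hg⟩ := exists_hasGerm hF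
  rwa [hf.unique hg.hasJets]

theorem HasGerm.unique {f g : MvPowerSeries (Fin 2) ℂ} {F : ℂ × ℂ → ℂ} (hf : HasGerm f F)
    (hg : HasGerm g F) : f = g :=
  hf.hasJets.unique hg.hasJets

theorem HasGerm.constantCoeff_eq {f : MvPowerSeries (Fin 2) ℂ} {F : ℂ × ℂ → ℂ}
    (hf : HasGerm f F) : MvPowerSeries.constantCoeff f = F 0 := by
  have h1 := hf.eventuallyEq.self_of_nhds
  rw [h1, seriesSum_zero]

theorem HasGerm.hasJets_pderiv {f : MvPowerSeries (Fin 2) ℂ} {F : ℂ × ℂ → ℂ} (hf : HasGerm f F)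
    (i : Fin 2) : HasJets (MvPowerSeries.pderiv ℂ i f)
      fun z => fderiv ℂ F (z 0, z 1) (pairEquiv (Pi.single i 1)) := by
  refine (hf.hasJets.pderiv hf.analyticAt.comp_pair i).congr ?_
  filter_upwards [tendsto_pair.eventually hf.analyticAt.eventually_analyticAt] with z hz
  have h1 : HasFDerivAt F (fderiv ℂ F (pairEquiv z)) (pairEquiv z) :=
    hz.differentiableAt.hasFDerivAt
  have h2 : HasFDerivAt (fun z : Fin 2 → ℂ => F (z 0, z 1)) _ z :=
    h1.comp z pairEquiv.hasFDerivAt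
  rw [h2.fderiv]
  rfl

/-- The Jacobian determinant of a map from `ℂ²` to itself. -/
def jacobianDet (G : ℂ × ℂ → ℂ × ℂ) (u : ℂ × ℂ) : ℂ :=
  (fderiv ℂ G u (1, 0)).1 * (fderiv ℂ G u (0, 1)).2 -
    (fderiv ℂ G u (0, 1)).1 * (fderiv ℂ G u (1, 0)).2

theorem AnalyticAt.jacobianDet {G : ℂ × ℂ → ℂ × ℂ} {u : ℂ × ℂ} (hG : AnalyticAt ℂ G u) :
    AnalyticAt ℂ (jacobianDet G) u := by
  have h1 : ∀ v, AnalyticAt ℂ (fun u => fderiv ℂ G u v) u := fun v =>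
    ((ContinuousLinearMap.apply ℂ (ℂ × ℂ) v).analyticAt _).comp hG.fderiv
  have hf : ∀ v, AnalyticAt ℂ (fun u => (fderiv ℂ G u v).1) u := fun v =>
    analyticAt_fst.comp (h1 v)
  have hs : ∀ v, AnalyticAt ℂ (fun u => (fderiv ℂ G u v).2) u := fun v =>
    analyticAt_snd.comp (h1 v)
  exact ((hf _).mul (hs _)).sub ((hf _).mul (hs _))

theorem IsMorseChart.jacobianDet_zero {H : ℂ × ℂ → ℂ} {l : ℂ} {U G : ℂ × ℂ → ℂ × ℂ}
    (h : IsMorseChart H l U G) : jacobianDet G 0 = l⁻¹ := by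
  simp [jacobianDet, h.fderiv_inverse]

theorem IsMorseChart.apply_inverse {H : ℂ × ℂ → ℂ} {l : ℂ} {U G : ℂ × ℂ → ℂ × ℂ}
    (h : IsMorseChart H l U G) : ∀ᶠ u in 𝓝 (0 : ℂ × ℂ), H (G u) = u.1 * u.2 := by
  have hc : Tendsto G (𝓝 0) (𝓝 0) := by
    have := h.analyticAt_inverse.continuousAt.tendsto
    rwa [h.inverse_zero] at this
  filter_upwards [hc.eventually h.chart_mul, h.right_inverse] with u hu hu'
  rw [← hu, hu']

theorem HasGerm.formalJacobian {g₀ g₁ : MvPowerSeries (Fin 2) ℂ} {G : ℂ × ℂ → ℂ × ℂ}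
    (hG : AnalyticAt ℂ G 0) (h₀ : HasGerm g₀ fun u => (G u).1) (h₁ : HasGerm g₁ fun u => (G u).2) :
    HasGerm (formalJacobian g₀ g₁) (jacobianDet G) := by
  refine HasJets.hasGerm ?_ hG.jacobianDet
  refine (((h₀.hasJets_pderiv 0).mul (h₁.hasJets_pderiv 1)).sub
    ((h₀.hasJets_pderiv 1).mul (h₁.hasJets_pderiv 0))).congr ?_
  filter_upwards [tendsto_pair.eventually hG.eventually_analyticAt] with z hz
  have hz' : HasFDerivAt G (fderiv ℂ G (z 0, z 1)) (z 0, z 1) := hz.differentiableAt.hasFDerivAt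
  have e1 := hz'.fst.fderiv
  have e2 := hz'.snd.fderiv
  rw [e1, e2]
  simp [jacobianDet, pairEquiv_apply]

/-- The diagonal coefficients of the Jacobian of the inverse Morse chart invert the primitive of
the normal form. -/
theorem IsMorseChart.exists_inverse_primitive {Y : FormalField} {l a₁ a₂ : ℂ} (hl : l ≠ 0)
    {c : PowerSeries ℂ} {H : ℂ × ℂ → ℂ} {U G : ℂ × ℂ → ℂ × ℂ} (hH : AnalyticAt ℂ H 0)
    (hc : IsMorseChart H l U G) (hY : RestrictsToHam Y H) (hn : IsHamNormalForm Y l a₁ a₂ c)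
    {j : MvPowerSeries (Fin 2) ℂ} (hj : HasGerm j (jacobianDet G)) :
    ∃ p : PowerSeries ℂ, PowerSeries.constantCoeff p = 0 ∧
      (∀ n, PowerSeries.coeff n (PowerSeries.derivative ℂ p) =
        MvPowerSeries.coeff (pairExponent (n, n)) j) ∧
      PowerSeries.subst p (PowerSeries.C l + c) * PowerSeries.derivative ℂ p = 1 := by
  have hG := hc.analyticAt_inverse
  obtain ⟨f, hf⟩ := exists_hasGerm hH
  obtain ⟨g₀, h₀⟩ := exists_hasGerm (F := fun u => (G u).1) (analyticAt_fst.comp hG)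
  obtain ⟨g₁, h₁⟩ := exists_hasGerm (F := fun u => (G u).2) (analyticAt_snd.comp hG)
  have hjac : j = formalJacobian g₀ g₁ := hj.unique (HasGerm.formalJacobian hG h₀ h₁)
  have hg0 : ∀ i, MvPowerSeries.constantCoeff ((![g₀, g₁] : Fin 2 → _) i) = 0 := by
    intro i
    fin_cases i
    · simpa [hc.inverse_zero] using h₀.constantCoeff_eq
    · simpa [hc.inverse_zero] using h₁.constantCoeff_eq
  have hf0 : MvPowerSeries.constantCoeff f = 0 := by
    rw [hf.constantCoeff_eq, ← hc.chart_mul.self_of_nhds, hc.chart_zero]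
    simp
  have h1 : restrictX0 (Y 1) = -MvPowerSeries.pderiv ℂ 1 f :=
    hY.2.1.hasJets.unique (by simpa [hamField, pairEquiv_apply] using (hf.hasJets_pderiv 1).neg)
  have h2 : restrictX0 (Y 2) = MvPowerSeries.pderiv ℂ 0 f :=
    hY.2.2.hasJets.unique (by simpa [hamField, pairEquiv_apply] using hf.hasJets_pderiv 0)
  have h3 : MvPowerSeries.subst ![g₀, g₁] f = MvPowerSeries.X 0 * MvPowerSeries.X 1 := by
    have ha : ∀ i, HasJets ((![g₀, g₁] : Fin 2 → MvPowerSeries (Fin 2) ℂ) i)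
        fun y : Fin 2 → ℂ => (![(G (y 0, y 1)).1, (G (y 0, y 1)).2] : Fin 2 → ℂ) i := by
      intro i
      fin_cases i
      · exact h₀.hasJets
      · exact h₁.hasJets
    refine ((hf.hasJets.comp ha hg0).congr ?_).unique ((HasJets.coord 0).mul (HasJets.coord 1))
    filter_upwards [tendsto_pair.eventually hc.apply_inverse] with z hz
    simpa using hz
  rw [hjac]
  refine _root_.exists_inverse_primitive (G := ![g₀, g₁]) hl hn hf0 hY.1 h1 h2 hg0 h3 ?_
  have h4 := hj.constantCoeff_eq
  rw [hc.jacobianDet_zero, hjac] at h4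
  simpa using h4

end

/-! ### Variation of the logarithm and homology of a curve. -/

noncomputable section

section LogIncrement

variable {X : Type*} [TopologicalSpace X] (e : C(X, {z : ℂ // z ≠ 0}))

/-- The variation of a continuous logarithm of `e` along a path. -/
def logIncrement {p q : X} (γ : Path p q) : ℂ :=
  Complex.isCoveringMap_exp.liftPath (e.comp (γ : C(unitInterval, X))) (Complex.log (e p).1)
    (Subtype.ext (by simp [Complex.exp_log (e p).2])) 1 - Complex.log (e p).1

variable {e}

/-- Any continuous logarithm along the path may be used: by uniqueness of lifts through the covering
`exp`, a translate of it is the chosen lift. -/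
theorem logIncrement_eq {p q : X} {γ : Path p q} {ζ : unitInterval → ℂ} (hc : Continuous ζ)
    (h : ∀ t, Complex.exp (ζ t) = (e (γ t)).1) : logIncrement e γ = ζ 1 - ζ 0 := by
  have h0 : Complex.exp (ζ 0) = (e p).1 := by simpa using h 0
  have h1 : (fun t => ζ t - ζ 0 + Complex.log (e p).1) =
      Complex.isCoveringMap_exp.liftPath (e.comp (γ : C(unitInterval, X))) (Complex.log (e p).1)
        (Subtype.ext (by simp [Complex.exp_log (e p).2])) := by
    rw [Complex.isCoveringMap_exp.eq_liftPath_iff]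
    refine ⟨by fun_prop, funext fun t => Subtype.ext ?_, by simp⟩
    simp only [Function.comp_apply, ContinuousMap.comp_apply]
    rw [Complex.exp_add, Complex.exp_sub, h, h0, Complex.exp_log (e p).2,
      div_mul_cancel₀ _ (e p).2]
    rfl
  rw [logIncrement, ← h1]
  ring

variable (e) in
theorem exists_log_lift {p q : X} (γ : Path p q) {ζ₀ : ℂ} (h₀ : Complex.exp ζ₀ = (e p).1) :
    ∃ ζ : C(unitInterval, ℂ), (∀ t, Complex.exp (ζ t) = (e (γ t)).1) ∧ ζ 0 = ζ₀ := by
  obtain ⟨Γ, hΓ, hΓ0⟩ := Complex.isCoveringMap_exp.exists_path_lifts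
    (e.comp (γ : C(unitInterval, X))) ζ₀ (Subtype.ext (by simp [h₀]))
  exact ⟨Γ, fun t => congrArg Subtype.val (congrFun hΓ t), hΓ0⟩

theorem logIncrement_trans {p q r : X} (γ : Path p q) (γ' : Path q r) :
    logIncrement e (γ.trans γ') = logIncrement e γ + logIncrement e γ' := by
  obtain ⟨ζ, hζ, -⟩ := exists_log_lift e γ (Complex.exp_log (e p).2)
  obtain ⟨ζ', hζ', h0⟩ := exists_log_lift e γ' (ζ₀ := ζ 1) (by simpa using hζ 1)
  let a : Path (ζ 0) (ζ 1) := ⟨ζ, rfl, rfl⟩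
  let b : Path (ζ 1) (ζ' 1) := ⟨ζ', h0, rfl⟩
  rw [logIncrement_eq ζ.continuous hζ, logIncrement_eq ζ'.continuous hζ',
    logIncrement_eq (ζ := a.trans b) (a.trans b).continuous]
  · simp [h0]
  · intro t
    rw [Path.trans_apply, Path.trans_apply]
    split_ifs
    · exact hζ _
    · exact hζ' _

theorem logIncrement_symm {p q : X} (γ : Path p q) :
    logIncrement e γ.symm = -logIncrement e γ := by
  obtain ⟨ζ, hζ, -⟩ := exists_log_lift e γ (Complex.exp_log (e p).2)
  rw [logIncrement_eq ζ.continuous hζ,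
    logIncrement_eq (ζ := ζ ∘ unitInterval.symm) (by fun_prop) fun t => hζ _]
  simp

theorem Path.Homotopic.logIncrement_eq {p q : X} {γ γ' : Path p q} (h : γ.Homotopic γ') :
    logIncrement e γ = logIncrement e γ' := by
  obtain ⟨F⟩ := h
  rw [logIncrement, logIncrement]
  congr 1
  exact Complex.isCoveringMap_exp.liftPath_apply_one_eq_of_homotopicRel
    ⟨ContinuousMap.HomotopyRel.compContinuousMap F e⟩ _ _ _

theorem exists_logIncrement_eq {p : X} (γ : Path p p) :
    ∃ n : ℤ, logIncrement e γ = n * (2 * Real.pi * Complex.I) := by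
  obtain ⟨ζ, hζ, h0⟩ := exists_log_lift e γ (Complex.exp_log (e p).2)
  have h1 : Complex.exp (ζ 1) = Complex.exp (ζ 0) := by rw [hζ, hζ, γ.source, γ.target]
  obtain ⟨n, hn⟩ := Complex.exp_eq_exp_iff_exists_int.mp h1
  exact ⟨n, by rw [_root_.logIncrement_eq ζ.continuous hζ, hn]; ring⟩

variable (e) in
/-- The variation of the logarithm, as a morphism on the fundamental group. -/
def logIncrementHom (p : X) : FundamentalGroup X p →* Multiplicative ℂ where
  toFun x := Multiplicative.ofAdd
    (Quotient.lift (fun γ : Path p p => logIncrement e γ) (fun _ _ h =>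
      Path.Homotopic.logIncrement_eq h) (FundamentalGroup.toPath x))
  map_one' := by
    have h : logIncrement e (Path.refl p) = 0 := by
      rw [logIncrement_eq (ζ := fun _ => Complex.log (e p).1) continuous_const fun t => by
        simp [Complex.exp_log (e p).2], sub_self]
    exact congrArg Multiplicative.ofAdd h
  map_mul' x y := by
    obtain ⟨γ, rfl⟩ := Quotient.exists_rep x
    obtain ⟨γ', rfl⟩ := Quotient.exists_rep y
    -- The product of the fundamental group concatenates in the opposite order, which the
    -- commutativity of `ℂ` absorbs.
    have h := logIncrement_trans (e := e) γ' γ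
    rw [add_comm] at h
    exact congrArg Multiplicative.ofAdd h

end LogIncrement

/-- `P` is a logarithmic parametrization of `X` by the contractible set `S`, relative to the nowhere
vanishing function `e`. -/
structure IsLogChart {X : Type*} [TopologicalSpace X] (e : C(X, {z : ℂ // z ≠ 0})) (S : Set ℂ)
    (P : S → X) : Prop where
  contractible : ContractibleSpace S
  continuous_param : Continuous P
  exp_param : ∀ ζ : S, (e (P ζ)).1 = Complex.exp ζ
  -- All logarithms of `e x` lie in `S` and return to `x`, so the logarithmic lift of a path stays
  -- in `S`.
  param_log : ∀ x ζ, Complex.exp ζ = (e x).1 → ∃ h : ζ ∈ S, P ⟨ζ, h⟩ = x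

namespace IsLogChart

variable {X : Type*} [TopologicalSpace X] {e : C(X, {z : ℂ // z ≠ 0})} {S : Set ℂ} {P : S → X}

theorem exists_path (h : IsLogChart e S P) {p q : X} {ζ ζ' : ℂ} (hζ : Complex.exp ζ = (e p).1)
    (hζ' : Complex.exp ζ' = (e q).1) : ∃ γ : Path p q, logIncrement e γ = ζ' - ζ := by
  have := h.contractible
  obtain ⟨hp, rfl⟩ := h.param_log p ζ hζ
  obtain ⟨hq, rfl⟩ := h.param_log q ζ' hζ'
  let σ : Path (⟨ζ, hp⟩ : S) ⟨ζ', hq⟩ := PathConnectedSpace.somePath _ _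
  refine ⟨σ.map h.continuous_param, ?_⟩
  rw [logIncrement_eq (ζ := fun t => (σ t : ℂ)) (by fun_prop) fun t => (h.exp_param _).symm]
  simp

theorem pathConnectedSpace (h : IsLogChart e S P) : PathConnectedSpace X := by
  have := h.contractible
  obtain ⟨ζ⟩ : Nonempty S := inferInstance
  refine ⟨⟨P ζ⟩, fun p q => ?_⟩
  obtain ⟨γ, -⟩ := h.exists_path (Complex.exp_log (e p).2) (Complex.exp_log (e q).2)
  exact ⟨γ⟩

/-- The map `P` plays the role of a universal covering. Logarithmic lifts with the same start and
equal increments share their end points, are homotopic in the contractible set `S`, and `P` pushes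
the homotopy down. -/
theorem homotopic (h : IsLogChart e S P) {p q : X} {γ γ' : Path p q}
    (hγ : logIncrement e γ = logIncrement e γ') : γ.Homotopic γ' := by
  have := h.contractible
  obtain ⟨ζ, hζ, h0⟩ := exists_log_lift e γ (Complex.exp_log (e p).2)
  obtain ⟨ζ', hζ', h0'⟩ := exists_log_lift e γ' (Complex.exp_log (e p).2)
  rw [logIncrement_eq ζ.continuous hζ, logIncrement_eq ζ'.continuous hζ', h0, h0'] at hγ
  have h1 : ζ' 1 = ζ 1 := by linear_combination -hγ
  choose hS hP using fun t => h.param_log (γ t) (ζ t) (hζ t)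
  choose hS' hP' using fun t => h.param_log (γ' t) (ζ' t) (hζ' t)
  let a : Path (⟨ζ 0, hS 0⟩ : S) ⟨ζ 1, hS 1⟩ :=
    ⟨⟨fun t => ⟨ζ t, hS t⟩, by fun_prop⟩, rfl, rfl⟩
  let b : Path (⟨ζ 0, hS 0⟩ : S) ⟨ζ 1, hS 1⟩ :=
    ⟨⟨fun t => ⟨ζ' t, hS' t⟩, by fun_prop⟩, Subtype.ext (h0'.trans h0.symm), Subtype.ext h1⟩
  have hab : a.Homotopic b := SimplyConnectedSpace.paths_homotopic a b
  have h2 := hab.map ⟨P, h.continuous_param⟩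
  have hp : p = P ⟨ζ 0, hS 0⟩ := by rw [hP, γ.source]
  have hq : q = P ⟨ζ 1, hS 1⟩ := by rw [hP, γ.target]
  have ha : γ = (a.map h.continuous_param).cast hp hq := by
    ext t
    exact (hP t).symm
  have hb : γ' = (b.map h.continuous_param).cast hp hq := by
    ext t
    exact (hP' t).symm
  rw [ha, hb]
  obtain ⟨F⟩ := h2
  exact ⟨F.cast (by ext; rfl) (by ext; rfl)⟩

theorem logIncrementHom_injective (h : IsLogChart e S P) (p : X) :
    Function.Injective (logIncrementHom e p) := by
  intro x y hxy
  obtain ⟨γ, rfl⟩ := Quotient.exists_rep x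
  obtain ⟨γ', rfl⟩ := Quotient.exists_rep y
  exact Quotient.sound (h.homotopic (Multiplicative.ofAdd.injective hxy))

end IsLogChart

theorem logIncrementHom_fromPath {X : Type*} [TopologicalSpace X] (e : C(X, {z : ℂ // z ≠ 0}))
    {p : X} (γ : Path p p) :
    logIncrementHom e p (FundamentalGroup.fromPath (Path.Homotopic.Quotient.mk γ)) =
      Multiplicative.ofAdd (logIncrement e γ) := rfl

namespace IsLogChart

variable {L : Set (ℂ × ℂ)} {e : C(L, {z : ℂ // z ≠ 0})} {S : Set ℂ} {P : S → L}

theorem lift_loopClass {p : L} (γ : Path p p) : Abelianization.lift (logIncrementHom e p)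
    (loopClass γ) = Multiplicative.ofAdd (logIncrement e γ) := by
  rw [loopClass, Abelianization.lift_apply_of, logIncrementHom_fromPath]

theorem loopClass_eq_iff (h : IsLogChart e S P) {p : L} {γ γ' : Path p p} :
    loopClass γ = loopClass γ' ↔ logIncrement e γ = logIncrement e γ' := by
  refine ⟨fun heq => ?_, fun heq => ?_⟩
  · have h1 := congrArg (Abelianization.lift (logIncrementHom e p)) heq
    rwa [lift_loopClass, lift_loopClass, Multiplicative.ofAdd.injective.eq_iff] at h1
  · have h1 : (Path.Homotopic.Quotient.mk γ) = Path.Homotopic.Quotient.mk γ' :=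
      Quotient.sound (h.homotopic heq)
    rw [loopClass, loopClass, h1]

/-- The increment along the connecting path cancels with that along its inverse, so the base points
do not matter. -/
theorem homologousLoops_iff (h : IsLogChart e S P) {p q : L} {γ : Path p p} {γ' : Path q q} :
    HomologousLoops γ γ' ↔ logIncrement e γ = logIncrement e γ' := by
  have h1 : ∀ σ : Path p q, logIncrement e ((σ.trans γ').trans σ.symm) = logIncrement e γ' := by
    intro σ
    rw [logIncrement_trans, logIncrement_trans, logIncrement_symm]
    ring
  refine ⟨fun ⟨σ, hσ⟩ => by rwa [h.loopClass_eq_iff, h1] at hσ, fun heq => ?_⟩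
  have := h.pathConnectedSpace
  refine ⟨PathConnectedSpace.somePath p q, ?_⟩
  rwa [h.loopClass_eq_iff, h1]

theorem generatesH1_of_logIncrement (h : IsLogChart e S P) {p : L} {γ : Path p p}
    (hγ : logIncrement e γ = 2 * Real.pi * Complex.I) : GeneratesH1 γ := by
  intro g
  obtain ⟨x, rfl⟩ := QuotientGroup.mk_surjective g
  obtain ⟨γ', rfl⟩ := Quotient.exists_rep x
  obtain ⟨n, hn⟩ := exists_logIncrement_eq (e := e) γ'
  refine Subgroup.mem_zpowers_iff.mpr ⟨n, ?_⟩
  have h1 : (FundamentalGroup.fromPath (Path.Homotopic.Quotient.mk γ)) ^ n =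
      FundamentalGroup.fromPath (Path.Homotopic.Quotient.mk γ') := by
    apply h.logIncrementHom_injective
    rw [map_zpow, logIncrementHom_fromPath, logIncrementHom_fromPath, hn, hγ, ← ofAdd_zsmul,
      zsmul_eq_mul]
  rw [loopClass, ← map_zpow, h1]
  rfl

/-- A loop of increment `2iπ` exists, obtained by joining two logarithms of the same point. Its
class is the `k`-th power of that of `γ`, whose increment is `n` times `2iπ`; hence `k n = 1` in
`ℤ`. -/
theorem logIncrement_of_generatesH1 (h : IsLogChart e S P) {p : L} {γ : Path p p}
    (hγ : GeneratesH1 γ) : logIncrement e γ = 2 * Real.pi * Complex.I ∨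
      logIncrement e γ = -(2 * Real.pi * Complex.I) := by
  have hlog := Complex.exp_log (e p).2
  obtain ⟨γ', hγ'⟩ := h.exists_path (p := p) (q := p) hlog
    (ζ' := Complex.log (e p).1 + 2 * Real.pi * Complex.I) (by
      rw [Complex.exp_add, Complex.exp_two_pi_mul_I, mul_one, hlog])
  obtain ⟨k, hk⟩ := Subgroup.mem_zpowers_iff.mp (hγ (loopClass γ'))
  obtain ⟨n, hn⟩ := exists_logIncrement_eq (e := e) γ
  have h1 := congrArg (Abelianization.lift (logIncrementHom e p)) hk
  rw [map_zpow, lift_loopClass, lift_loopClass, ← ofAdd_zsmul, zsmul_eq_mul, hn, hγ',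
    Multiplicative.ofAdd.injective.eq_iff] at h1
  have h2 : (k : ℂ) * n = 1 := by
    have h3 := Complex.two_pi_I_ne_zero
    apply mul_right_cancel₀ h3
    linear_combination h1
  have h3 : k * n = 1 := by exact_mod_cast h2
  rcases Int.isUnit_iff.mp (IsUnit.of_mul_eq_one_right k h3) with h4 | h4
  · left
    rw [hn, h4]
    simp
  · right
    rw [hn, h4]
    simp

end IsLogChart

end

/-! ### Growth of the modulus along the hyperbolic flow. -/

noncomputable section

/-- If `f = zⁿ g` with `g(0) ≠ 0` and `n ≥ 1`, then `z f' = f (n + z g' / g)`, where the last term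
is small near the origin. -/
theorem re_conj_mul_mul_deriv_pos {f : ℂ → ℂ} (hf : AnalyticAt ℂ f 0) (h0 : f 0 = 0) :
    ∀ᶠ z in 𝓝 (0 : ℂ), f z ≠ 0 → 0 < (starRingEnd ℂ (f z) * (z * deriv f z)).re := by
  rcases hf.eventually_eq_zero_or_eventually_ne_zero with h | h
  · filter_upwards [h] with z hz hz' using absurd hz hz'
  · have hne : ¬∀ᶠ z in 𝓝 (0 : ℂ), f z = 0 := by
      intro h'
      obtain ⟨z, hz, hz'⟩ := (h.and (h'.filter_mono nhdsWithin_le_nhds)).exists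
      exact hz hz'
    obtain ⟨n, g, hg, hg0, hfg⟩ := hf.exists_eventuallyEq_pow_smul_nonzero_iff.mpr hne
    simp only [sub_zero, smul_eq_mul] at hfg
    have hn : n ≠ 0 := by
      rintro rfl
      have := hfg.self_of_nhds
      rw [h0, pow_zero, one_mul] at this
      exact hg0 this.symm
    have hcont : ContinuousAt (fun z => z * deriv g z / g z) 0 :=
      (continuousAt_id.mul hg.deriv.continuousAt).div hg.continuousAt hg0
    have hsmall : ∀ᶠ z in 𝓝 (0 : ℂ), ‖z * deriv g z / g z‖ < 1 := by
      have h1 := hcont.tendsto.norm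
      simp only [zero_mul, zero_div, norm_zero] at h1
      exact h1.eventually (gt_mem_nhds one_pos)
    filter_upwards [hfg.eventually_nhds, hsmall, hg.eventually_analyticAt,
      hg.continuousAt.eventually_ne hg0] with z hz hs ha hgz hfz
    have hd : deriv f z = n * z ^ (n - 1) * g z + z ^ n * deriv g z := by
      rw [Filter.EventuallyEq.deriv_eq hz, deriv_fun_mul (by fun_prop) ha.differentiableAt]
      simp
    have hzd : z * deriv f z = f z * (n + z * deriv g z / g z) := by
      have hp : z * z ^ (n - 1) = z ^ n := mul_pow_sub_one hn z
      rw [hd, hz.self_of_nhds]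
      field_simp
      linear_combination (n * g z) * hp
    rw [hzd, ← mul_assoc, Complex.conj_mul', ← Complex.ofReal_pow, Complex.re_ofReal_mul]
    have h1 : 0 < ‖f z‖ ^ 2 := by positivity
    refine mul_pos h1 ?_
    rw [Complex.add_re, Complex.natCast_re]
    have h2 := (abs_le.mp ((Complex.abs_re_le_norm _).trans hs.le)).1
    have h3 := (abs_lt.mp ((Complex.abs_re_le_norm _).trans_lt hs)).1
    have h4 : (1 : ℝ) ≤ n := by exact_mod_cast Nat.one_le_iff_ne_zero.mpr hn
    linarith

/-- The quantity is half the derivative of `‖F‖²` along the flow `(exp(s) z, exp(-s) v)`, which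
preserves `z v`. On `v = 0` it is positive off the zeros of `F`, and compactness of the disc `‖z‖ ≤
R` extends this to small `v` on the level `‖F‖ = r`. Only the bound on `v` depends on `r`. -/
theorem exists_radial_derivative_pos {F : ℂ × ℂ → ℂ} (hF : AnalyticAt ℂ F 0) (h0 : F 0 = 0) :
    ∀ᶠ R in 𝓝[>] (0 : ℝ), ∀ r : ℝ, 0 < r → ∀ᶠ v in 𝓝 (0 : ℂ), ∀ z : ℂ, ‖z‖ ≤ R →
      ‖F (z, v)‖ = r → 0 < (starRingEnd ℂ (F (z, v)) * fderiv ℂ F (z, v) (z, -v)).re := by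
  have hi : Tendsto (fun z : ℂ => (z, (0 : ℂ))) (𝓝 0) (𝓝 0) :=
    (by fun_prop : Continuous fun z : ℂ => (z, (0 : ℂ))).tendsto' _ _ rfl
  have hf : AnalyticAt ℂ (fun z : ℂ => F (z, 0)) 0 :=
    AnalyticAt.fun_comp (g := F) (f := fun z : ℂ => (z, (0 : ℂ))) hF (by fun_prop)
  obtain ⟨R₀, hR₀, hb⟩ := Metric.eventually_nhds_iff_ball.mp
    ((re_conj_mul_mul_deriv_pos hf h0).and (hi.eventually hF.eventually_analyticAt))
  filter_upwards [Ioo_mem_nhdsGT hR₀] with R hR r hr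
  have key := (isCompact_closedBall (0 : ℂ) R).eventually_forall_of_forall_eventually
    (x₀ := (0 : ℂ)) (P := fun v z => ‖F (z, v)‖ = r →
      0 < (starRingEnd ℂ (F (z, v)) * fderiv ℂ F (z, v) (z, -v)).re) ?_
  · filter_upwards [key] with v hv z hz using hv z (by simpa using hz)
  intro z hz
  have hz' : z ∈ Metric.ball (0 : ℂ) R₀ := by
    rw [mem_closedBall_zero_iff] at hz
    rw [mem_ball_zero_iff]
    exact hz.trans_lt hR.2
  obtain ⟨h1, h2⟩ := hb z hz'
  have hsw : Tendsto (fun p : ℂ × ℂ => (p.2, p.1)) (𝓝 (0, z)) (𝓝 (z, 0)) :=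
    continuous_swap.tendsto _
  have hFc : Tendsto (fun p : ℂ × ℂ => F (p.2, p.1)) (𝓝 (0, z)) (𝓝 (F (z, 0))) :=
    h2.continuousAt.tendsto.comp hsw
  by_cases hne : ‖F (z, 0)‖ = r
  · have h3 := h1 (norm_ne_zero_iff.mp (by rw [hne]; exact hr.ne'))
    have hd : deriv (fun z : ℂ => F (z, 0)) z = fderiv ℂ F (z, 0) (1, 0) :=
      (h2.differentiableAt.hasFDerivAt.comp_hasDerivAt z
        ((hasDerivAt_id z).prodMk (hasDerivAt_const z (0 : ℂ)))).deriv
    have hd' : z * deriv (fun z : ℂ => F (z, 0)) z = fderiv ℂ F (z, 0) (z, -0) := by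
      rw [hd, ← smul_eq_mul, ← map_smul]
      simp
    rw [hd'] at h3
    have hDc : ContinuousAt (fun p : ℂ × ℂ => fderiv ℂ F (p.2, p.1)) (0, z) :=
      h2.fderiv.continuousAt.tendsto.comp hsw
    have hD : Tendsto (fun p : ℂ × ℂ => fderiv ℂ F (p.2, p.1) (p.2, -p.1)) (𝓝 (0, z))
        (𝓝 (fderiv ℂ F (z, 0) (z, -0))) :=
      (hDc.clm_apply (by fun_prop : ContinuousAt (fun p : ℂ × ℂ => (p.2, -p.1)) (0, z))).tendsto
    have hlim := (Complex.continuous_re.tendsto _).comp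
      (((Complex.continuous_conj.tendsto _).comp hFc).mul hD)
    filter_upwards [hlim.eventually (lt_mem_nhds h3)] with p hp _ using hp
  · filter_upwards [hFc.norm.eventually_ne hne] with p hp hp' using absurd hp' hp

/-- If `‖F‖ ≥ r` held at the earlier point of the flow line, `‖F‖` could not fall below `r`
afterwards, since it increases strictly whenever it equals `r`. -/
theorem norm_lt_of_radial {F : ℂ × ℂ → ℂ} {R r α : ℝ}
    (hA : ∀ u : ℂ × ℂ, ‖u‖ ≤ R → AnalyticAt ℂ F u)
    (hpos : ∀ v : ℂ, ‖v‖ < α → ∀ z : ℂ, ‖z‖ ≤ R → ‖F (z, v)‖ = r →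
      0 < (starRingEnd ℂ (F (z, v)) * fderiv ℂ F (z, v) (z, -v)).re) {z v : ℂ} {σ : ℝ} (hσ : 0 ≤ σ)
    (hz : ‖z‖ ≤ R) (hvR : ‖Complex.exp σ * v‖ ≤ R) (hvα : ‖Complex.exp σ * v‖ < α)
    (h : ‖F (z, v)‖ < r) : ‖F (Complex.exp (-σ) * z, Complex.exp σ * v)‖ < r := by
  by_contra! hcon
  have hr : 0 ≤ r := (norm_nonneg _).trans h.le
  set u : ℝ → ℂ × ℂ := fun s => (Complex.exp s * z, Complex.exp (-s) * v) with hu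
  have hnorm : ∀ s : ℝ, ∀ w : ℂ, ‖Complex.exp s * w‖ = Real.exp s * ‖w‖ := fun s w => by
    rw [norm_mul, Complex.norm_exp_ofReal]
  have hbd : ∀ s ∈ Icc (-σ) 0, ‖(u s).1‖ ≤ R ∧ ‖(u s).2‖ ≤ ‖Complex.exp σ * v‖ := by
    intro s hs
    simp only [hu]
    rw [← Complex.ofReal_neg, hnorm, hnorm, hnorm]
    constructor
    · refine le_trans ?_ hz
      exact mul_le_of_le_one_left (norm_nonneg _) (Real.exp_le_one_iff.mpr hs.2)
    · exact mul_le_mul_of_nonneg_right (Real.exp_le_exp.mpr (by linarith [hs.1])) (norm_nonneg _)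
  have hud : ∀ s, HasDerivAt u ((u s).1, -(u s).2) s := by
    intro s
    have h1 : HasDerivAt (fun s : ℝ => Complex.exp s) (Complex.exp s) s := by
      simpa using (Complex.ofRealCLM.hasDerivAt (x := s)).cexp
    have h2 : HasDerivAt (fun s : ℝ => Complex.exp (-s)) (-Complex.exp (-s)) s := by
      simpa using (Complex.ofRealCLM.hasDerivAt (x := s)).neg.cexp
    have h3 := (h1.mul_const z).prodMk (h2.mul_const v)
    simpa [hu] using h3
  have hmem : ∀ s ∈ Icc (-σ) 0, ‖u s‖ ≤ R := fun s hs =>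
    max_le (hbd s hs).1 ((hbd s hs).2.trans hvR)
  have hFd : ∀ s ∈ Icc (-σ) 0, HasDerivAt (fun s => F (u s))
      (fderiv ℂ F (u s) ((u s).1, -(u s).2)) s := fun s hs =>
    ((hA _ (hmem s hs)).differentiableAt.hasFDerivAt.restrictScalars ℝ).comp_hasDerivAt s (hud s)
  have hN : ∀ s ∈ Icc (-σ) 0, HasDerivAt (fun s => ‖F (u s)‖ ^ 2)
      (2 * (starRingEnd ℂ (F (u s)) * fderiv ℂ F (u s) ((u s).1, -(u s).2)).re) s := by
    intro s hs
    have := (hFd s hs).norm_sq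
    rwa [Complex.inner, mul_comm (fderiv ℂ F (u s) _)] at this
  -- In the comparison lemma the constant `r ^ 2` is the function and `‖F (u s)‖ ^ 2` is the
  -- boundary that stays above it.
  have hle := image_le_of_deriv_right_lt_deriv_boundary' (f := fun _ : ℝ => r ^ 2)
    (f' := fun _ => 0) (a := -σ) (b := 0) continuousOn_const
    (fun x _ => (hasDerivAt_const x (r ^ 2)).hasDerivWithinAt) (B := fun s => ‖F (u s)‖ ^ 2)
    (B' := fun s => 2 * (starRingEnd ℂ (F (u s)) * fderiv ℂ F (u s) ((u s).1, -(u s).2)).re)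
    (by
      have : u (-σ) = (Complex.exp (-σ) * z, Complex.exp σ * v) := by simp [hu]
      rw [this]
      exact pow_le_pow_left₀ hr hcon 2)
    (fun s hs => (hN s hs).continuousAt.continuousWithinAt)
    (fun s hs => (hN s (Ico_subset_Icc_self hs)).hasDerivWithinAt)
    (fun s hs heq => by
      have hs' := Ico_subset_Icc_self hs
      have h1 : ‖F (u s)‖ = r :=
        ((sq_eq_sq₀ hr (norm_nonneg _)).mp heq).symm
      exact mul_pos two_pos (hpos _ ((hbd s hs').2.trans_lt hvα) _ (hbd s hs').1 h1))
    (right_mem_Icc.mpr (by linarith))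
  have h0 : u 0 = (z, v) := by simp [hu]
  rw [h0] at hle
  exact absurd h (not_lt.mpr (le_of_sq_le_sq hle (norm_nonneg _)))

end

/-! ### Integration of power series along logarithmic loops. -/

noncomputable section

open MeasureTheory

theorem integral_cexp_int_mul {ζ ζ' : ℝ → ℂ} (hζ : ContinuousOn ζ (Icc 0 1))
    (hd : ∀ t ∈ Ioo (0 : ℝ) 1, HasDerivAt ζ (ζ' t) t) (hζ' : ContinuousOn ζ' (Icc 0 1))
    (hw : ζ 1 = ζ 0 + 2 * Real.pi * Complex.I) (n : ℤ) :
    ∫ t in (0 : ℝ)..1, Complex.exp (n * ζ t) * ζ' t =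
      if n = 0 then 2 * Real.pi * Complex.I else 0 := by
  have hint : IntervalIntegrable (fun t => Complex.exp (n * ζ t) * ζ' t) volume 0 1 := by
    refine ContinuousOn.intervalIntegrable ?_
    rw [uIcc_of_le zero_le_one]
    exact (Complex.continuous_exp.comp_continuousOn (continuousOn_const.mul hζ)).mul hζ'
  split_ifs with hn
  · subst hn
    rw [intervalIntegral.integral_eq_sub_of_hasDerivAt_of_le zero_le_one hζ
      (fun t ht => by simpa using hd t ht) hint, hw]
    ring
  · have hn' : (n : ℂ) ≠ 0 := by exact_mod_cast hn
    rw [intervalIntegral.integral_eq_sub_of_hasDerivAt_of_le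
      (f := fun t => (n : ℂ)⁻¹ * Complex.exp (n * ζ t)) zero_le_one
      (continuousOn_const.mul
        (Complex.continuous_exp.comp_continuousOn (continuousOn_const.mul hζ)))
      (fun t ht => ?_) hint]
    · have : Complex.exp (n * ζ 1) = Complex.exp (n * ζ 0) := by
        rw [hw, mul_add, Complex.exp_add, Complex.exp_int_mul_two_pi_mul_I, mul_one]
      rw [this, sub_self]
    · have h1 := (((hd t ht).const_mul (n : ℂ)).cexp).const_mul (n : ℂ)⁻¹
      convert! h1 using 1
      field_simp

/-- Along the loop `u₁ ^ m u₂ ^ n = a ^ n exp((m - n) ζ)`. Integrating term by term, which the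
geometric domination allows, only the diagonal monomials survive. -/
theorem integral_seriesSum_cexp {f : MvPowerSeries (Fin 2) ℂ} {ε C s : ℝ} (hε : 0 < ε)
    (hC : ∀ k : Fin 2 →₀ ℕ, ‖MvPowerSeries.coeff k f‖ * ε ^ (k 0 + k 1) ≤ C) (hs0 : 0 ≤ s)
    (hs : s < ε) {a : ℂ} {ζ ζ' : ℝ → ℂ} (hζ : ContinuousOn ζ (Icc 0 1))
    (hd : ∀ t ∈ Ioo (0 : ℝ) 1, HasDerivAt ζ (ζ' t) t) (hζ' : ContinuousOn ζ' (Icc 0 1))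
    (hw : ζ 1 = ζ 0 + 2 * Real.pi * Complex.I)
    (hb : ∀ t ∈ Icc (0 : ℝ) 1, ‖(Complex.exp (ζ t), a * Complex.exp (-ζ t))‖ ≤ s) :
    ∫ t in (0 : ℝ)..1, seriesSum f (Complex.exp (ζ t), a * Complex.exp (-ζ t)) * ζ' t =
      2 * Real.pi * Complex.I * ∑' n, MvPowerSeries.coeff (pairExponent (n, n)) f * a ^ n := by
  have hC0 : 0 ≤ C := (mul_nonneg (norm_nonneg _) (by positivity)).trans (hC 0)
  obtain ⟨M, hM⟩ := isCompact_Icc.exists_bound_of_continuousOn hζ'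
  have hsub : uIoc (0 : ℝ) 1 ⊆ Icc 0 1 := by
    rw [uIoc_of_le zero_le_one]
    exact Ioc_subset_Icc_self
  have hsum := (summable_geometric_pair (q := s / ε) (by positivity) ((div_lt_one hε).mpr hs))
  have hexp : ∀ (k : Fin 2 →₀ ℕ) (t : ℝ),
      Complex.exp (ζ t) ^ k 0 * (a * Complex.exp (-ζ t)) ^ k 1 =
        a ^ k 1 * Complex.exp (((k 0 - k 1 : ℤ) : ℂ) * ζ t) := by
    intro k t
    rw [mul_pow, ← Complex.exp_nat_mul, ← Complex.exp_nat_mul, mul_left_comm, ← Complex.exp_add]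
    congr 2
    push_cast
    ring
  have hcont : ∀ k : Fin 2 →₀ ℕ, ContinuousOn (fun t => MvPowerSeries.coeff k f *
      (Complex.exp (ζ t) ^ k 0 * (a * Complex.exp (-ζ t)) ^ k 1) * ζ' t) (Icc 0 1) := by
    intro k
    have h1 := Complex.continuous_exp.comp_continuousOn hζ
    have h2 := Complex.continuous_exp.comp_continuousOn hζ.neg
    exact (continuousOn_const.mul ((h1.pow _).mul ((continuousOn_const.mul h2).pow _))).mul hζ'
  have key := intervalIntegral.hasSum_integral_of_dominated_convergence (μ := volume) (a := 0)
    (b := 1) (F := fun (k : Fin 2 →₀ ℕ) t => MvPowerSeries.coeff k f *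
      (Complex.exp (ζ t) ^ k 0 * (a * Complex.exp (-ζ t)) ^ k 1) * ζ' t)
    (f := fun t => seriesSum f (Complex.exp (ζ t), a * Complex.exp (-ζ t)) * ζ' t)
    (fun k _ => C * (s / ε) ^ (k 0 + k 1) * M)
    (fun k => ((hcont k).mono hsub).aestronglyMeasurable measurableSet_uIoc)
    (fun k => Eventually.of_forall fun t ht => by
      have h1 := norm_term_le hε hC (hb t (hsub ht)) k
      rw [norm_mul]
      exact mul_le_mul h1 (hM t (hsub ht)) (norm_nonneg _) (by positivity))
    (Eventually.of_forall fun t _ => (hsum.mul_left C).mul_right M)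
    intervalIntegrable_const
    (Eventually.of_forall fun t ht => by
      have h1 := (summable_term hε hC ((hb t (hsub ht)).trans_lt hs)).hasSum
      exact h1.mul_right (ζ' t))
  have hterm : ∀ k : Fin 2 →₀ ℕ, ∫ t in (0 : ℝ)..1, MvPowerSeries.coeff k f *
      (Complex.exp (ζ t) ^ k 0 * (a * Complex.exp (-ζ t)) ^ k 1) * ζ' t =
        if k 0 = k 1 then MvPowerSeries.coeff k f * a ^ k 1 * (2 * Real.pi * Complex.I) else 0 := by
    intro k
    simp_rw [hexp, ← mul_assoc, mul_assoc _ (Complex.exp _)]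
    rw [intervalIntegral.integral_const_mul, integral_cexp_int_mul hζ hd hζ' hw]
    simp only [sub_eq_zero, Nat.cast_inj, mul_ite, mul_zero]
    congr 1
    ring
  simp_rw [hterm] at key
  have hinj : Function.Injective fun n : ℕ => pairExponent (n, n) := fun m n h => by
    simpa using pairExponent.injective h
  have h2 := (hinj.hasSum_iff (f := fun k : Fin 2 →₀ ℕ => if k 0 = k 1 then
    MvPowerSeries.coeff k f * a ^ k 1 * (2 * Real.pi * Complex.I) else 0) fun k hk => by
      rw [if_neg]
      intro heq
      refine hk ⟨k 0, ?_⟩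
      ext i
      fin_cases i
      · simp
      · simpa using heq).mpr key
  rw [← h2.tsum_eq, ← tsum_mul_left]
  refine tsum_congr fun n => ?_
  simp only [Function.comp_apply, pairExponent_zero, pairExponent_one, if_true]
  ring

end

/-! ### The period of a time form in the Morse chart. -/

noncomputable section

open MeasureTheory

/-- Near `t` the lift stays within `π` of `ζ t`, so it is given there by the principal logarithm of
`z s / z t`. -/
theorem hasDerivAt_log_lift {ζ z : ℝ → ℂ} {z' : ℂ} {t : ℝ} (hζ : ContinuousAt ζ t)
    (h : ∀ᶠ s in 𝓝 t, Complex.exp (ζ s) = z s) (hz : HasDerivAt z z' t) :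
    HasDerivAt ζ (z' / z t) t := by
  have hzt : z t ≠ 0 := by
    rw [← h.self_of_nhds]
    exact Complex.exp_ne_zero _
  have h1 : ∀ᶠ s in 𝓝 t, ‖ζ s - ζ t‖ < Real.pi := by
    have := (hζ.tendsto.sub_const (ζ t)).norm
    simp only [sub_self, norm_zero] at this
    exact this.eventually (gt_mem_nhds Real.pi_pos)
  have h2 : ζ =ᶠ[𝓝 t] fun s => ζ t + Complex.log (z s / z t) := by
    filter_upwards [h, h1] with s hs hs1
    have h3 := abs_lt.mp ((Complex.abs_im_le_norm (ζ s - ζ t)).trans_lt hs1)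
    rw [← hs, ← h.self_of_nhds, ← Complex.exp_sub, Complex.log_exp h3.1 h3.2.le]
    ring
  have h4 : HasDerivAt (fun s => ζ t + Complex.log (z s / z t)) (z' / z t / (z t / z t)) t := by
    refine HasDerivAt.const_add _ (HasDerivAt.clog_real (hz.div_const _) ?_)
    rw [div_self hzt]
    exact Complex.one_mem_slitPlane
  rw [div_self hzt, div_one] at h4
  exact h4.congr_of_eventuallyEq h2

/-- A map straightening `H` to the product of the coordinates sends the saddle field to a multiple
of the Hamiltonian field. -/
theorem fderiv_saddle_eq_jacobianDet_smul_hamField {H : ℂ × ℂ → ℂ} {G : ℂ × ℂ → ℂ × ℂ} {u : ℂ × ℂ}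
    (hG : DifferentiableAt ℂ G u) (hH : DifferentiableAt ℂ H (G u))
    (h : ∀ᶠ v in 𝓝 u, H (G v) = v.1 * v.2) :
    fderiv ℂ G u (u.1, -u.2) = -jacobianDet G u • hamField H (G u) := by
  have h1 : HasFDerivAt (fun v : ℂ × ℂ => v.1 * v.2) ((fderiv ℂ H (G u)).comp (fderiv ℂ G u)) u :=
    (hH.hasFDerivAt.comp u hG.hasFDerivAt).congr_of_eventuallyEq (h.mono fun v hv => hv.symm)
  have h2 : HasFDerivAt (fun v : ℂ × ℂ => v.1 * v.2) _ u :=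
    (hasFDerivAt_fst (𝕜 := ℂ) (p := u)).mul hasFDerivAt_snd
  have h3 := h1.unique h2
  have hv : ∀ (A : ℂ × ℂ →L[ℂ] ℂ) (v : ℂ × ℂ), A v = v.1 * A (1, 0) + v.2 * A (0, 1) := by
    intro A v
    rw [← smul_eq_mul, ← smul_eq_mul, ← map_smul, ← map_smul, ← map_add]
    simp
  have hw : ∀ (A : ℂ × ℂ →L[ℂ] ℂ × ℂ) (v : ℂ × ℂ), A v = v.1 • A (1, 0) + v.2 • A (0, 1) := by
    intro A v
    rw [← map_smul, ← map_smul, ← map_add]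
    simp
  -- The form `dH` takes the values `u₂` and `u₁` on the columns of `DG`. Both components of the
  -- claim are combinations of these two relations.
  have e1 := congrArg (fun A => A (1, 0)) h3
  have e2 := congrArg (fun A => A (0, 1)) h3
  simp at e1 e2
  rw [hv] at e1 e2
  rw [hw]
  ext
  · simp [jacobianDet, hamField]
    linear_combination (fderiv ℂ G u (0, 1)).1 * e1 - (fderiv ℂ G u (1, 0)).1 * e2
  · simp [jacobianDet, hamField]
    linear_combination (fderiv ℂ G u (0, 1)).2 * e1 - (fderiv ℂ G u (1, 0)).2 * e2

/-- The data needed to compute periods along a loop: in the chart `U` with inverse `G`, the loop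
reads `(exp ζ, a exp (-ζ))`. -/
theorem loopPeriod_eq {L : Set (ℂ × ℂ)} {p : L} {γ : Path p p} (hγ : IsC1Loop γ)
    {H : ℂ × ℂ → ℂ} {U G : ℂ × ℂ → ℂ × ℂ} {f : MvPowerSeries (Fin 2) ℂ} {ε C s : ℝ} (hε : 0 < ε)
    (hC : ∀ k : Fin 2 →₀ ℕ, ‖MvPowerSeries.coeff k f‖ * ε ^ (k 0 + k 1) ≤ C) (hs0 : 0 ≤ s)
    (hs : s < ε) {a : ℂ} {ζ : C(unitInterval, ℂ)}
    (hw : ζ 1 = ζ 0 + 2 * Real.pi * Complex.I)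
    (hζ : ∀ t, U (γ t) = (Complex.exp (ζ t), a * Complex.exp (-ζ t)))
    (hUa : ∀ t, AnalyticAt ℂ U (γ t)) (hUs : ∀ t, ‖U (γ t)‖ ≤ s)
    (hGU : ∀ t, G (U (γ t)) = γ t)
    (hGa : ∀ t, AnalyticAt ℂ G (U (γ t))) (hHa : ∀ t, AnalyticAt ℂ H (γ t))
    (hHG : ∀ t, ∀ᶠ v in 𝓝 (U (γ t)), H (G v) = v.1 * v.2)
    (hj : ∀ t, jacobianDet G (U (γ t)) = seriesSum f (U (γ t)))
    {τ : ℂ × ℂ → (ℂ × ℂ) →L[ℂ] ℂ} (hτ : IsTimeForm γ (hamField H) τ) :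
    loopPeriod γ τ = -∑' n, MvPowerSeries.coeff (pairExponent (n, n)) f * a ^ n := by
  set g : ℝ → ℂ × ℂ := fun t => (γ.extend t : ℂ × ℂ) with hg
  -- The derivative within `[0, 1]` is continuous up to the end points, where the extended loop need
  -- not be differentiable.
  set D : ℝ → ℂ × ℂ := fun t => derivWithin g (Icc 0 1) t with hD
  set Z : ℝ → ℂ := IccExtend zero_le_one ζ with hZ
  set Z' : ℝ → ℂ := fun t => (fderiv ℂ U (g t) (D t)).1 / (U (g t)).1 with hZ'
  have hgI : ∀ t (ht : t ∈ Icc (0 : ℝ) 1), g t = γ ⟨t, ht⟩ := fun t ht => by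
    simp [hg, Path.extend_apply _ ht]
  have hZI : ∀ t (ht : t ∈ Icc (0 : ℝ) 1), Z t = ζ ⟨t, ht⟩ := fun t ht =>
    IccExtend_of_mem _ _ ht
  have hZc : Continuous Z := ζ.continuous.Icc_extend'
  have hgc : ContinuousOn g (Icc 0 1) := hγ.continuousOn
  have hDc : ContinuousOn D (Icc 0 1) :=
    hγ.continuousOn_derivWithin (uniqueDiffOn_Icc zero_lt_one) le_rfl
  have hgd : ∀ t ∈ Ioo (0 : ℝ) 1, HasDerivAt g (D t) t := by
    intro t ht
    have h1 := (hγ.differentiableOn one_ne_zero t (Ioo_subset_Icc_self ht)).hasDerivWithinAt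
    exact h1.hasDerivAt (Icc_mem_nhds ht.1 ht.2)
  have hUg : ∀ t ∈ Icc (0 : ℝ) 1, U (g t) = (Complex.exp (Z t), a * Complex.exp (-Z t)) := by
    intro t ht
    rw [hgI t ht, hZI t ht, hζ]
  have hUga : ∀ t ∈ Icc (0 : ℝ) 1, AnalyticAt ℂ U (g t) := fun t ht => by
    rw [hgI t ht]
    exact hUa _
  have hZ'c : ContinuousOn Z' (Icc 0 1) := by
    have h1 : ContinuousOn (fun t => U (g t)) (Icc 0 1) := fun t ht =>
      (hUga t ht).continuousAt.comp_continuousWithinAt (hgc t ht)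
    have h2 : ContinuousOn (fun t => fderiv ℂ U (g t)) (Icc 0 1) := fun t ht =>
      (hUga t ht).fderiv.continuousAt.comp_continuousWithinAt (hgc t ht)
    refine (h2.clm_apply hDc).fst.div h1.fst fun t ht => ?_
    rw [hUg t ht]
    exact Complex.exp_ne_zero _
  have hUd : ∀ t ∈ Ioo (0 : ℝ) 1, HasDerivAt (fun t => U (g t)) (fderiv ℂ U (g t) (D t)) t := by
    intro t ht
    exact ((hUga t (Ioo_subset_Icc_self ht)).differentiableAt.hasFDerivAt.restrictScalars
      ℝ).comp_hasDerivAt t (hgd t ht)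
  have hZd : ∀ t ∈ Ioo (0 : ℝ) 1, HasDerivAt Z (Z' t) t := by
    intro t ht
    refine hasDerivAt_log_lift (z := fun t => (U (g t)).1) hZc.continuousAt ?_ (hUd t ht).fst
    filter_upwards [Icc_mem_nhds ht.1 ht.2] with s hs
    rw [hUg s hs]
  -- The loop is `G(exp Z, a exp(-Z))`, so its velocity is `Z'` times the image of the saddle field,
  -- a multiple of `J∇H`. Any time form is prescribed on this direction, whence the independence of
  -- `τ`.
  have hDeq : ∀ t ∈ Ioo (0 : ℝ) 1,
      D t = -(Z' t * jacobianDet G (U (g t))) • hamField H (g t) := by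
    intro t ht
    have ht' := Ioo_subset_Icc_self ht
    have hGt := hGa ⟨t, ht'⟩
    rw [← hgI t ht'] at hGt
    have h1 : HasDerivAt (fun t => (Complex.exp (Z t), a * Complex.exp (-Z t)))
        (Z' t • ((U (g t)).1, -(U (g t)).2)) t := by
      have := (hZd t ht).cexp.prodMk ((hZd t ht).neg.cexp.const_mul a)
      convert! this using 1
      rw [hUg t ht']
      ext <;> simp <;> ring
    have h2 : HasDerivAt (fun t => G (Complex.exp (Z t), a * Complex.exp (-Z t)))
        (fderiv ℂ G (U (g t)) (Z' t • ((U (g t)).1, -(U (g t)).2))) t := by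
      have h3 := hGt.differentiableAt.hasFDerivAt.restrictScalars ℝ
      rw [hUg t ht'] at h3 ⊢
      rw [hUg t ht'] at h1
      exact h3.comp_hasDerivAt t h1
    have h4 : HasDerivAt g (fderiv ℂ G (U (g t)) (Z' t • ((U (g t)).1, -(U (g t)).2))) t := by
      refine h2.congr_of_eventuallyEq ?_
      filter_upwards [Icc_mem_nhds ht.1 ht.2] with s hs
      rw [← hUg s hs, hgI s hs, hGU]
    have hGg : G (U (g t)) = g t := by rw [hgI t ht', hGU]
    have hHt : DifferentiableAt ℂ H (G (U (g t))) := by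
      rw [hGg, hgI t ht']
      exact (hHa _).differentiableAt
    have hev : ∀ᶠ v in 𝓝 (U (g t)), H (G v) = v.1 * v.2 := by
      rw [hgI t ht']
      exact hHG _
    rw [(hgd t ht).unique h4, map_smul,
      fderiv_saddle_eq_jacobianDet_smul_hamField hGt.differentiableAt hHt hev, hGg, smul_smul]
    congr 1
    ring
  have hmap : ∀ t, (γ.map continuous_subtype_val).extend t = g t := fun t => by
    simp [hg, Path.extend, IccExtend]
  have hcurve : curveIntegral τ (γ.map continuous_subtype_val) =
      ∫ t in (0 : ℝ)..1, -(seriesSum f (Complex.exp (Z t), a * Complex.exp (-Z t)) * Z' t) := by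
    rw [curveIntegral_eq_intervalIntegral_deriv]
    apply intervalIntegral.integral_congr_ae_restrict
    rw [uIoc_of_le zero_le_one, ← restrict_Ioo_eq_restrict_Ioc]
    filter_upwards [ae_restrict_mem measurableSet_Ioo] with t ht
    have ht' := Ioo_subset_Icc_self ht
    have h1 : τ (g t) (hamField H (g t)) = 1 := by
      rw [hgI t ht']
      exact hτ _
    have h2 : jacobianDet G (U (g t)) = seriesSum f (U (g t)) := by
      rw [hgI t ht']
      exact hj _
    rw [funext hmap, (hgd t ht).deriv, hDeq t ht, map_smul, h1, h2, hUg t ht', smul_eq_mul]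
    ring
  have hZ01 : Z 1 = Z 0 + 2 * Real.pi * Complex.I := by
    rw [hZI 1 (by simp), hZI 0 (by simp)]
    exact hw
  have hbound : ∀ t ∈ Icc (0 : ℝ) 1, ‖(Complex.exp (Z t), a * Complex.exp (-Z t))‖ ≤ s := by
    intro t ht
    rw [← hUg t ht, hgI t ht]
    exact hUs _
  rw [loopPeriod, hcurve, intervalIntegral.integral_neg,
    integral_seriesSum_cexp hε hC hs0 hs hZc.continuousOn hZd hZ'c hZ01 hbound, mul_neg,
    inv_mul_cancel_left₀ Complex.two_pi_I_ne_zero]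

end

/-! ### A positively oriented loop in the level curve. -/

noncomputable section

open Asymptotics

/-- Near a saddle point, `H (x, x w) = x ^ 2 b` is solved by `w = W (x, b)`. -/
theorem exists_blowup_solution {H : ℂ × ℂ → ℂ} {l : ℂ} (hl : l ≠ 0) (hH : AnalyticAt ℂ H 0)
    (hHl : (fun y : ℂ × ℂ => H y - l * (y.1 * y.2)) =o[𝓝 0] fun y : ℂ × ℂ => ‖y‖ ^ 2) :
    ∃ W : ℂ × ℂ → ℂ, AnalyticAt ℂ W 0 ∧ W 0 = 0 ∧
      ∀ᶠ p in 𝓝 (0 : ℂ × ℂ), H (p.1, p.1 * W p) = p.1 ^ 2 * p.2 := by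
  obtain ⟨A, B, C, hA, hB, hC, hA0, hB0, hC0, hHy⟩ := exists_quadratic_expansion hH hHl
  let b : ℂ × ℂ → ℂ × ℂ := fun p => (p.1, p.1 * p.2)
  have hb : AnalyticAt ℂ b 0 := analyticAt_fst.prod (analyticAt_fst.mul analyticAt_snd)
  have hb0 : b 0 = 0 := by simp [b]
  have hcomp : ∀ {F : ℂ × ℂ → ℂ}, AnalyticAt ℂ F 0 → AnalyticAt ℂ (fun p => F (b p)) 0 :=
    fun {F} hF => AnalyticAt.fun_comp (g := F) (f := b) (by rwa [hb0]) hb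
  -- Here `H(x, x w) = x² K(x, w)` and `∂K/∂w = l ≠ 0` at the origin, so `(x, w) ↦ (x, K)` is
  -- locally invertible.
  let K : ℂ × ℂ → ℂ := fun p => A (b p) + p.2 * B (b p) + p.2 ^ 2 * C (b p)
  have h1 := analyticAt_snd (𝕜 := ℂ) (p := (0 : ℂ × ℂ))
  have hK : AnalyticAt ℂ K 0 :=
    ((hcomp hA).add (h1.mul (hcomp hB))).add ((h1.pow 2).mul (hcomp hC))
  have hK0 : K 0 = 0 := by simp [K, hb0, hA0]
  have hK2 : fderiv ℂ K 0 (0, 1) = l := by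
    have h2 : HasDerivAt (fun w : ℂ => K (0, w)) (fderiv ℂ K 0 (0, 1)) 0 :=
      hK.differentiableAt.hasFDerivAt.comp_hasDerivAt (f := fun w : ℂ => ((0 : ℂ), w)) 0
        ((hasDerivAt_const 0 (0 : ℂ)).prodMk (hasDerivAt_id 0))
    have h3 : (fun w : ℂ => K (0, w)) = fun w => w * l := by
      funext w
      have : b (0, w) = 0 := by simp [b]
      simp [K, this, hA0, hB0, hC0]
    rw [h3] at h2
    simpa using h2.unique ((hasDerivAt_id (0 : ℂ)).mul_const l)
  set α := fderiv ℂ K 0 (1, 0) with hα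
  have hKv : ∀ v, fderiv ℂ K 0 v = v.1 * α + v.2 * l := by
    intro v
    rw [← hK2, hα, ← smul_eq_mul, ← smul_eq_mul, ← map_smul, ← map_smul, ← map_add]
    simp
  let Ψ : ℂ × ℂ → ℂ × ℂ := fun p => (p.1, K p)
  have hΨ : AnalyticAt ℂ Ψ 0 := analyticAt_fst.prod hK
  have hΨ0 : Ψ 0 = 0 := by simp [Ψ, hK0]
  let i : (ℂ × ℂ) ≃L[ℂ] (ℂ × ℂ) := ContinuousLinearEquiv.equivOfInverse
    ((ContinuousLinearMap.fst ℂ ℂ ℂ).prod (fderiv ℂ K 0))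
    ((ContinuousLinearMap.fst ℂ ℂ ℂ).prod
      (l⁻¹ • (ContinuousLinearMap.snd ℂ ℂ ℂ - α • ContinuousLinearMap.fst ℂ ℂ ℂ)))
    (fun v => by ext <;> simp [hKv]; field_simp; ring)
    (fun v => by ext <;> simp [hKv]; field_simp; ring)
  have hΨd : HasFDerivAt Ψ (i : (ℂ × ℂ) →L[ℂ] (ℂ × ℂ)) 0 :=
    hasFDerivAt_fst.prodMk hK.differentiableAt.hasFDerivAt
  have hΨs : HasStrictFDerivAt Ψ (i : (ℂ × ℂ) →L[ℂ] (ℂ × ℂ)) 0 := by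
    have := hΨ.hasStrictFDerivAt
    rwa [hΨd.fderiv] at this
  set Q := hΨs.localInverse Ψ i 0 with hQ
  have hQa : AnalyticAt ℂ Q 0 := by
    have := (hΨs.toOpenPartialHomeomorph Ψ).analyticAt_symm'
      hΨs.mem_toOpenPartialHomeomorph_source hΨ hΨd.fderiv
    rw [hΨs.toOpenPartialHomeomorph_coe, hΨ0] at this
    exact this
  have hQ0 : Q 0 = 0 := by
    have := hΨs.localInverse_apply_image
    rwa [hΨ0] at this
  have hQr : ∀ᶠ p in 𝓝 (0 : ℂ × ℂ), Ψ (Q p) = p := by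
    have := hΨs.eventually_right_inverse
    rwa [hΨ0] at this
  have hQt : Tendsto (fun p => b (Q p)) (𝓝 0) (𝓝 0) := by
    have h4 := hb.continuousAt.tendsto
    have h5 := hQa.continuousAt.tendsto
    rw [hb0] at h4
    rw [hQ0] at h5
    exact h4.comp h5
  refine ⟨fun p => (Q p).2, analyticAt_snd.comp hQa, by simp [hQ0], ?_⟩
  filter_upwards [hQr, hQt.eventually hHy] with p hp hp'
  have e1 : (Q p).1 = p.1 := (congrArg Prod.fst hp : (Ψ (Q p)).1 = p.1)
  have e2 : K (Q p) = p.2 := (congrArg Prod.snd hp : (Ψ (Q p)).2 = p.2)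
  simp only [b, K, e1] at hp' e2
  rw [hp']
  linear_combination p.1 ^ 2 * e2

theorem norm_mul_cexp_two_pi_mul_I {s : ℝ} (hs : 0 ≤ s) (t : ℝ) :
    ‖(s * Complex.exp (2 * Real.pi * Complex.I * t) : ℂ)‖ = s := by
  have : (2 * Real.pi * Complex.I * t : ℂ) = ((2 * Real.pi * t : ℝ) : ℂ) * Complex.I := by
    push_cast; ring
  rw [norm_mul, this, Complex.norm_exp_ofReal_mul_I, mul_one, Complex.norm_real,
    Real.norm_of_nonneg hs]

/-- With `y₁` on the circle of radius `s`, take `y₂ = y₁ W(y₁, a / y₁²)`. The choice `s² = 2 ‖a‖ /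
ε` gives `‖a / y₁²‖ = ε / 2`, inside the domain of `W`, and `‖W‖ < 1` there ensures `‖y₂‖ < s`. -/
theorem exists_loop_of_saddle {H : ℂ × ℂ → ℂ} {l : ℂ} (hl : l ≠ 0) (hH : AnalyticAt ℂ H 0)
    (hHl : (fun y : ℂ × ℂ => H y - l * (y.1 * y.2)) =o[𝓝 0] fun y : ℂ × ℂ => ‖y‖ ^ 2)
    {r : ℝ} (hr : 0 < r) : ∀ᶠ a in 𝓝[≠] (0 : ℂ), ∃ s : ℝ, 0 < s ∧ s < r ∧
      ∃ g : ℝ → ℂ × ℂ, ContDiff ℝ 1 g ∧ g 0 = g 1 ∧ ∀ t,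
        (g t).1 = s * Complex.exp (2 * Real.pi * Complex.I * t) ∧ ‖(g t).2‖ < s ∧ H (g t) = a := by
  obtain ⟨W, hW, hW0, hHW⟩ := exists_blowup_solution hl hH hHl
  have hW1 : ∀ᶠ p in 𝓝 (0 : ℂ × ℂ), ‖W p‖ < 1 := by
    have := hW.continuousAt.tendsto.norm
    rw [hW0, norm_zero] at this
    exact this.eventually (gt_mem_nhds one_pos)
  obtain ⟨ε, hε, hb⟩ := Metric.eventually_nhds_iff_ball.mp
    (hHW.and (hW1.and hW.eventually_analyticAt))
  have hs : Tendsto (fun a : ℂ => Real.sqrt (2 * ‖a‖ / ε)) (𝓝 0) (𝓝 0) :=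
    (by fun_prop : Continuous fun a : ℂ => Real.sqrt (2 * ‖a‖ / ε)).tendsto' _ _ (by simp)
  filter_upwards [self_mem_nhdsWithin, (hs.eventually (gt_mem_nhds (lt_min hr hε))).filter_mono
    nhdsWithin_le_nhds] with a ha0 ha
  have ha' : 0 < ‖a‖ := norm_pos_iff.mpr ha0
  set s := Real.sqrt (2 * ‖a‖ / ε) with hsdef
  have hs0 : 0 < s := Real.sqrt_pos.mpr (by positivity)
  have hs2 : s ^ 2 = 2 * ‖a‖ / ε := Real.sq_sqrt (by positivity)
  have hs0' : (s : ℂ) ≠ 0 := by exact_mod_cast hs0.ne'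
  let x : ℝ → ℂ := fun t => s * Complex.exp (2 * Real.pi * Complex.I * t)
  have hx : ContDiff ℝ 1 x :=
    contDiff_const.mul ((contDiff_const.mul Complex.ofRealCLM.contDiff).cexp)
  have hxn : ∀ t, ‖x t‖ = s := fun t => norm_mul_cexp_two_pi_mul_I hs0.le t
  have hx0 : ∀ t, x t ≠ 0 := fun t => norm_pos_iff.mp (by rw [hxn]; exact hs0)
  let q : ℝ → ℂ × ℂ := fun t => (x t, a * (x t ^ 2)⁻¹)
  have hq : ContDiff ℝ 1 q :=
    hx.prodMk (contDiff_const.mul ((hx.pow 2).inv fun t => pow_ne_zero 2 (hx0 t)))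
  have hqb : ∀ t, q t ∈ Metric.ball (0 : ℂ × ℂ) ε := by
    intro t
    rw [mem_ball_zero_iff, Prod.norm_mk, max_lt_iff, hxn, ← div_eq_mul_inv, norm_div, norm_pow, hxn, hs2]
    refine ⟨ha.trans_le (min_le_right _ _), ?_⟩
    rw [div_div_eq_mul_div, div_lt_iff₀ (by positivity)]
    nlinarith [mul_pos ha' hε]
  have hWq : ContDiff ℝ 1 fun t => W (q t) := by
    rw [contDiff_iff_contDiffAt]
    intro t
    have h1 : ContDiffAt ℝ 1 W (q t) := ((hb _ (hqb t)).2.2.contDiffAt).restrict_scalars ℝ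
    exact h1.comp t hq.contDiffAt
  have h01 : x 0 = x 1 := by simp [x]
  refine ⟨s, hs0, ha.trans_le (min_le_left _ _), fun t => (x t, x t * W (q t)),
    hx.prodMk (hx.mul hWq), by simp only [q, h01], fun t => ⟨rfl, ?_, ?_⟩⟩
  · rw [norm_mul, hxn]
    exact mul_lt_of_lt_one_right hs0 (hb _ (hqb t)).2.1
  · have := (hb _ (hqb t)).1
    rw [this]
    simp only [q]
    rw [mul_left_comm, mul_inv_cancel₀ (pow_ne_zero 2 (hx0 t)), mul_one]

end

/-! ### Contractibility in logarithmic coordinates. -/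

noncomputable section

/-- The set is pushed horizontally onto the vertical line, which is then contracted to a point. -/
theorem contractibleSpace_of_retract_line {S : Set ℂ} {m : ℝ} (hline : ∀ ζ : ℂ, ζ.re = m → ζ ∈ S)
    (hrad : ∀ ζ ∈ S, ∀ s ∈ uIcc m ζ.re, (s + ζ.im * Complex.I : ℂ) ∈ S) : ContractibleSpace S := by
  rw [contractible_iff_id_nullhomotopic]
  have hl : ∀ y : ℝ, (m + y * Complex.I : ℂ) ∈ S := fun y => hline _ (by simp)
  let ret : C(S, S) := ⟨fun ζ => ⟨m + (ζ : ℂ).im * Complex.I, hl _⟩, by fun_prop⟩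
  have hseg : ∀ (t : unitInterval) (ζ : S),
      (((1 - t : ℝ) * (ζ : ℂ).re + t * m : ℝ) + (ζ : ℂ).im * Complex.I : ℂ) ∈ S := by
    intro t ζ
    refine hrad ζ ζ.2 _ ?_
    rw [uIcc_comm, ← segment_eq_uIcc]
    exact ⟨1 - t, t, by linarith [t.2.2], t.2.1, by ring, by simp⟩
  let F₁ : ContinuousMap.Homotopy (ContinuousMap.id S) ret :=
    { toFun := fun p => ⟨_, hseg p.1 p.2⟩
      continuous_toFun := by fun_prop
      map_zero_left := fun ζ => Subtype.ext (by simp)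
      map_one_left := fun ζ => Subtype.ext (by simp [ret]) }
  let F₂ : ContinuousMap.Homotopy ret (ContinuousMap.const S ⟨m + (0 : ℝ) * Complex.I, hl 0⟩) :=
    { toFun := fun p => ⟨m + ((1 - p.1 : ℝ) * (p.2 : ℂ).im : ℝ) * Complex.I, hl _⟩
      continuous_toFun := by fun_prop
      map_zero_left := fun ζ => Subtype.ext (by simp [ret])
      map_one_left := fun ζ => Subtype.ext (by simp) }
  exact ⟨_, ⟨F₁.trans F₂⟩⟩

/-- The radial derivative of `‖F‖` is positive on the level set `‖F‖ = r`, over the bidisc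
`‖z‖ ≤ R`, `‖v‖ < α`. -/
def RadiallyIncreasing (F : ℂ × ℂ → ℂ) (R r α : ℝ) : Prop :=
  ∀ v : ℂ, ‖v‖ < α → ∀ z : ℂ, ‖z‖ ≤ R → ‖F (z, v)‖ = r →
    0 < (starRingEnd ℂ (F (z, v)) * fderiv ℂ F (z, v) (z, -v)).re

/-- Moving `ζ` horizontally towards `Re ζ = m` follows the hyperbolic flow. To the right of that
line the second coordinate remains at most `exp m`, hence small enough for the radial estimate; to
the left the two coordinates exchange roles, whence the swapped hypothesis. -/
theorem norm_lt_of_exp_coordinates {F : ℂ × ℂ → ℂ} {R r α : ℝ}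
    (hA : ∀ u : ℂ × ℂ, ‖u‖ ≤ R → AnalyticAt ℂ F u) (hF : RadiallyIncreasing F R r α)
    (hF' : RadiallyIncreasing (fun u => F u.swap) R r α) {a ζ : ℂ} {m : ℝ}
    (hm : ‖a‖ = Real.exp (2 * m)) (hmR : Real.exp m ≤ R) (hmα : Real.exp m < α)
    (hζ : ‖Complex.exp ζ‖ ≤ R) (hζ' : ‖a * Complex.exp (-ζ)‖ ≤ R)
    (h : ‖F (Complex.exp ζ, a * Complex.exp (-ζ))‖ < r) {s : ℝ} (hs : s ∈ uIcc m ζ.re) :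
    ‖F (Complex.exp (s + ζ.im * Complex.I), a * Complex.exp (-(s + ζ.im * Complex.I)))‖ < r := by
  have hre : ζ = ζ.re + ζ.im * Complex.I := (Complex.re_add_im ζ).symm
  rcases le_total m ζ.re with hle | hle
  · rw [uIcc_of_le hle] at hs
    have hbound : ‖Complex.exp ((ζ.re - s : ℝ) : ℂ) * (a * Complex.exp (-ζ))‖ ≤ Real.exp m := by
      rw [norm_mul, norm_mul, Complex.norm_exp_ofReal, Complex.norm_exp, hm, ← Real.exp_add,
        ← Real.exp_add, Complex.neg_re]
      exact Real.exp_le_exp.mpr (by linarith [hs.1])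
    have h1 := norm_lt_of_radial (σ := ζ.re - s) hA hF (by linarith [hs.2]) hζ
      (hbound.trans hmR) (hbound.trans_lt hmα) h
    convert h1 using 4
    · rw [← Complex.exp_add]
      congr 1
      nth_rw 3 [hre]
      push_cast
      ring
    · rw [mul_left_comm, ← Complex.exp_add]
      congr 2
      nth_rw 3 [hre]
      push_cast
      ring
  · rw [uIcc_of_ge hle] at hs
    have hA' : ∀ u : ℂ × ℂ, ‖u‖ ≤ R → AnalyticAt ℂ (fun u : ℂ × ℂ => F u.swap) u := by
      intro u hu
      refine AnalyticAt.fun_comp (g := F) (f := Prod.swap) (hA _ ?_)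
        (analyticAt_snd.prod analyticAt_fst)
      rwa [Prod.norm_def, max_comm] at hu
    have hbound : ‖Complex.exp ((s - ζ.re : ℝ) : ℂ) * Complex.exp ζ‖ ≤ Real.exp m := by
      rw [norm_mul, Complex.norm_exp_ofReal, Complex.norm_exp, ← Real.exp_add]
      exact Real.exp_le_exp.mpr (by linarith [hs.2])
    have h1 := norm_lt_of_radial (σ := s - ζ.re) hA' hF' (by linarith [hs.1]) hζ'
      (hbound.trans hmR) (hbound.trans_lt hmα) h
    convert h1 using 4
    · rw [← Complex.exp_add]
      congr 1
      nth_rw 3 [hre]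
      push_cast
      ring
    · rw [Prod.swap]
      dsimp only
      rw [mul_left_comm, ← Complex.exp_add]
      congr 2
      nth_rw 3 [hre]
      push_cast
      ring

end

/-! ### Uniform radii and logarithmic parametrization of the level curves. -/

noncomputable section

theorem isOpen_polydisc (r₁ r₂ : ℝ) : IsOpen (polydisc r₁ r₂) :=
  (isOpen_lt continuous_fst.norm continuous_const).inter
    (isOpen_lt continuous_snd.norm continuous_const)

theorem eventually_radiallyIncreasing {F : ℂ × ℂ → ℂ} (hF : AnalyticAt ℂ F 0) (h0 : F 0 = 0) :
    ∀ᶠ R in 𝓝[>] (0 : ℝ), ∀ r : ℝ, 0 < r → ∀ᶠ α in 𝓝[>] (0 : ℝ), RadiallyIncreasing F R r α := by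
  filter_upwards [exists_radial_derivative_pos hF h0] with R hR r hr
  obtain ⟨δ, hδ, hb⟩ := Metric.eventually_nhds_iff_ball.mp (hR r hr)
  filter_upwards [Ioo_mem_nhdsGT hδ] with α hα v hv
  exact hb v (mem_ball_zero_iff.mpr (hv.trans hα.2))

/-- Radii on which the local properties of a Morse chart hold uniformly. -/
structure IsMorseDomain (H : ℂ × ℂ → ℂ) (U G : ℂ × ℂ → ℂ × ℂ) (f : MvPowerSeries (Fin 2) ℂ)
    (R ρ : ℝ) : Prop where
  inverse_zero : G 0 = 0
  analyticAt_inverse : ∀ u : ℂ × ℂ, ‖u‖ ≤ R → AnalyticAt ℂ G u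
  right_inverse : ∀ u : ℂ × ℂ, ‖u‖ ≤ R → U (G u) = u
  apply_inverse : ∀ u : ℂ × ℂ, ‖u‖ ≤ R → ∀ᶠ v in 𝓝 u, H (G v) = v.1 * v.2
  jacobian : ∀ u : ℂ × ℂ, ‖u‖ ≤ R → jacobianDet G u = seriesSum f u
  radial_fst : ∀ r : ℝ, 0 < r → ∀ᶠ α in 𝓝[>] (0 : ℝ),
    RadiallyIncreasing (fun u => (G u).1) R r α ∧ RadiallyIncreasing (fun u => (G u.swap).1) R r α
  radial_snd : ∀ r : ℝ, 0 < r → ∀ᶠ α in 𝓝[>] (0 : ℝ),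
    RadiallyIncreasing (fun u => (G u).2) R r α ∧ RadiallyIncreasing (fun u => (G u.swap).2) R r α
  analyticAt_fun : ∀ y : ℂ × ℂ, ‖y‖ < ρ → AnalyticAt ℂ H y
  analyticAt_chart : ∀ y : ℂ × ℂ, ‖y‖ < ρ → AnalyticAt ℂ U y
  norm_chart_lt : ∀ y : ℂ × ℂ, ‖y‖ < ρ → ‖U y‖ < R
  left_inverse : ∀ y : ℂ × ℂ, ‖y‖ < ρ → G (U y) = y
  chart_mul : ∀ y : ℂ × ℂ, ‖y‖ < ρ → (U y).1 * (U y).2 = H y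
  -- As `U₁` is tangent to `y₁`, any factor less than one could be used; it keeps `U₁ / y₁` off the
  -- cut of the logarithm when `‖y₂‖ ≤ ‖y₁‖`.
  chart_near : ∀ y : ℂ × ℂ, ‖y‖ < ρ → ‖(U y).1 - y.1‖ ≤ ‖y‖ / 2

theorem IsMorseChart.exists_isMorseDomain {H : ℂ × ℂ → ℂ} {l : ℂ} {U G : ℂ × ℂ → ℂ × ℂ}
    (hc : IsMorseChart H l U G) (hH : AnalyticAt ℂ H 0) {f : MvPowerSeries (Fin 2) ℂ}
    (hf : HasGerm f (jacobianDet G)) {ε : ℝ} (hε : 0 < ε) :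
    ∃ R ρ : ℝ, 0 < R ∧ R < ε ∧ 0 < ρ ∧ IsMorseDomain H U G f R ρ := by
  have hG := hc.analyticAt_inverse
  have hG₁ : AnalyticAt ℂ (fun u => (G u).1) 0 := analyticAt_fst.comp hG
  have hG₂ : AnalyticAt ℂ (fun u => (G u).2) 0 := analyticAt_snd.comp hG
  have hsw : AnalyticAt ℂ (Prod.swap : ℂ × ℂ → ℂ × ℂ) 0 := analyticAt_snd.prod analyticAt_fst
  have hG₁' : AnalyticAt ℂ (fun u : ℂ × ℂ => (G u.swap).1) 0 :=
    AnalyticAt.fun_comp (g := fun u => (G u).1) (f := Prod.swap) hG₁ hsw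
  have hG₂' : AnalyticAt ℂ (fun u : ℂ × ℂ => (G u.swap).2) 0 :=
    AnalyticAt.fun_comp (g := fun u => (G u).2) (f := Prod.swap) hG₂ hsw
  have hz : G 0 = 0 := hc.inverse_zero
  obtain ⟨δ, hδ, hb⟩ := Metric.eventually_nhds_iff_ball.mp ((hG.eventually_analyticAt.and
    hc.right_inverse).and (hc.apply_inverse.eventually_nhds.and hf.eventuallyEq))
  obtain ⟨R, ⟨⟨⟨h1, h2⟩, h3⟩, h4⟩, hR⟩ := ((((eventually_radiallyIncreasing hG₁ (by simp [hz])).and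
    (eventually_radiallyIncreasing hG₁' (by simp [hz]))).and
    (eventually_radiallyIncreasing hG₂ (by simp [hz]))).and
    (eventually_radiallyIncreasing hG₂' (by simp [hz]))).and
    (Ioo_mem_nhdsGT (lt_min hδ hε)) |>.exists
  have hb' : ∀ u : ℂ × ℂ, ‖u‖ ≤ R → u ∈ Metric.ball (0 : ℂ × ℂ) δ := fun u hu =>
    mem_ball_zero_iff.mpr (hu.trans_lt (hR.2.trans_le (min_le_left _ _)))
  have hUR : ∀ᶠ y in 𝓝 (0 : ℂ × ℂ), ‖U y‖ < R := by
    have := hc.analyticAt_chart.continuousAt.tendsto.norm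
    rw [hc.chart_zero, norm_zero] at this
    exact this.eventually (gt_mem_nhds hR.1)
  have hnear : ∀ᶠ y in 𝓝 (0 : ℂ × ℂ), ‖(U y).1 - y.1‖ ≤ ‖y‖ / 2 := by
    have h5 := hc.analyticAt_chart.differentiableAt.hasFDerivAt.fst.isLittleO.def
      (half_pos one_pos)
    filter_upwards [h5] with y hy
    simp only [hc.chart_zero, Prod.fst_zero, sub_zero, ContinuousLinearMap.comp_apply,
      hc.fderiv_chart] at hy
    simpa [div_eq_inv_mul] using hy
  obtain ⟨ρ, hρ, hB⟩ := Metric.eventually_nhds_iff_ball.mp ((hH.eventually_analyticAt.and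
    hc.analyticAt_chart.eventually_analyticAt).and ((hUR.and hc.left_inverse).and
    (hc.chart_mul.and hnear)))
  have hB' : ∀ y : ℂ × ℂ, ‖y‖ < ρ → y ∈ Metric.ball (0 : ℂ × ℂ) ρ := fun y hy =>
    mem_ball_zero_iff.mpr hy
  exact ⟨R, ρ, hR.1, hR.2.trans_le (min_le_right _ _), hρ,
    { inverse_zero := hc.inverse_zero
      analyticAt_inverse := fun u hu => (hb u (hb' u hu)).1.1
      right_inverse := fun u hu => (hb u (hb' u hu)).1.2
      apply_inverse := fun u hu => (hb u (hb' u hu)).2.1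
      jacobian := fun u hu => (hb u (hb' u hu)).2.2
      radial_fst := fun r hr => (h1 r hr).and (h2 r hr)
      radial_snd := fun r hr => (h3 r hr).and (h4 r hr)
      analyticAt_fun := fun y hy => (hB y (hB' y hy)).1.1
      analyticAt_chart := fun y hy => (hB y (hB' y hy)).1.2
      norm_chart_lt := fun y hy => (hB y (hB' y hy)).2.1.1
      left_inverse := fun y hy => (hB y (hB' y hy)).2.1.2
      chart_mul := fun y hy => (hB y (hB' y hy)).2.2.1
      chart_near := fun y hy => (hB y (hB' y hy)).2.2.2 }⟩

namespace IsMorseDomain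

variable {H : ℂ × ℂ → ℂ} {U G : ℂ × ℂ → ℂ × ℂ} {f : MvPowerSeries (Fin 2) ℂ} {R ρ r₁ r₂ : ℝ}

theorem norm_lt_of_mem_levelCurve (h₁ : r₁ < ρ) (h₂ : r₂ < ρ) {a : ℂ} {y : ℂ × ℂ}
    (hy : y ∈ levelCurve H r₁ r₂ a) : ‖y‖ < ρ :=
  max_lt (hy.1.1.trans h₁) (hy.1.2.trans h₂)

/-- The first chart coordinate, as a nowhere vanishing function on the level curve. -/
def chartCoordinate (hD : IsMorseDomain H U G f R ρ) (h₁ : r₁ < ρ) (h₂ : r₂ < ρ) {a : ℂ}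
    (ha : a ≠ 0) : C(levelCurve H r₁ r₂ a, {z : ℂ // z ≠ 0}) where
  toFun y := ⟨(U y).1, fun h0 => ha <| by
    rw [← y.2.2, ← hD.chart_mul y (norm_lt_of_mem_levelCurve h₁ h₂ y.2), h0, zero_mul]⟩
  continuous_toFun := by
    refine Continuous.subtype_mk (continuous_iff_continuousAt.mpr fun y => ?_) _
    have h3 := (hD.analyticAt_chart y (norm_lt_of_mem_levelCurve h₁ h₂ y.2)).continuousAt
    exact (h3.comp continuous_subtype_val.continuousAt).fst

theorem isLogChart (hD : IsMorseDomain H U G f R ρ) (h₁ : r₁ < ρ) (h₂ : r₂ < ρ)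
    (hr₁ : 0 < r₁) (hr₂ : 0 < r₂) : ∀ᶠ a in 𝓝 (0 : ℂ), ∀ ha : a ≠ 0,
      ∃ S P, IsLogChart (hD.chartCoordinate h₁ h₂ ha) S P := by
  have hR : 0 < R := (norm_nonneg _).trans_lt
    (hD.norm_chart_lt 0 (by simpa using hr₁.trans h₁))
  have hGc : ∀ᶠ u in 𝓝 (0 : ℂ × ℂ), G u ∈ polydisc r₁ r₂ := by
    have h3 := (hD.analyticAt_inverse 0 (by simpa using hR.le)).continuousAt.tendsto
    rw [hD.inverse_zero] at h3
    exact h3 ((isOpen_polydisc r₁ r₂).mem_nhds ⟨by simpa using hr₁, by simpa using hr₂⟩)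
  obtain ⟨β, hβ, hb⟩ := Metric.eventually_nhds_iff_ball.mp hGc
  obtain ⟨α₁, ⟨hα₁, hα₁'⟩, hp₁⟩ := ((hD.radial_fst r₁ hr₁).and self_mem_nhdsWithin).exists
  obtain ⟨α₂, ⟨hα₂, hα₂'⟩, hp₂⟩ := ((hD.radial_snd r₂ hr₂).and self_mem_nhdsWithin).exists
  have hs : Tendsto (fun a : ℂ => Real.sqrt ‖a‖) (𝓝 0) (𝓝 0) :=
    (by fun_prop : Continuous fun a : ℂ => Real.sqrt ‖a‖).tendsto' _ _ (by simp)
  filter_upwards [hs.eventually (gt_mem_nhds (lt_min (lt_min hR hβ) (lt_min hp₁ hp₂)))] with a ha' ha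
  rw [lt_min_iff, lt_min_iff, lt_min_iff] at ha'
  obtain ⟨⟨hqR, hqβ⟩, hq₁, hq₂⟩ := ha'
  have hna : 0 < ‖a‖ := norm_pos_iff.mpr ha
  -- On the line `Re ζ = m` both chart coordinates have modulus `√‖a‖`, so for small `a` its image
  -- lies well inside the polydisc.
  set m : ℝ := Real.log ‖a‖ / 2 with hm
  have hm2 : ‖a‖ = Real.exp (2 * m) := by
    rw [hm, mul_div_cancel₀ _ two_ne_zero, Real.exp_log hna]
  have hmq : Real.exp m = Real.sqrt ‖a‖ := by rw [hm, Real.exp_half, Real.exp_log hna]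
  rw [← hmq] at hqR hqβ hq₁ hq₂
  set u : ℂ → ℂ × ℂ := fun ζ => (Complex.exp ζ, a * Complex.exp (-ζ)) with hu
  have huc : Continuous u := by fun_prop
  have hu1 : ∀ ζ : ℂ, ‖(u ζ).1‖ = Real.exp ζ.re := fun ζ => Complex.norm_exp ζ
  have hu2 : ∀ ζ : ℂ, ‖(u ζ).2‖ = Real.exp (2 * m - ζ.re) := fun ζ => by
    simp only [hu]
    rw [norm_mul, Complex.norm_exp, hm2, ← Real.exp_add, Complex.neg_re, sub_eq_add_neg]
  have hu12 : ∀ ζ, (u ζ).1 * (u ζ).2 = a := fun ζ => by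
    simp only [hu]
    rw [mul_left_comm, ← Complex.exp_add, add_neg_cancel, Complex.exp_zero, mul_one]
  have hline : ∀ ζ : ℂ, ζ.re = m → ‖u ζ‖ = Real.exp m := fun ζ hζ => by
    rw [Prod.norm_def, hu1, hu2, hζ]
    ring_nf
    exact max_self _
  let S : Set ℂ := {ζ | ‖u ζ‖ < R ∧ G (u ζ) ∈ polydisc r₁ r₂}
  have hA₁ : ∀ u : ℂ × ℂ, ‖u‖ ≤ R → AnalyticAt ℂ (fun u => (G u).1) u := fun u hu =>
    analyticAt_fst.comp (hD.analyticAt_inverse u hu)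
  have hA₂ : ∀ u : ℂ × ℂ, ‖u‖ ≤ R → AnalyticAt ℂ (fun u => (G u).2) u := fun u hu =>
    analyticAt_snd.comp (hD.analyticAt_inverse u hu)
  refine ⟨S, fun ζ => ⟨G (u ζ), ζ.2.2, ?_⟩, ?_, ?_, ?_, ?_⟩
  · rw [(hD.apply_inverse _ ζ.2.1.le).self_of_nhds, hu12]
  · refine contractibleSpace_of_retract_line (m := m) (fun ζ hζ => ?_) fun ζ hζ s hs => ?_
    · have h3 := hline ζ hζ
      exact ⟨h3.trans_lt hqR, hb _ (mem_ball_zero_iff.mpr (h3.trans_lt hqβ))⟩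
    · have hζ1 := (le_max_left _ _).trans_lt hζ.1
      have hζ2 := (le_max_right _ _).trans_lt hζ.1
      refine ⟨max_lt ?_ ?_, ?_, ?_⟩
      · rw [hu1] at hζ1 ⊢
        have hre : (s + ζ.im * Complex.I : ℂ).re = s := by simp
        rw [hre]
        rcases le_max_iff.mp hs.2 with h3 | h3
        · exact (Real.exp_le_exp.mpr h3).trans_lt hqR
        · exact (Real.exp_le_exp.mpr h3).trans_lt hζ1
      · rw [hu2] at hζ2 ⊢
        have hre : (s + ζ.im * Complex.I : ℂ).re = s := by simp
        rw [hre]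
        rcases min_le_iff.mp hs.1 with h3 | h3
        · exact (Real.exp_le_exp.mpr (by linarith)).trans_lt hqR
        · exact (Real.exp_le_exp.mpr (by linarith)).trans_lt hζ2
      · exact norm_lt_of_exp_coordinates hA₁ hα₁ hα₁' hm2 hqR.le hq₁ hζ1.le hζ2.le hζ.2.1 hs
      · exact norm_lt_of_exp_coordinates hA₂ hα₂ hα₂' hm2 hqR.le hq₂ hζ1.le hζ2.le hζ.2.2 hs
  · refine Continuous.subtype_mk (continuous_iff_continuousAt.mpr fun ζ => ?_) _
    exact ContinuousAt.comp (g := G) (f := fun ζ : S => u ζ)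
      (hD.analyticAt_inverse _ ζ.2.1.le).continuousAt (by fun_prop)
  · intro ζ
    change (U (G (u ζ))).1 = _
    rw [hD.right_inverse _ ζ.2.1.le]
  · intro y ζ hζ
    have hy := norm_lt_of_mem_levelCurve h₁ h₂ y.2
    have h3 : u ζ = U y := by
      have h4 : Complex.exp ζ = (U y).1 := hζ
      have h5 : (U y).1 * (U y).2 = a := (hD.chart_mul y hy).trans y.2.2
      refine Prod.ext h4 ?_
      have h6 := (hu12 ζ).trans h5.symm
      rw [← h4] at h6
      exact mul_left_cancel₀ (Complex.exp_ne_zero ζ) h6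
    have h7 : G (u ζ) = y := by rw [h3, hD.left_inverse y hy]
    refine ⟨⟨?_, ?_⟩, Subtype.ext h7⟩
    · rw [h3]
      exact hD.norm_chart_lt y hy
    · rw [h7]
      exact y.2.1

end IsMorseDomain

end

/-! ### Orientation of loops and the period map. -/

noncomputable section

namespace IsMorseDomain

variable {H : ℂ × ℂ → ℂ} {U G : ℂ × ℂ → ℂ × ℂ} {f : MvPowerSeries (Fin 2) ℂ} {R ρ r₁ r₂ : ℝ}

/-- Along a loop where `y₁` runs once counterclockwise around a circle and `|y₂| < |y₁|`, the
logarithm of the first chart coordinate varies by `2iπ`. -/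
theorem logIncrement_circle (hD : IsMorseDomain H U G f R ρ) (h₁ : r₁ < ρ) (h₂ : r₂ < ρ) {a : ℂ}
    (ha : a ≠ 0) {q : levelCurve H r₁ r₂ a} {γ : Path q q} {s : ℝ} (hs : 0 < s)
    (hγ : ∀ t : unitInterval, (γ t).1.1 = s * Complex.exp (2 * Real.pi * Complex.I * (t : ℝ)) ∧
      ‖(γ t).1.2‖ < s) :
    logIncrement (hD.chartCoordinate h₁ h₂ ha) γ = 2 * Real.pi * Complex.I := by
  set e := hD.chartCoordinate h₁ h₂ ha
  have hs' : (s : ℂ) ≠ 0 := by exact_mod_cast hs.ne'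
  have hn : ∀ t, ‖(γ t).1.1‖ = s := by
    intro t
    rw [(hγ t).1, norm_mul_cexp_two_pi_mul_I hs.le]
  have h0 : ∀ t, (γ t).1.1 ≠ 0 := fun t => norm_pos_iff.mp (by rw [hn]; exact hs)
  -- Since `‖U₁ - y₁‖ ≤ s / 2 < s = ‖y₁‖`, the ratio stays in the disc of radius one about `1`. Its
  -- principal logarithm therefore closes up and adds nothing to the winding.
  have hslit : ∀ t, (e (γ t)).1 / (γ t).1.1 ∈ Complex.slitPlane := by
    intro t
    refine Complex.mem_slitPlane_of_norm_lt_one (z := (e (γ t)).1 / (γ t).1.1 - 1) ?_ |> fun h => by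
      simpa using h
    have h3 := hD.chart_near (γ t) (norm_lt_of_mem_levelCurve h₁ h₂ (γ t).2)
    have h4 : ‖((γ t).1 : ℂ × ℂ)‖ = s := by
      rw [Prod.norm_def, hn, max_eq_left (hγ t).2.le]
    rw [h4] at h3
    rw [div_sub_one (h0 t), norm_div, hn, div_lt_one hs]
    exact h3.trans_lt (half_lt_self hs)
  have hlog : Continuous fun t => Complex.log ((e (γ t)).1 / (γ t).1.1) := by
    refine Continuous.clog ?_ hslit
    exact (by fun_prop : Continuous fun t => (e (γ t)).1).div (by fun_prop) h0
  rw [logIncrement_eq (ζ := fun t => Complex.log s + 2 * Real.pi * Complex.I * (t : ℝ) +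
    Complex.log ((e (γ t)).1 / (γ t).1.1)) (by fun_prop) fun t => ?_]
  · simp
  · rw [Complex.exp_add, Complex.exp_add, Complex.exp_log hs',
      Complex.exp_log (div_ne_zero (e (γ t)).2 (h0 t)), ← (hγ t).1, mul_div_cancel₀ _ (h0 t)]

theorem exists_c1Loop (h₁ : 0 < r₁) (h₂ : 0 < r₂) {l : ℂ} (hl : l ≠ 0) (hH : AnalyticAt ℂ H 0)
    (hHl : (fun y : ℂ × ℂ => H y - l * (y.1 * y.2)) =o[𝓝 0] fun y : ℂ × ℂ => ‖y‖ ^ 2) :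
    ∀ᶠ a in 𝓝[≠] (0 : ℂ), ∃ (q : levelCurve H r₁ r₂ a) (γ : Path q q) (s : ℝ), IsC1Loop γ ∧
      0 < s ∧ ∀ t : unitInterval,
        (γ t).1.1 = s * Complex.exp (2 * Real.pi * Complex.I * (t : ℝ)) ∧ ‖(γ t).1.2‖ < s := by
  filter_upwards [exists_loop_of_saddle hl hH hHl (lt_min h₁ h₂)] with a ⟨s, hs, hsr, g, hg, h01, hga⟩
  have hn : ∀ t, ‖(g t).1‖ = s := by
    intro t
    rw [(hga t).1, norm_mul_cexp_two_pi_mul_I hs.le]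
  have hmem : ∀ t, g t ∈ levelCurve H r₁ r₂ a := fun t =>
    ⟨⟨by rw [hn]; exact hsr.trans_le (min_le_left _ _),
      (hga t).2.1.trans (hsr.trans_le (min_le_right _ _))⟩, (hga t).2.2⟩
  have hgc := hg.continuous
  refine ⟨⟨g 0, hmem 0⟩, ⟨⟨fun t => ⟨g t, hmem t⟩, by fun_prop⟩, Subtype.ext (by simp),
    Subtype.ext (by simp [h01])⟩, s, ?_, hs, fun t => ⟨(hga t).1, (hga t).2.1⟩⟩
  refine hg.contDiffOn.congr fun t ht => ?_
  rw [Path.extend_apply _ ht]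
  rfl

end IsMorseDomain

/-- The period map of a function with a saddle point: the opposite of the resonant part of the
Jacobian of the inverse Morse chart. -/
theorem IsMorseChart.isPeriodMap {H : ℂ × ℂ → ℂ} {l : ℂ} {U G : ℂ × ℂ → ℂ × ℂ} (hl : l ≠ 0)
    (hH : AnalyticAt ℂ H 0)
    (hHl : (fun y : ℂ × ℂ => H y - l * (y.1 * y.2)) =o[𝓝 0] fun y : ℂ × ℂ => ‖y‖ ^ 2)
    (hc : IsMorseChart H l U G) {f : MvPowerSeries (Fin 2) ℂ} (hf : HasGerm f (jacobianDet G)) :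
    IsPeriodMap H fun a => -∑' n, MvPowerSeries.coeff (pairExponent (n, n)) f * a ^ n := by
  obtain ⟨ε, hε, C, hC⟩ := hf.geomBounded
  obtain ⟨R, ρ, hR, hRε, hρ, hD⟩ := hc.exists_isMorseDomain hH hf hε
  refine ⟨ρ, hρ, fun r₁ r₂ hr₁ h₁ hr₂ h₂ => ⟨fun y hy =>
    hD.analyticAt_fun y (max_lt (hy.1.trans h₁) (hy.2.trans h₂)), ?_⟩⟩
  have hev := (hD.isLogChart h₁ h₂ hr₁ hr₂).filter_mono (nhdsWithin_le_nhds (s := {0}ᶜ)) |>.and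
    (IsMorseDomain.exists_c1Loop hr₁ hr₂ hl hH hHl)
  rw [eventually_nhdsWithin_iff, Metric.eventually_nhds_iff_ball] at hev
  obtain ⟨r, hr, hb⟩ := hev
  refine ⟨r, hr, fun a ha har => ?_⟩
  obtain ⟨hlc, q, γ₀, s, hγ₀, hs, hcirc⟩ := hb a (mem_ball_zero_iff.mpr har) ha
  obtain ⟨S, P, hSP⟩ := hlc ha
  -- Positive orientation amounts to an increment `2iπ`: every admissible circle has this increment,
  -- and loops with equal increments are homologous.
  have hpos : ∀ {p : levelCurve H r₁ r₂ a} {γ : Path p p}, PositivelyOriented γ ↔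
      logIncrement (hD.chartCoordinate h₁ h₂ ha) γ = 2 * Real.pi * Complex.I := by
    intro p γ
    constructor
    · rintro ⟨q', γ', s', hs', hcirc', hhom⟩
      rw [hSP.homologousLoops_iff.mp hhom, hD.logIncrement_circle h₁ h₂ ha hs' hcirc']
    · intro h
      refine ⟨q, γ₀, s, hs, hcirc, hSP.homologousLoops_iff.mpr ?_⟩
      rw [h, hD.logIncrement_circle h₁ h₂ ha hs hcirc]
  refine ⟨isPathConnected_iff_pathConnectedSpace.mpr hSP.pathConnectedSpace, ?_, ?_⟩
  · have h3 := hD.logIncrement_circle h₁ h₂ ha hs hcirc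
    exact ⟨q, γ₀, hγ₀, hSP.generatesH1_of_logIncrement h3, hpos.mpr h3⟩
  · intro p γ hγ
    refine ⟨?_, fun hC1 hor τ hτ => ?_⟩
    · rcases hSP.logIncrement_of_generatesH1 hγ with h3 | h3
      · exact Or.inl (hpos.mpr h3)
      · refine Or.inr (hpos.mpr ?_)
        rw [logIncrement_symm, h3, neg_neg]
    · have hw := hpos.mp hor
      have hy : ∀ t, ‖((γ t).1 : ℂ × ℂ)‖ < ρ := fun t =>
        IsMorseDomain.norm_lt_of_mem_levelCurve h₁ h₂ (γ t).2
      obtain ⟨ζ, hζ, -⟩ := exists_log_lift (hD.chartCoordinate h₁ h₂ ha) γ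
        (Complex.exp_log (hD.chartCoordinate h₁ h₂ ha p).2)
      rw [logIncrement_eq ζ.continuous hζ, sub_eq_iff_eq_add'] at hw
      refine loopPeriod_eq hC1 hε hC hR.le hRε hw (fun t => ?_)
        (fun t => hD.analyticAt_chart _ (hy t)) (fun t => (hD.norm_chart_lt _ (hy t)).le)
        (fun t => hD.left_inverse _ (hy t))
        (fun t => hD.analyticAt_inverse _ (hD.norm_chart_lt _ (hy t)).le)
        (fun t => hD.analyticAt_fun _ (hy t))
        (fun t => hD.apply_inverse _ (hD.norm_chart_lt _ (hy t)).le)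
        (fun t => hD.jacobian _ (hD.norm_chart_lt _ (hy t)).le) hτ
      have h4 : Complex.exp (ζ t) = (U (γ t)).1 := hζ t
      have h5 : (U (γ t)).1 * (U (γ t)).2 = a := (hD.chart_mul _ (hy t)).trans (γ t).2.2
      refine Prod.ext h4.symm ?_
      have h6 : (U (γ t)).1 ≠ 0 := h4 ▸ Complex.exp_ne_zero (ζ t)
      change (U (γ t)).2 = a * Complex.exp (-ζ t)
      rw [Complex.exp_neg, h4, eq_mul_inv_iff_mul_eq₀ h6, mul_comm, h5]

end

/-! ### The period map and the normal form read off one diagonal series. -/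

theorem mainTheorem10
    (Y : FormalField) (hY : Y.IsHamSaddleNode)
    (l : ℂ) (hl : l ≠ 0) (H : ℂ × ℂ → ℂ) (hH : AnalyticAt ℂ H 0)
    (hHl : (fun y : ℂ × ℂ => H y - l * (y.1 * y.2)) =o[𝓝 0] fun y : ℂ × ℂ => ‖y‖ ^ 2)
    (hY₀ : RestrictsToHam Y H) :
    ∃ T S h : ℂ → ℂ,
      -- the period map and its value at the origin
      IsPeriodMap H T ∧ AnalyticAt ℂ T 0 ∧ T 0 = -1 / l ∧
      -- `S` is the primitive of `T` vanishing at `0`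
      S 0 = 0 ∧ (∀ᶠ a in 𝓝 (0 : ℂ), HasDerivAt S (T a) a) ∧
      -- `h` is the inverse of `-S`
      AnalyticAt ℂ h 0 ∧ h 0 = 0 ∧
      (∀ᶠ v in 𝓝 (0 : ℂ), -S (h v) = v) ∧ (∀ᶠ a in 𝓝 (0 : ℂ), h (-S a) = a) ∧
      -- the invariant `c` of the normal form is analytic and `h' = l + c`
      ∀ (a₁ a₂ : ℂ) (c : PowerSeries ℂ), IsHamNormalForm Y l a₁ a₂ c →
        ∃ C : ℂ → ℂ, IsSumNearZero c C ∧
          ∀ᶠ v in 𝓝 (0 : ℂ), HasDerivAt h (l + C v) v := by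
  obtain ⟨U, G, hc⟩ := exists_isMorseChart hl hH hHl
  obtain ⟨f, hf⟩ := exists_hasGerm hc.analyticAt_inverse.jacobianDet
  obtain ⟨ε, hε, B, hB⟩ := hf.geomBounded
  have hf0 : MvPowerSeries.coeff (pairExponent (0, 0)) f = l⁻¹ := by
    have h0 : pairExponent (0, 0) = 0 := by simp [pairExponent]
    rw [h0, MvPowerSeries.coeff_zero_eq_constantCoeff_apply, hf.constantCoeff_eq,
      hc.jacobianDet_zero]
  -- The radius is `ε ^ 2` because the diagonal exponent `(n, n)` has total degree `2 n`. The germ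
  -- `g` is `-S`.
  obtain ⟨δ, g, h, hδ, hδa, hδ0, hg0, hg, hh, hh0, hgh, hhg, hcv⟩ := exists_inverse_of_primitive
    (d := fun n => MvPowerSeries.coeff (pairExponent (n, n)) f) (r := ε ^ 2) hl (by positivity)
    (fun n => by simpa [← pow_mul, two_mul] using hB (pairExponent (n, n))) hf0
  refine ⟨fun a => -δ a, fun a => -g a, h, ?_, hδa.neg, ?_, by simp [hg0], ?_, hh, hh0,
    by simpa using hgh, by simpa using hhg, ?_⟩
  · rw [hδ]
    exact hc.isPeriodMap hl hH hHl hf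
  · simp only [hδ0]
    rw [neg_div, one_div]
  · filter_upwards [hg] with a ha using ha.neg
  · intro a₁ a₂ c hn
    obtain ⟨p, hp0, hp, hpc⟩ := hc.exists_inverse_primitive hl hH hY₀ hn hf
    exact hcv p c hp0 hp hpc
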